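/- Let $N\in\{1,2,3\}$, let $\Omega\subset\mathbb R^N$ be a bounded Lipschitz domain, $T>0$, $\mu>0$, $\lambda\ge 0$ (with $\lambda>0$ if $N=1$), $a>0$, $\gamma>1$, $q\in C_c^\infty(0,\infty)$, and put $$p(\varrho)=a\varrho^\gamma+q(\varrho),\quad \mathbb S(\nabla u)=\mu\Big(\nabla u+\nabla^t u-\tfrac2N\operatorname{div}u\,\mathbb I\Big)+\lambda\operatorname{div}u\,\mathbb I,\quad P(\varrho)=\frac{a}{\gamma-1}\varrho^\gamma+\varrho\int_1^\varrho\frac{q(z)}{z^2}\,dz .$$ Consider the compressible Navier--Stokes system $$\partial_t\varrho+\operatorname{div}(\varrho u)=0,\qquad \partial_t(\varrho u)+\operatorname{div}(\varrho u\otimes u)+\nabla p(\varrho)=\operatorname{div}\mathbb S(\nabla u),\qquad u|_{\partial\Omega}=0. \tag{NS}$$ A pair $[\varrho,u]$ is a dissipative weak solution on $[0,T]$ if $\varrho\ge 0$, $\varrho\in L^\infty(0,T;L^\gamma(\Omega))$, $u\in L^2(0,T;W^{1,2}_0(\Omega;\mathbb R^N))$, $\varrho u\in L^\infty(0,T;L^{2\gamma/(\gamma+1)}(\Omega;\mathbb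 R^N))$, the instantaneous values $\varrho(\tau,\cdot)$ and $(\varrho u)(\tau,\cdot)$ are integrable functions on $\Omega$ for every $\tau\in[0,T]$, and: (i) for all $\tau\in[0,T]$ and $\varphi\in C^1([0,T]\times\overline\Omega)$, $$\Big[\int_\Omega\varrho\varphi\,dx\Big]_{t=0}^{t=\tau}=\int_0^\tau\!\!\int_\Omega\big[\varrho\,\partial_t\varphi+\varrho u\cdot\nabla\varphi\big]\,dx\,dt;$$ (ii) for all $\tau\in[0,T]$ and $\phi\in C^1([0,T]\times\overline\Omega;\mathbb R^N)$ with $\phi|_{\partial\Omega}=0$, $$\Big[\int_\Omega\varrho u\cdot\phi\,dx\Big]_{t=0}^{t=\tau}=\int_0^\tau\!\!\int_\Omega\big[\varrho u\cdot\partial_t\phi+\varrho u\otimes u:\nabla\phi+p(\varrho)\operatorname{div}\phi\big]\,dx\,dt-\int_0^\tau\!\!\int_\Omega\mathbb S(\nabla u):\nabla\phi\,dx\,dt;$$ (iii) for all $\tau\in[0,T]$, $\varphi\in C^1([0,T]\times\overline\Omega)$ and $b\in C^1[0,\infty)$ with $b'\in C_c[0,\infty)$, $$\Big[\int_\Omega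 b(\varrho)\varphi\,dx\Big]_{t=0}^{t=\tau}=\int_0^\tau\!\!\int_\Omega\big[b(\varrho)\partial_t\varphi+b(\varrho)u\cdot\nabla\varphi+(b(\varrho)-b'(\varrho)\varrho)\operatorname{div}u\,\varphi\big]\,dx\,dt;$$ (iv) the energy $\int_\Omega\big(\tfrac12\varrho|u|^2+P(\varrho)\big)dx$ is finite at $t=0$ and at almost all times, and for almost all $\tau\in(0,T)$, $$\Big[\int_\Omega\big(\tfrac12\varrho|u|^2+P(\varrho)\big)\,dx\Big]_{t=0}^{t=\tau}+\int_0^\tau\!\!\int_\Omega\mathbb S(\nabla u):\nabla u\,dx\,dt\le 0 .$$ A pair $[r,U]$ is a classical solution on $[0,T]$ if $r\in C^1([0,T]\times\overline\Omega)$, $r\ge0$, $U\in C^1([0,T]\times\overline\Omega;\mathbb R^N)$, $U|_{\partial\Omega}=0$, $U(t,\cdot)\in C^2(\Omega)$ for each $t\in(0,T)$, and (NS) holds for $[r,U]$ at every point of $(0,T)\times\Omega$. **Theorem 1.** Let $[\varrho,u]$ be a dissipative weak solution and $[r,U]$ a classical solution of (NS) on $[0,T]$ such that $$\varrho(0,\cdot)=r(0,\cdot),\qquad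 (\varrho u)(0,\cdot)=r(0,\cdot)U(0,\cdot)\quad\text{a.e. in }\Omega,\qquad r(0,\cdot)>0\ \text{ on }\overline\Omega .$$ Then $\varrho=r$ and $u=U$ almost everywhere in $(0,T)\times\Omega$. -/

import Mathlib

open MeasureTheory Set Filter Topology
open scoped ENNReal ContDiff

noncomputable section

namespace CompressibleNS

/-- Euclidean space `ℝ^N`. -/
abbrev Eucl (N : ℕ) : Type := EuclideanSpace ℝ (Fin N)

/-- The `j`-th vector of the standard basis. -/
def stdVec {N : ℕ} (j : Fin N) : Eucl N := EuclideanSpace.single j (1 : ℝ)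

/-! ### Lipschitz domains -/

/-- Bounded Lipschitz domain: a bounded, open, connected (nonempty) set which near each of its
boundary points is, for a suitable unit vector `e`, the part strictly above the graph over the
hyperplane `e^⊥` of a Lipschitz function (`x - ⟪e, x⟫ e` is the projection of `x` onto `e^⊥`). -/
structure IsBoundedLipschitzDomain {N : ℕ} (Ω : Set (Eucl N)) : Prop where
  isOpen : IsOpen Ω
  isConnected : IsConnected Ω
  isBounded : Bornology.IsBounded Ω
  boundary_graph : ∀ x₀ ∈ frontier Ω, ∃ e : Eucl N, ‖e‖ = 1 ∧
    ∃ g : Eucl N → ℝ, (∃ K : NNReal, LipschitzWith K g) ∧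
      ∃ δ : ℝ, 0 < δ ∧ ∀ x ∈ Metric.ball x₀ δ,
        (x ∈ Ω ↔ g (x - (inner ℝ e x : ℝ) • e) < (inner ℝ e x : ℝ))

/-! ### Tensor algebra and the constitutive relations

A tensor is a linear map; the velocity gradient is `fderiv ℝ u x`, that is `(∇u)_{ij} = ∂_j u_i`. -/

/-- Trace of a tensor; `tr (∇u) = div u`. -/
def tr {N : ℕ} (A : Eucl N →L[ℝ] Eucl N) : ℝ := ∑ j, (A (stdVec j)) j

/-- The scalar product `A : B = ∑_{i,j} A_{ij} B_{ij}` of two tensors. -/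
def frob {N : ℕ} (A B : Eucl N →L[ℝ] Eucl N) : ℝ :=
  ∑ i, ∑ j, (A (stdVec j)) i * (B (stdVec j)) i

/-- The tensor `v ⊗ w`. -/
def tensor {N : ℕ} (v w : Eucl N) : Eucl N →L[ℝ] Eucl N := (innerSL ℝ w).smulRight v

/-- Divergence of a tensor field, `(div M)_i = ∑_j ∂_j M_{ij}`. -/
def tensorDiv {N : ℕ} (M : Eucl N → (Eucl N →L[ℝ] Eucl N)) (x : Eucl N) : Eucl N :=
  ∑ j, (fderiv ℝ M x (stdVec j)) (stdVec j)

/-- Newton's viscous stress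
`S(A) = μ (A + Aᵗ - (2/N) tr(A) I) + lam tr(A) I`. -/
def stress {N : ℕ} (μ lam : ℝ) (A : Eucl N →L[ℝ] Eucl N) : Eucl N →L[ℝ] Eucl N :=
  μ • (A + ContinuousLinearMap.adjoint A
      - ((2 / (N : ℝ)) * tr A) • ContinuousLinearMap.id ℝ (Eucl N))
    + (lam * tr A) • ContinuousLinearMap.id ℝ (Eucl N)

/-- `q ∈ C_c^∞(0,∞)`. -/
def IsTestOnPos (q : ℝ → ℝ) : Prop :=
  ContDiff ℝ ∞ q ∧ HasCompactSupport q ∧ tsupport q ⊆ Ioi 0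

/-- The pressure `p(ρ) = a ρ^γ + q(ρ)`. -/
def pressure (a γ : ℝ) (q : ℝ → ℝ) (s : ℝ) : ℝ := a * s ^ γ + q s

/-- The pressure potential `P(ρ) = a/(γ-1) ρ^γ + ρ ∫_1^ρ q(z)/z² dz`. -/
def pressurePotential (a γ : ℝ) (q : ℝ → ℝ) (s : ℝ) : ℝ :=
  a / (γ - 1) * s ^ γ + s * ∫ z in (1 : ℝ)..s, q z / z ^ 2

/-- The energy density `½ ρ |u|² + P(ρ)`. -/
def energyDensity {N : ℕ} (a γ : ℝ) (q : ℝ → ℝ) (s : ℝ) (v : Eucl N) : ℝ :=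
  1 / 2 * s * ‖v‖ ^ 2 + pressurePotential a γ q s

/-! ### Function spaces -/

/-- `f ∈ C¹([0,T] × Ω̄)`: differentiable relative to the closed set, with continuous derivative. -/
def IsC1 {N : ℕ} {F : Type*} [NormedAddCommGroup F] [NormedSpace ℝ F]
    (Ω : Set (Eucl N)) (T : ℝ) (f : ℝ → Eucl N → F) : Prop :=
  ContDiffOn ℝ 1 (fun z : ℝ × Eucl N => f z.1 z.2) (Icc 0 T ×ˢ closure Ω)

/-- `f` vanishes on `∂Ω` for all times in `[0,T]`. -/
def VanishesOnBoundary {N : ℕ} (Ω : Set (Eucl N)) (T : ℝ) (f : ℝ → Eucl N → Eucl N) : Prop :=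
  ∀ t ∈ Icc (0 : ℝ) T, ∀ x ∈ frontier Ω, f t x = 0

/-- `v ∈ W^{1,2}_0(Ω; ℝ^N)` with weak gradient `G`: the pair `(v, G)` is the limit in `L²(Ω)` of
pairs `(φ, ∇φ)` with `φ ∈ C_c^∞(Ω; ℝ^N)`. -/
def MemW012 {N : ℕ} (Ω : Set (Eucl N)) (v : Eucl N → Eucl N)
    (G : Eucl N → (Eucl N →L[ℝ] Eucl N)) : Prop :=
  MemLp v 2 (volume.restrict Ω) ∧ MemLp G 2 (volume.restrict Ω) ∧
  ∃ φ : ℕ → Eucl N → Eucl N,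
    (∀ n, ContDiff ℝ ∞ (φ n) ∧ HasCompactSupport (φ n) ∧ tsupport (φ n) ⊆ Ω) ∧
    Tendsto (fun n => eLpNorm (fun x => φ n x - v x) 2 (volume.restrict Ω)) atTop (𝓝 0) ∧
    Tendsto (fun n => eLpNorm (fun x => fderiv ℝ (φ n) x - G x) 2 (volume.restrict Ω))
      atTop (𝓝 0)

/-- The space-time cylinder `(0,T) × Ω`. -/
def cylinder {N : ℕ} (Ω : Set (Eucl N)) (T : ℝ) : Set (ℝ × Eucl N) := Ioo 0 T ×ˢ Ω

/-- `f ∈ L^∞(0,T; L^s(Ω))`. -/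
def MemLinftyLp {N : ℕ} {F : Type*} [NormedAddCommGroup F]
    (Ω : Set (Eucl N)) (T s : ℝ) (f : ℝ → Eucl N → F) : Prop :=
  AEStronglyMeasurable (fun z : ℝ × Eucl N => f z.1 z.2) (volume.restrict (cylinder Ω T)) ∧
  ∃ C : NNReal, ∀ᵐ t ∂(volume.restrict (Ioo 0 T)),
    eLpNorm (f t) (ENNReal.ofReal s) (volume.restrict Ω) ≤ C

/-- `u ∈ L²(0,T; W^{1,2}_0(Ω; ℝ^N))` with spatial weak gradient `Du`. -/
def MemL2W012 {N : ℕ} (Ω : Set (Eucl N)) (T : ℝ) (u : ℝ → Eucl N → Eucl N)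
    (Du : ℝ → Eucl N → (Eucl N →L[ℝ] Eucl N)) : Prop :=
  MemLp (fun z : ℝ × Eucl N => u z.1 z.2) 2 (volume.restrict (cylinder Ω T)) ∧
  MemLp (fun z : ℝ × Eucl N => Du z.1 z.2) 2 (volume.restrict (cylinder Ω T)) ∧
  ∀ᵐ t ∂(volume.restrict (Ioo 0 T)), MemW012 Ω (u t) (Du t)

/-! ### Weak formulation -/

/-- Weak form of the equation of continuity. -/
def WeakContinuity {N : ℕ} (Ω : Set (Eucl N)) (T : ℝ)
    (ρ : ℝ → Eucl N → ℝ) (u : ℝ → Eucl N → Eucl N) : Prop :=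
  ∀ φ : ℝ → Eucl N → ℝ, IsC1 Ω T φ → ∀ τ ∈ Icc (0 : ℝ) T,
    (∫ x in Ω, ρ τ x * φ τ x) - (∫ x in Ω, ρ 0 x * φ 0 x) =
      ∫ t in (0 : ℝ)..τ, ∫ x in Ω,
        (ρ t x * deriv (fun s => φ s x) t + ρ t x * fderiv ℝ (φ t) x (u t x))

/-- Weak form of the momentum equation. -/
def WeakMomentum {N : ℕ} (Ω : Set (Eucl N)) (T μ lam a γ : ℝ) (q : ℝ → ℝ)
    (ρ : ℝ → Eucl N → ℝ) (u : ℝ → Eucl N → Eucl N)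
    (Du : ℝ → Eucl N → (Eucl N →L[ℝ] Eucl N)) : Prop :=
  ∀ φ : ℝ → Eucl N → Eucl N, IsC1 Ω T φ → VanishesOnBoundary Ω T φ → ∀ τ ∈ Icc (0 : ℝ) T,
    (∫ x in Ω, (inner ℝ (ρ τ x • u τ x) (φ τ x) : ℝ))
        - (∫ x in Ω, (inner ℝ (ρ 0 x • u 0 x) (φ 0 x) : ℝ)) =
      (∫ t in (0 : ℝ)..τ, ∫ x in Ω,
        ((inner ℝ (ρ t x • u t x) (deriv (fun s => φ s x) t) : ℝ)
          + frob (tensor (ρ t x • u t x) (u t x)) (fderiv ℝ (φ t) x)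
          + pressure a γ q (ρ t x) * tr (fderiv ℝ (φ t) x)))
      - ∫ t in (0 : ℝ)..τ, ∫ x in Ω, frob (stress μ lam (Du t x)) (fderiv ℝ (φ t) x)

/-- Renormalized equation of continuity, for all `b ∈ C¹[0,∞)` with `b' ∈ C_c[0,∞)`. -/
def RenormalizedContinuity {N : ℕ} (Ω : Set (Eucl N)) (T : ℝ)
    (ρ : ℝ → Eucl N → ℝ) (u : ℝ → Eucl N → Eucl N)
    (Du : ℝ → Eucl N → (Eucl N →L[ℝ] Eucl N)) : Prop :=
  ∀ b : ℝ → ℝ, ContDiffOn ℝ 1 b (Ici 0) →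
    (∃ R : ℝ, ∀ s : ℝ, R ≤ s → derivWithin b (Ici 0) s = 0) →
  ∀ φ : ℝ → Eucl N → ℝ, IsC1 Ω T φ → ∀ τ ∈ Icc (0 : ℝ) T,
    (∫ x in Ω, b (ρ τ x) * φ τ x) - (∫ x in Ω, b (ρ 0 x) * φ 0 x) =
      ∫ t in (0 : ℝ)..τ, ∫ x in Ω,
        (b (ρ t x) * deriv (fun s => φ s x) t
          + b (ρ t x) * fderiv ℝ (φ t) x (u t x)
          + (b (ρ t x) - derivWithin b (Ici 0) (ρ t x) * ρ t x) * tr (Du t x) * φ t x)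

/-- Energy inequality, for almost all times; the energy is finite at the initial time and at
almost all times. -/
def EnergyInequality {N : ℕ} (Ω : Set (Eucl N)) (T μ lam a γ : ℝ) (q : ℝ → ℝ)
    (ρ : ℝ → Eucl N → ℝ) (u : ℝ → Eucl N → Eucl N)
    (Du : ℝ → Eucl N → (Eucl N →L[ℝ] Eucl N)) : Prop :=
  IntegrableOn (fun x => energyDensity a γ q (ρ 0 x) (u 0 x)) Ω ∧
  ∀ᵐ τ ∂(volume.restrict (Ioo 0 T)),
    IntegrableOn (fun x => energyDensity a γ q (ρ τ x) (u τ x)) Ω ∧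
    (∫ x in Ω, energyDensity a γ q (ρ τ x) (u τ x))
        - (∫ x in Ω, energyDensity a γ q (ρ 0 x) (u 0 x))
      + (∫ t in (0 : ℝ)..τ, ∫ x in Ω, frob (stress μ lam (Du t x)) (Du t x)) ≤ 0

/-- Dissipative weak solution `[ρ, u]` on `[0,T]`. The density `ρ(t,·)` and the momentum
`(ρu)(t,·)` are the instantaneous values that enter the integral identities at each
`t ∈ [0,T]`; `u(t,·)` lies in `W^{1,2}_0` for almost all `t` only. -/
def IsDissipativeWeakSolution {N : ℕ} (Ω : Set (Eucl N)) (T μ lam a γ : ℝ) (q : ℝ → ℝ)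
    (ρ : ℝ → Eucl N → ℝ) (u : ℝ → Eucl N → Eucl N) : Prop :=
  (∀ t ∈ Icc (0 : ℝ) T, IntegrableOn (ρ t) Ω ∧ IntegrableOn (fun x => ρ t x • u t x) Ω) ∧
  (∀ t ∈ Icc (0 : ℝ) T, ∀ᵐ x ∂(volume.restrict Ω), 0 ≤ ρ t x) ∧
  MemLinftyLp Ω T γ ρ ∧
  MemLinftyLp Ω T (2 * γ / (γ + 1)) (fun t x => ρ t x • u t x) ∧
  ∃ Du : ℝ → Eucl N → (Eucl N →L[ℝ] Eucl N),
    MemL2W012 Ω T u Du ∧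
    WeakContinuity Ω T ρ u ∧
    WeakMomentum Ω T μ lam a γ q ρ u Du ∧
    RenormalizedContinuity Ω T ρ u Du ∧
    EnergyInequality Ω T μ lam a γ q ρ u Du

/-! ### Classical solutions -/

/-- Classical solution `[r, U]` on `[0,T]`: `r, U ∈ C¹([0,T] × Ω̄)`, `r ≥ 0`, `U = 0` on `∂Ω`,
`U(t,·)` twice continuously differentiable in `Ω`, and the equations hold at every point
of `(0,T) × Ω`. -/
structure IsClassicalSolution {N : ℕ} (Ω : Set (Eucl N)) (T μ lam a γ : ℝ) (q : ℝ → ℝ)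
    (r : ℝ → Eucl N → ℝ) (U : ℝ → Eucl N → Eucl N) : Prop where
  density_C1 : IsC1 Ω T r
  velocity_C1 : IsC1 Ω T U
  density_nonneg : ∀ t ∈ Icc (0 : ℝ) T, ∀ x ∈ closure Ω, 0 ≤ r t x
  no_slip : VanishesOnBoundary Ω T U
  velocity_C2 : ∀ t ∈ Ioo (0 : ℝ) T, ContDiffOn ℝ 2 (U t) Ω
  continuity_eq : ∀ t ∈ Ioo (0 : ℝ) T, ∀ x ∈ Ω,
    deriv (fun s => r s x) t + tr (fderiv ℝ (fun y => r t y • U t y) x) = 0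
  momentum_eq : ∀ t ∈ Ioo (0 : ℝ) T, ∀ x ∈ Ω,
    deriv (fun s => r s x • U s x) t
        + tensorDiv (fun y => tensor (r t y • U t y) (U t y)) x
        + gradient (fun y => pressure a γ q (r t y)) x
      = tensorDiv (fun y => stress μ lam (fderiv ℝ (U t) y)) x

end CompressibleNS

end

/-
The relative energy of `[ρ, u]` with respect to `[r, U]`, the integral of
`½ ρ |u - U|² + (Bregman distance of the isentropic potential between ρ and r)`, vanishes at time
zero and controls the distance of the two flows. A minimum principle along the transport equation
keeps `r` positive on the closed domain, so `½ |U|² - h(r)`, with `h` the derivative of the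
isentropic potential, and `U` are admissible test functions for the mass and momentum balances of
`[ρ, u]`. Subtracting the results from the energy inequality bounds the relative energy by the
integral of a remainder minus the viscous dissipation of `u - U`. All remainder terms are quadratic
in the difference of the flows; what the relative energy does not control, the forcing where `ρ`
lacks a lower bound and the non-monotone part `q` of the pressure, is absorbed by the dissipation
through a Korn-Poincaré inequality, and Grönwall's lemma applies.
-/

noncomputable section

namespace CompressibleNS

section SpaceTimeCylinder

theorem exists_nhdsWithin_norm_fderiv_le {X F : Type*} [NormedAddCommGroup X] [NormedSpace ℝ X]
    [NormedAddCommGroup F] [NormedSpace ℝ F] {K O : Set X} (hO : IsOpen O) (hOK : O ⊆ K)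
    {f : X → F} {x : X} (hx : x ∈ K) (hf : ContDiffWithinAt ℝ 1 f K x) :
    ∃ s ∈ 𝓝[K] x, ∃ C : ℝ, ∀ z ∈ s, z ∈ O → ‖fderiv ℝ f z‖ ≤ C := by
  obtain ⟨v, hv, -, f', hf', hf'c⟩ :=
    (contDiffWithinAt_succ_iff_hasFDerivWithinAt (n := 0) (by simp)).1 (by simpa using hf)
  rw [insert_eq_of_mem hx] at hv
  have hbound : ∀ᶠ y in 𝓝[K] x, y ∈ v → ‖f' y‖ < ‖f' x‖ + 1 := by
    have := hf'c.continuousWithinAt.norm.eventually_lt_const (lt_add_one ‖f' x‖)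
    rw [eventually_nhdsWithin_iff] at this ⊢
    filter_upwards [this] with y hy _ hyv using hy hyv
  obtain ⟨V, hV, hxV, hVv⟩ := mem_nhdsWithin.1 hv
  refine ⟨_, inter_mem hbound (mem_nhdsWithin_of_mem_nhds (hV.mem_nhds hxV)), ‖f' x‖ + 1,
    fun z hz hzO => ?_⟩
  have hvz : v ∈ 𝓝 z := mem_of_superset ((hV.inter hO).mem_nhds ⟨hz.2, hzO⟩)
    fun y hy => hVv ⟨hy.1, hOK hy.2⟩
  rw [((hf' z (mem_of_mem_nhds hvz)).hasFDerivAt hvz).fderiv]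
  exact (hz.1 (mem_of_mem_nhds hvz)).le

-- `f` may fail to be differentiable at points of `K \ O`, so `fderiv ℝ f` need not be continuous
-- on `K` and the extreme value theorem does not apply to it.
theorem exists_bound_fderiv_of_contDiffOn {X F : Type*} [NormedAddCommGroup X] [NormedSpace ℝ X]
    [NormedAddCommGroup F] [NormedSpace ℝ F] {K O : Set X} (hK : IsCompact K) (hO : IsOpen O)
    (hOK : O ⊆ K) {f : X → F} (hf : ContDiffOn ℝ 1 f K) :
    ∃ C : ℝ, ∀ z ∈ O, ‖fderiv ℝ f z‖ ≤ C := by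
  obtain ⟨C, hC⟩ : ∃ C : ℝ, ∀ z ∈ K, z ∈ O → ‖fderiv ℝ f z‖ ≤ C := by
    refine hK.induction_on (p := fun s => ∃ C : ℝ, ∀ z ∈ s, z ∈ O → ‖fderiv ℝ f z‖ ≤ C)
      ⟨0, by simp⟩ ?_ ?_ fun x hx => exists_nhdsWithin_norm_fderiv_le hO hOK hx (hf x hx)
    · rintro s t hst ⟨C, hC⟩
      exact ⟨C, fun z hz => hC z (hst hz)⟩
    · rintro s t ⟨C, hC⟩ ⟨D, hD⟩
      refine ⟨max C D, ?_⟩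
      rintro z (hz | hz) hzO
      · exact (hC z hz hzO).trans (le_max_left _ _)
      · exact (hD z hz hzO).trans (le_max_right _ _)
  exact ⟨C, fun z hz => hC z (hOK hz) hz⟩

variable {N : ℕ} {F : Type*} [NormedAddCommGroup F] [NormedSpace ℝ F]
  {Ω : Set (Eucl N)} {T : ℝ} {f : ℝ → Eucl N → F}

theorem isOpen_cylinder (hΩ : IsOpen Ω) : IsOpen (cylinder Ω T) := isOpen_Ioo.prod hΩ

theorem cylinder_subset_Icc_prod_closure : cylinder Ω T ⊆ Icc 0 T ×ˢ closure Ω :=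
  prod_mono Ioo_subset_Icc_self subset_closure

theorem isCompact_Icc_prod_closure (hb : Bornology.IsBounded Ω) :
    IsCompact (Icc (0 : ℝ) T ×ˢ closure Ω) :=
  isCompact_Icc.prod hb.isCompact_closure

theorem IsC1.continuousOn (hf : IsC1 Ω T f) :
    ContinuousOn (fun z : ℝ × Eucl N => f z.1 z.2) (Icc 0 T ×ˢ closure Ω) :=
  ContDiffOn.continuousOn hf

theorem IsC1.exists_bound (hf : IsC1 Ω T f) (hb : Bornology.IsBounded Ω) :
    ∃ C : ℝ, ∀ t ∈ Icc (0 : ℝ) T, ∀ x ∈ closure Ω, ‖f t x‖ ≤ C := by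
  obtain ⟨C, hC⟩ := (isCompact_Icc_prod_closure hb).exists_bound_of_continuousOn hf.continuousOn
  exact ⟨C, fun t ht x hx => hC (t, x) ⟨ht, hx⟩⟩

theorem IsC1.continuousOn_slice (hf : IsC1 Ω T f) {t : ℝ} (ht : t ∈ Icc (0 : ℝ) T) :
    ContinuousOn (f t) (closure Ω) :=
  hf.continuousOn.comp (f := fun x => (t, x)) (by fun_prop) fun _ hx => ⟨ht, hx⟩

theorem IsC1.continuousOn_time (hf : IsC1 Ω T f) {x : Eucl N} (hx : x ∈ closure Ω) :
    ContinuousOn (fun t => f t x) (Icc 0 T) :=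
  hf.continuousOn.comp (f := fun t => (t, x)) (by fun_prop) fun _ ht => ⟨ht, hx⟩

theorem IsC1.contDiffOn_slice (hf : IsC1 Ω T f) {t : ℝ} (ht : t ∈ Icc (0 : ℝ) T) :
    ContDiffOn ℝ 1 (f t) (closure Ω) :=
  ContDiffOn.comp (g := fun z : ℝ × Eucl N => f z.1 z.2) (f := fun x => (t, x)) hf
    (by fun_prop) fun _ hx => ⟨ht, hx⟩

theorem IsC1.hasFDerivAt (hf : IsC1 Ω T f) (hΩ : IsOpen Ω) {t : ℝ} {x : Eucl N}
    (ht : t ∈ Ioo 0 T) (hx : x ∈ Ω) :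
    HasFDerivAt (fun z : ℝ × Eucl N => f z.1 z.2)
      (fderiv ℝ (fun z : ℝ × Eucl N => f z.1 z.2) (t, x)) (t, x) := by
  have hnhds : Icc 0 T ×ˢ closure Ω ∈ 𝓝 (t, x) :=
    mem_of_superset ((isOpen_cylinder hΩ).mem_nhds ⟨ht, hx⟩) cylinder_subset_Icc_prod_closure
  exact ((ContDiffOn.contDiffAt hf hnhds).differentiableAt one_ne_zero).hasFDerivAt

theorem IsC1.hasDerivAt_fderiv_apply (hf : IsC1 Ω T f) (hΩ : IsOpen Ω) {t : ℝ} {x : Eucl N}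
    (ht : t ∈ Ioo 0 T) (hx : x ∈ Ω) :
    HasDerivAt (fun s => f s x)
      (fderiv ℝ (fun z : ℝ × Eucl N => f z.1 z.2) (t, x) (1, 0)) t :=
  (hf.hasFDerivAt hΩ ht hx).comp_hasDerivAt (f := fun s => (s, x)) t
    ((hasDerivAt_id t).prodMk (hasDerivAt_const t x))

theorem IsC1.hasFDerivAt_fderiv_comp_inr (hf : IsC1 Ω T f) (hΩ : IsOpen Ω) {t : ℝ} {x : Eucl N}
    (ht : t ∈ Ioo 0 T) (hx : x ∈ Ω) :
    HasFDerivAt (f t)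
      ((fderiv ℝ (fun z : ℝ × Eucl N => f z.1 z.2) (t, x)).comp
        (ContinuousLinearMap.inr ℝ ℝ (Eucl N))) x :=
  (hf.hasFDerivAt hΩ ht hx).comp x (hasFDerivAt_prodMk_right t x)

theorem IsC1.hasDerivAt_time (hf : IsC1 Ω T f) (hΩ : IsOpen Ω) {t : ℝ} {x : Eucl N}
    (ht : t ∈ Ioo 0 T) (hx : x ∈ Ω) :
    HasDerivAt (fun s => f s x) (deriv (fun s => f s x) t) t :=
  (hf.hasDerivAt_fderiv_apply hΩ ht hx).differentiableAt.hasDerivAt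

theorem IsC1.hasFDerivAt_slice (hf : IsC1 Ω T f) (hΩ : IsOpen Ω) {t : ℝ} {x : Eucl N}
    (ht : t ∈ Ioo 0 T) (hx : x ∈ Ω) :
    HasFDerivAt (f t) (fderiv ℝ (f t) x) x :=
  (hf.hasFDerivAt_fderiv_comp_inr hΩ ht hx).differentiableAt.hasFDerivAt

theorem IsC1.continuousOn_fderiv (hf : IsC1 Ω T f) (hΩ : IsOpen Ω) :
    ContinuousOn (fderiv ℝ (fun z : ℝ × Eucl N => f z.1 z.2)) (cylinder Ω T) :=
  (ContDiffOn.mono hf cylinder_subset_Icc_prod_closure).continuousOn_fderiv_of_isOpen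
    (isOpen_cylinder hΩ) le_rfl

theorem IsC1.continuousOn_deriv_time (hf : IsC1 Ω T f) (hΩ : IsOpen Ω) :
    ContinuousOn (fun z : ℝ × Eucl N => deriv (fun s => f s z.2) z.1) (cylinder Ω T) :=
  ((hf.continuousOn_fderiv hΩ).clm_apply continuousOn_const).congr fun _ hz =>
    (hf.hasDerivAt_fderiv_apply hΩ hz.1 hz.2).deriv

theorem IsC1.continuousOn_fderiv_slice (hf : IsC1 Ω T f) (hΩ : IsOpen Ω) :
    ContinuousOn (fun z : ℝ × Eucl N => fderiv ℝ (f z.1) z.2) (cylinder Ω T) :=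
  ((hf.continuousOn_fderiv hΩ).clm_comp continuousOn_const).congr fun _ hz =>
    (hf.hasFDerivAt_fderiv_comp_inr hΩ hz.1 hz.2).fderiv

theorem IsC1.exists_bound_deriv_time (hf : IsC1 Ω T f) (hΩ : IsOpen Ω)
    (hb : Bornology.IsBounded Ω) :
    ∃ C : ℝ, ∀ t ∈ Ioo 0 T, ∀ x ∈ Ω, ‖deriv (fun s => f s x) t‖ ≤ C := by
  obtain ⟨C, hC⟩ := exists_bound_fderiv_of_contDiffOn (isCompact_Icc_prod_closure hb)
    (isOpen_cylinder hΩ) cylinder_subset_Icc_prod_closure hf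
  refine ⟨C, fun t ht x hx => ?_⟩
  rw [(hf.hasDerivAt_fderiv_apply hΩ ht hx).deriv]
  exact ((ContinuousLinearMap.unit_le_opNorm _ _ (by simp)).trans (hC _ ⟨ht, hx⟩))

theorem IsC1.exists_bound_fderiv_slice (hf : IsC1 Ω T f) (hΩ : IsOpen Ω)
    (hb : Bornology.IsBounded Ω) :
    ∃ C : ℝ, ∀ t ∈ Ioo 0 T, ∀ x ∈ Ω, ‖fderiv ℝ (f t) x‖ ≤ C := by
  obtain ⟨C, hC⟩ := exists_bound_fderiv_of_contDiffOn (isCompact_Icc_prod_closure hb)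
    (isOpen_cylinder hΩ) cylinder_subset_Icc_prod_closure hf
  refine ⟨C, fun t ht x hx => ?_⟩
  rw [(hf.hasFDerivAt_fderiv_comp_inr hΩ ht hx).fderiv]
  exact (ContinuousLinearMap.opNorm_comp_le _ _).trans <|
    (mul_le_of_le_one_right (norm_nonneg _)
      (ContinuousLinearMap.norm_inr_le_one ℝ ℝ (Eucl N))).trans (hC _ ⟨ht, hx⟩)

theorem memLp_top_of_continuousOn_cylinder {G : Type*} [NormedAddCommGroup G]
    [SecondCountableTopologyEither (ℝ × Eucl N) G] {g : ℝ × Eucl N → G} (hΩ : IsOpen Ω)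
    (hg : ContinuousOn g (cylinder Ω T)) {C : ℝ}
    (hC : ∀ t ∈ Ioo 0 T, ∀ x ∈ Ω, ‖g (t, x)‖ ≤ C) :
    MemLp g ∞ (volume.restrict (cylinder Ω T)) := by
  have hm : MeasurableSet (cylinder Ω T) := (isOpen_cylinder hΩ).measurableSet
  exact memLp_top_of_bound (hg.aestronglyMeasurable hm) C
    (ae_restrict_of_forall_mem hm fun z hz => hC z.1 hz.1 z.2 hz.2)

theorem IsC1.memLp_top (hf : IsC1 Ω T f) (hΩ : IsOpen Ω) (hb : Bornology.IsBounded Ω) :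
    MemLp (fun z : ℝ × Eucl N => f z.1 z.2) ∞ (volume.restrict (cylinder Ω T)) := by
  obtain ⟨C, hC⟩ := hf.exists_bound hb
  exact memLp_top_of_continuousOn_cylinder hΩ
    (hf.continuousOn.mono cylinder_subset_Icc_prod_closure)
    fun t ht x hx => hC t (Ioo_subset_Icc_self ht) x (subset_closure hx)

theorem IsC1.memLp_top_deriv_time (hf : IsC1 Ω T f) (hΩ : IsOpen Ω)
    (hb : Bornology.IsBounded Ω) :
    MemLp (fun z : ℝ × Eucl N => deriv (fun s => f s z.2) z.1) ∞
      (volume.restrict (cylinder Ω T)) :=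
  let ⟨_, hC⟩ := hf.exists_bound_deriv_time hΩ hb
  memLp_top_of_continuousOn_cylinder hΩ (hf.continuousOn_deriv_time hΩ) hC

theorem IsC1.memLp_top_fderiv_slice (hf : IsC1 Ω T f) (hΩ : IsOpen Ω)
    (hb : Bornology.IsBounded Ω) :
    MemLp (fun z : ℝ × Eucl N => fderiv ℝ (f z.1) z.2) ∞
      (volume.restrict (cylinder Ω T)) :=
  let ⟨_, hC⟩ := hf.exists_bound_fderiv_slice hΩ hb
  memLp_top_of_continuousOn_cylinder hΩ (hf.continuousOn_fderiv_slice hΩ) hC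

end SpaceTimeCylinder

section TensorAlgebra

variable {N : ℕ}

theorem stdVec_apply (i j : Fin N) : (stdVec j : Eucl N) i = if i = j then 1 else 0 := by
  simp [stdVec]

theorem norm_stdVec (j : Fin N) : ‖(stdVec j : Eucl N)‖ = 1 := by simp [stdVec]

theorem inner_stdVec_left (i : Fin N) (v : Eucl N) : (inner ℝ (stdVec i) v : ℝ) = v i := by
  simp [stdVec, EuclideanSpace.inner_single_left]

theorem inner_stdVec_right (v : Eucl N) (i : Fin N) : (inner ℝ v (stdVec i) : ℝ) = v i := by
  simp [stdVec, EuclideanSpace.inner_single_right]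

theorem inner_eq_sum (v w : Eucl N) : (inner ℝ v w : ℝ) = ∑ i, v i * w i := by
  simp [PiLp.inner_apply, mul_comm]

theorem sum_smul_stdVec (v : Eucl N) : ∑ j, v j • (stdVec j : Eucl N) = v := by
  ext i
  simp [stdVec_apply]

theorem sum_smul_map_stdVec {F : Type*} [NormedAddCommGroup F] [NormedSpace ℝ F]
    (l : Eucl N →L[ℝ] F) (v : Eucl N) : ∑ j, v j • l (stdVec j) = l v := by
  conv_rhs => rw [← sum_smul_stdVec v]
  simp

theorem adjoint_stdVec_apply (A : Eucl N →L[ℝ] Eucl N) (i j : Fin N) :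
    (ContinuousLinearMap.adjoint A (stdVec j)) i = (A (stdVec i)) j := by
  rw [← inner_stdVec_left, ContinuousLinearMap.adjoint_inner_right, inner_stdVec_right]

@[simp] theorem tr_add (A B : Eucl N →L[ℝ] Eucl N) : tr (A + B) = tr A + tr B := by
  simp [tr, Finset.sum_add_distrib]

@[simp] theorem tr_sub (A B : Eucl N →L[ℝ] Eucl N) : tr (A - B) = tr A - tr B := by
  simp [tr, Finset.sum_sub_distrib]

@[simp] theorem tr_smul (c : ℝ) (A : Eucl N →L[ℝ] Eucl N) : tr (c • A) = c * tr A := by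
  simp [tr, Finset.mul_sum]

theorem tr_smulRight (l : Eucl N →L[ℝ] ℝ) (v : Eucl N) : tr (l.smulRight v) = l v := by
  rw [← sum_smul_map_stdVec l v]
  simp [tr, mul_comm]

theorem abs_tr_le (A : Eucl N →L[ℝ] Eucl N) : |tr A| ≤ N * ‖A‖ := by
  have hdiag (j : Fin N) : |(A (stdVec j)) j| ≤ ‖A‖ :=
    (PiLp.norm_apply_le (A (stdVec j)) j).trans (A.unit_le_opNorm _ (norm_stdVec j).le)
  refine (Finset.abs_sum_le_sum_abs _ _).trans ?_
  simpa using Finset.sum_le_sum fun j (_ : j ∈ Finset.univ) => hdiag j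

theorem tr_fderiv_smul {f : Eucl N → ℝ} {V : Eucl N → Eucl N} {x : Eucl N}
    (hf : DifferentiableAt ℝ f x) (hV : DifferentiableAt ℝ V x) :
    tr (fderiv ℝ (fun y => f y • V y) x) = f x * tr (fderiv ℝ V x) + fderiv ℝ f x (V x) := by
  rw [fderiv_fun_smul hf hV, tr_add, tr_smul, tr_smulRight]

theorem frob_add_left (A A' B : Eucl N →L[ℝ] Eucl N) :
    frob (A + A') B = frob A B + frob A' B := by
  simp [frob, add_mul, Finset.sum_add_distrib]

theorem frob_add_right (A B B' : Eucl N →L[ℝ] Eucl N) :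
    frob A (B + B') = frob A B + frob A B' := by
  simp [frob, mul_add, Finset.sum_add_distrib]

theorem frob_sub_left (A A' B : Eucl N →L[ℝ] Eucl N) :
    frob (A - A') B = frob A B - frob A' B := by
  simp [frob, sub_mul, Finset.sum_sub_distrib]

theorem frob_sub_right (A B B' : Eucl N →L[ℝ] Eucl N) :
    frob A (B - B') = frob A B - frob A B' := by
  simp [frob, mul_sub, Finset.sum_sub_distrib]

theorem frob_smul_left (c : ℝ) (A B : Eucl N →L[ℝ] Eucl N) :
    frob (c • A) B = c * frob A B := by
  simp [frob, Finset.mul_sum, mul_assoc]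

theorem frob_smul_right (c : ℝ) (A B : Eucl N →L[ℝ] Eucl N) :
    frob A (c • B) = c * frob A B := by
  simp [frob, Finset.mul_sum, mul_left_comm]

theorem frob_id_left (B : Eucl N →L[ℝ] Eucl N) :
    frob (ContinuousLinearMap.id ℝ (Eucl N)) B = tr B := by
  simp [frob, tr, stdVec_apply]

theorem frob_eq_sum_inner (A B : Eucl N →L[ℝ] Eucl N) :
    frob A B = ∑ j, (inner ℝ (A (stdVec j)) (B (stdVec j)) : ℝ) := by
  simp only [frob, inner_eq_sum]
  exact Finset.sum_comm

theorem frob_tensor (v w : Eucl N) (B : Eucl N →L[ℝ] Eucl N) :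
    frob (tensor v w) B = (inner ℝ v (B w) : ℝ) := by
  rw [frob_eq_sum_inner, ← sum_smul_map_stdVec B w, inner_sum]
  simp [tensor, inner_stdVec_right, inner_smul_left, inner_smul_right]

theorem tr_sq_le (A : Eucl N →L[ℝ] Eucl N) : tr A ^ 2 ≤ N * frob A A := by
  calc tr A ^ 2 ≤ N * ∑ j, (A (stdVec j)) j ^ 2 := by
        simpa [tr] using sq_sum_le_card_mul_sum_sq (s := Finset.univ)
          (f := fun j : Fin N => (A (stdVec j)) j)
    _ ≤ N * frob A A := by
        gcongr
        refine Finset.sum_le_sum fun i _ => ?_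
        rw [sq]
        exact Finset.single_le_sum (f := fun j => (A (stdVec j)) i * (A (stdVec j)) i)
          (fun j _ => mul_self_nonneg _) (Finset.mem_univ i)

/-- The scalar product of tensors, as a continuous bilinear form. -/
def frobL (N : ℕ) :
    (Eucl N →L[ℝ] Eucl N) →L[ℝ] (Eucl N →L[ℝ] Eucl N) →L[ℝ] ℝ :=
  (LinearMap.mk₂ ℝ frob frob_add_left frob_smul_left frob_add_right
    frob_smul_right).toContinuousBilinearMap

/-- The trace, as a continuous linear form. -/
def trL (N : ℕ) : (Eucl N →L[ℝ] Eucl N) →L[ℝ] ℝ :=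
  LinearMap.toContinuousLinearMap
    { toFun := tr, map_add' := tr_add, map_smul' := tr_smul }

theorem trL_apply (A : Eucl N →L[ℝ] Eucl N) : trL N A = tr A := rfl

/-- The transposition of tensors, as a continuous linear map. `ContinuousLinearMap.adjoint` is
only semilinear with respect to `starRingEnd ℝ`. -/
def transposeL (N : ℕ) : (Eucl N →L[ℝ] Eucl N) →L[ℝ] (Eucl N →L[ℝ] Eucl N) :=
  LinearMap.toContinuousLinearMap
    { toFun := fun A => ContinuousLinearMap.adjoint A
      map_add' := fun A B => map_add _ A B
      map_smul' := fun c A => by simp }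

theorem transposeL_apply (A : Eucl N →L[ℝ] Eucl N) :
    transposeL N A = ContinuousLinearMap.adjoint A := rfl

/-- The tensor product of vectors, as a continuous bilinear map. -/
def tensorL (N : ℕ) : Eucl N →L[ℝ] Eucl N →L[ℝ] (Eucl N →L[ℝ] Eucl N) :=
  (LinearMap.mk₂ ℝ tensor
    (fun v v' w => by ext1 x; simp [tensor])
    (fun c v w => by ext1 x; simp [tensor, smul_comm c])
    (fun v w w' => by ext1 x; simp [tensor, add_smul])
    (fun c v w => by ext1 x; simp [tensor, mul_smul])).toContinuousBilinearMap

theorem tensorL_apply (v w : Eucl N) : tensorL N v w = tensor v w := rfl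

theorem stress_add (μ lam : ℝ) (A B : Eucl N →L[ℝ] Eucl N) :
    stress μ lam (A + B) = stress μ lam A + stress μ lam B := by
  simp only [stress, tr_add, map_add]
  module

theorem stress_smul (μ lam c : ℝ) (A : Eucl N →L[ℝ] Eucl N) :
    stress μ lam (c • A) = c • stress μ lam A := by
  simp only [stress, tr_smul, ← transposeL_apply, map_smul]
  module

/-- Newton's viscous stress, as a continuous linear map of the velocity gradient. -/
def stressL (N : ℕ) (μ lam : ℝ) : (Eucl N →L[ℝ] Eucl N) →L[ℝ] (Eucl N →L[ℝ] Eucl N) :=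
  LinearMap.toContinuousLinearMap
    { toFun := stress μ lam, map_add' := stress_add μ lam, map_smul' := stress_smul μ lam }

theorem stressL_apply (μ lam : ℝ) (A : Eucl N →L[ℝ] Eucl N) :
    stressL N μ lam A = stress μ lam A := rfl

theorem stress_sub (μ lam : ℝ) (A B : Eucl N →L[ℝ] Eucl N) :
    stress μ lam (A - B) = stress μ lam A - stress μ lam B := by
  simp only [← stressL_apply, map_sub]

theorem frob_stress (μ lam : ℝ) (A B : Eucl N →L[ℝ] Eucl N) :
    frob (stress μ lam A) B = μ * (frob A B + frob (ContinuousLinearMap.adjoint A) B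
      - 2 / (N : ℝ) * tr A * tr B) + lam * tr A * tr B := by
  simp only [stress, frob_add_left, frob_sub_left, frob_smul_left, frob_id_left]

end TensorAlgebra

section MinimumPrinciple

variable {N : ℕ} {Ω : Set (Eucl N)} {T : ℝ} {w : ℝ → Eucl N → ℝ} {U : ℝ → Eucl N → Eucl N}

theorem VanishesOnBoundary.eventually_norm_lt (hvan : VanishesOnBoundary Ω T U)
    (hb : Bornology.IsBounded Ω)
    (hU : ContinuousOn (fun z : ℝ × Eucl N => U z.1 z.2) (Icc 0 T ×ˢ closure Ω))
    {x₀ : Eucl N} (hx₀ : x₀ ∈ frontier Ω) {η : ℝ} (hη : 0 < η) :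
    ∀ᶠ x in 𝓝[Ω] x₀, ∀ t ∈ Icc 0 T, ‖U t x‖ < η := by
  obtain ⟨δ, hδ, hδU⟩ := Metric.uniformContinuousOn_iff.1
    ((isCompact_Icc_prod_closure hb).uniformContinuousOn_of_continuous hU) η hη
  filter_upwards [self_mem_nhdsWithin, mem_nhdsWithin_of_mem_nhds (Metric.ball_mem_nhds x₀ hδ)]
    with x hx hxδ t ht
  have := hδU (t, x) ⟨ht, subset_closure hx⟩ (t, x₀) ⟨ht, frontier_subset_closure hx₀⟩
    (by simpa [Prod.dist_eq, hδ] using hxδ)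
  simpa [hvan t ht x₀ hx₀] using this

-- The boundary is characteristic, but `w` is not differentiable there: the time derivative is
-- bounded below at nearby interior points, and the bound tends to `0` together with `U`.
theorem monotoneOn_time_of_mem_frontier (hΩ : IsOpen Ω) (hb : Bornology.IsBounded Ω)
    (hw : IsC1 Ω T w)
    (hU : ContinuousOn (fun z : ℝ × Eucl N => U z.1 z.2) (Icc 0 T ×ˢ closure Ω))
    (hvan : VanishesOnBoundary Ω T U)
    (h : ∀ t ∈ Ioo 0 T, ∀ x ∈ Ω, 0 ≤ deriv (fun s => w s x) t + fderiv ℝ (w t) x (U t x))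
    {x₀ : Eucl N} (hx₀ : x₀ ∈ frontier Ω) :
    MonotoneOn (fun t => w t x₀) (Icc 0 T) := by
  intro s hs t ht hst
  obtain ⟨L, hL⟩ := hw.exists_bound_fderiv_slice hΩ hb
  have hinner : ∀ η > 0, ∀ᶠ x in 𝓝[Ω] x₀, -(|L| * η) * (t - s) ≤ w t x - w s x := by
    intro η hη
    filter_upwards [self_mem_nhdsWithin, hvan.eventually_norm_lt hb hU hx₀ hη] with x hx hUx
    refine (convex_Icc 0 T).mul_sub_le_image_sub_of_le_deriv (f := fun s => w s x)
      (hw.continuousOn_time (subset_closure hx)) ?_ ?_ s hs t ht hst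
    all_goals rw [interior_Icc]
    · exact fun σ hσ => (hw.hasDerivAt_time hΩ hσ hx).differentiableAt.differentiableWithinAt
    · intro σ hσ
      have hle : fderiv ℝ (w σ) x (U σ x) ≤ |L| * η :=
        (le_abs_self _).trans <| (fderiv ℝ (w σ) x).le_of_opNorm_le_of_le
          ((hL σ hσ x hx).trans (le_abs_self L)) (hUx σ (Ioo_subset_Icc_self hσ)).le
      linarith [h σ hσ x hx]
  have hlim : ∀ σ ∈ Icc 0 T, Tendsto (w σ) (𝓝[Ω] x₀) (𝓝 (w σ x₀)) := fun σ hσ =>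
    (hw.continuousOn_slice hσ x₀ (frontier_subset_closure hx₀)).mono_left
      (nhdsWithin_mono _ subset_closure)
  have : (𝓝[Ω] x₀).NeBot := mem_closure_iff_nhdsWithin_neBot.1 (frontier_subset_closure hx₀)
  have hη : Tendsto (fun η => -(|L| * η) * (t - s)) (𝓝[>] 0) (𝓝 0) :=
    ((Continuous.tendsto' (by fun_prop) 0 0 (by simp)).mono_left nhdsWithin_le_nhds)
  refine sub_nonneg.1 (le_of_tendsto hη ?_)
  filter_upwards [self_mem_nhdsWithin] with η hη
  exact ge_of_tendsto ((hlim t ht).sub (hlim s hs)) (hinner η hη)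

theorem transport_nonpos_of_isMinOn (hΩ : IsOpen Ω) (hw : IsC1 Ω T w) {t₀ : ℝ} {x₀ : Eucl N}
    (ht₀ : t₀ ∈ Ioo 0 T) (hx₀ : x₀ ∈ Ω)
    (hmin : ∀ t ∈ Icc 0 t₀, ∀ x ∈ Ω, w t₀ x₀ ≤ w t x) (v : Eucl N) :
    deriv (fun s => w s x₀) t₀ + fderiv ℝ (w t₀) x₀ v ≤ 0 := by
  have hspace : fderiv ℝ (w t₀) x₀ = 0 := by
    apply IsLocalMin.fderiv_eq_zero
    filter_upwards [hΩ.mem_nhds hx₀] with x hx using hmin t₀ ⟨ht₀.1.le, le_rfl⟩ x hx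
  have htime : IsLocalMinOn (fun s => w s x₀) (Icc 0 t₀) t₀ := by
    filter_upwards [self_mem_nhdsWithin] with t ht using hmin t ht x₀ hx₀
  have hdir : (-t₀ : ℝ) ∈ posTangentConeAt (Icc 0 t₀) t₀ := by
    simpa using sub_mem_posTangentConeAt_of_segment_subset (s := Icc 0 t₀) (x := t₀) (y := 0)
      (by rw [segment_symm, segment_eq_Icc ht₀.1.le])
  have := htime.hasFDerivWithinAt_nonneg
    (hw.hasDerivAt_time hΩ ht₀ hx₀).hasFDerivAt.hasFDerivWithinAt hdir
  simp only [ContinuousLinearMap.toSpanSingleton_apply, smul_eq_mul] at this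
  rw [hspace, zero_apply, add_zero]
  nlinarith [ht₀.1]

theorem le_add_mul_of_transport_nonneg (hΩ : IsOpen Ω) (hb : Bornology.IsBounded Ω)
    (hw : IsC1 Ω T w)
    (hU : ContinuousOn (fun z : ℝ × Eucl N => U z.1 z.2) (Icc 0 T ×ˢ closure Ω))
    (hvan : VanishesOnBoundary Ω T U)
    (h : ∀ t ∈ Ioo 0 T, ∀ x ∈ Ω, 0 ≤ deriv (fun s => w s x) t + fderiv ℝ (w t) x (U t x))
    {m : ℝ} (hm : ∀ x ∈ closure Ω, m ≤ w 0 x) {ε : ℝ} (hε : 0 < ε) {τ : ℝ} (hτ : τ ∈ Ioo 0 T)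
    {y : Eucl N} (hy : y ∈ closure Ω) : m ≤ w τ y + ε * τ := by
  have hv : IsC1 Ω T (fun t x => w t x + ε * t) :=
    ContDiffOn.add hw (contDiff_const.mul contDiff_fst).contDiffOn
  obtain ⟨⟨t₀, x₀⟩, ⟨ht₀, hx₀⟩, hmin⟩ :=
    (isCompact_Icc.prod hb.isCompact_closure).exists_isMinOn
      (⟨(0, y), ⟨le_rfl, hτ.1.le⟩, hy⟩ : (Icc 0 τ ×ˢ closure Ω).Nonempty)
      (hv.continuousOn.mono (prod_mono (Icc_subset_Icc_right hτ.2.le) Subset.rfl))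
  have hle (t : ℝ) (ht : t ∈ Icc 0 τ) (x : Eucl N) (hx : x ∈ closure Ω) :
      w t₀ x₀ + ε * t₀ ≤ w t x + ε * t := hmin (show (t, x) ∈ _ from ⟨ht, hx⟩)
  obtain rfl | ht₀pos := ht₀.1.eq_or_lt
  · linarith [hm x₀ hx₀, hle τ ⟨hτ.1.le, le_rfl⟩ y hy]
  exfalso
  have ht₀T : t₀ ∈ Ioo 0 T := ⟨ht₀pos, ht₀.2.trans_lt hτ.2⟩
  by_cases hxΩ : x₀ ∈ Ω
  · have htransport := transport_nonpos_of_isMinOn hΩ hv ht₀T hxΩ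
      (fun t ht x hx => hle t ⟨ht.1, ht.2.trans ht₀.2⟩ x (subset_closure hx)) (U t₀ x₀)
    have hderiv : deriv (fun s => w s x₀ + ε * s) t₀ = deriv (fun s => w s x₀) t₀ + ε := by
      simpa using ((hw.hasDerivAt_time hΩ ht₀T hxΩ).fun_add ((hasDerivAt_id t₀).const_mul ε)).deriv
    rw [hderiv, fderiv_add_const] at htransport
    linarith [h t₀ ht₀T x₀ hxΩ]
  · have hmono := monotoneOn_time_of_mem_frontier hΩ hb hw hU hvan h
      (hΩ.frontier_eq.ge ⟨hx₀, hxΩ⟩) ⟨le_rfl, ht₀pos.le.trans ht₀T.2.le⟩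
      (Ioo_subset_Icc_self ht₀T) ht₀pos.le
    have hpos : 0 < ε * t₀ := mul_pos hε ht₀pos
    have := hle 0 ⟨le_rfl, hτ.1.le⟩ x₀ hx₀
    simp only [mul_zero, add_zero] at hmono this
    linarith

theorem le_of_transport_nonneg (hΩ : IsOpen Ω) (hb : Bornology.IsBounded Ω) (hT : 0 < T)
    (hw : IsC1 Ω T w)
    (hU : ContinuousOn (fun z : ℝ × Eucl N => U z.1 z.2) (Icc 0 T ×ˢ closure Ω))
    (hvan : VanishesOnBoundary Ω T U)
    (h : ∀ t ∈ Ioo 0 T, ∀ x ∈ Ω, 0 ≤ deriv (fun s => w s x) t + fderiv ℝ (w t) x (U t x))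
    {m : ℝ} (hm : ∀ x ∈ closure Ω, m ≤ w 0 x) {t : ℝ} (ht : t ∈ Icc 0 T) {x : Eucl N}
    (hx : x ∈ closure Ω) : m ≤ w t x := by
  have hinterior : ∀ τ ∈ Ioo 0 T, m ≤ w τ x := fun τ hτ => by
    refine le_of_forall_pos_le_add fun ε hε => ?_
    simpa [div_mul_cancel₀ ε hτ.1.ne'] using
      le_add_mul_of_transport_nonneg hΩ hb hw hU hvan h hm (div_pos hε hτ.1) hτ hx
  rw [← closure_Ioo hT.ne] at ht
  refine le_on_closure hinterior continuousOn_const ?_ ht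
  rw [closure_Ioo hT.ne]
  exact hw.continuousOn_time hx

theorem exists_pos_le_of_transport_eq {r : ℝ → Eucl N → ℝ} (hΩ : IsOpen Ω)
    (hb : Bornology.IsBounded Ω) (hne : Ω.Nonempty) (hT : 0 < T) (hr : IsC1 Ω T r)
    (hU : IsC1 Ω T U) (hvan : VanishesOnBoundary Ω T U)
    (hnn : ∀ t ∈ Icc (0 : ℝ) T, ∀ x ∈ closure Ω, 0 ≤ r t x)
    (heq : ∀ t ∈ Ioo (0 : ℝ) T, ∀ x ∈ Ω, deriv (fun s => r s x) t =
      -(r t x * tr (fderiv ℝ (U t) x)) - fderiv ℝ (r t) x (U t x))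
    (hpos : ∀ x ∈ closure Ω, 0 < r 0 x) :
    ∃ δ > 0, ∀ t ∈ Icc (0 : ℝ) T, ∀ x ∈ closure Ω, δ ≤ r t x := by
  obtain ⟨xm, hxm, hmin⟩ := hb.isCompact_closure.exists_isMinOn hne.closure
    (hr.continuousOn_slice ⟨le_rfl, hT.le⟩)
  obtain ⟨C, hC⟩ := hU.exists_bound_fderiv_slice hΩ hb
  have hdiv (t : ℝ) (ht : t ∈ Ioo 0 T) (x : Eucl N) (hx : x ∈ Ω) :
      tr (fderiv ℝ (U t) x) ≤ N * |C| :=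
    (le_abs_self _).trans <| (abs_tr_le _).trans <| by
      gcongr
      exact (hC t ht x hx).trans (le_abs_self C)
  set M : ℝ := N * |C|
  have hw : IsC1 Ω T (fun t x => r t x * Real.exp (M * t)) :=
    ContDiffOn.mul hr (contDiff_const.mul contDiff_fst).exp.contDiffOn
  have htransport (t : ℝ) (ht : t ∈ Ioo 0 T) (x : Eucl N) (hx : x ∈ Ω) :
      0 ≤ deriv (fun s => r s x * Real.exp (M * s)) t
        + fderiv ℝ (fun x => r t x * Real.exp (M * t)) x (U t x) := by
    have hexp : HasDerivAt (fun s => Real.exp (M * s)) (Real.exp (M * t) * M) t := by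
      simpa using ((hasDerivAt_id t).const_mul M).exp
    have htime := (hr.hasDerivAt_time hΩ ht hx).fun_mul hexp
    have hspace := (hr.hasFDerivAt_slice hΩ ht hx).mul_const (Real.exp (M * t))
    calc 0 ≤ Real.exp (M * t) * (r t x * (M - tr (fderiv ℝ (U t) x))) :=
          mul_nonneg (Real.exp_pos _).le (mul_nonneg
            (hnn t (Ioo_subset_Icc_self ht) x (subset_closure hx)) (sub_nonneg.2 (hdiv t ht x hx)))
      _ = _ := by
          simp only [hspace.fderiv, htime.deriv, heq t ht x hx, smul_apply, smul_eq_mul]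
          ring
  refine ⟨r 0 xm * Real.exp (-(M * T)), mul_pos (hpos xm hxm) (Real.exp_pos _),
    fun t ht x hx => ?_⟩
  have hlower : r 0 xm ≤ r t x * Real.exp (M * t) :=
    le_of_transport_nonneg hΩ hb hT hw hU.continuousOn hvan htransport
      (fun y hy => by simpa using hmin hy) ht hx
  rw [Real.exp_neg, ← div_eq_mul_inv, div_le_iff₀ (Real.exp_pos _)]
  refine hlower.trans (mul_le_mul_of_nonneg_left ?_ (hnn t ht x hx))
  gcongr
  exact ht.2

end MinimumPrinciple

section IntegrationByParts

variable {N : ℕ} {Ω : Set (Eucl N)}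

theorem tsupport_subset_of_forall_eq_zero {X E F : Type*} [TopologicalSpace X] [Zero E] [Zero F]
    {f : X → E} {g : X → F} (h : ∀ x, g x = 0 → f x = 0) : tsupport f ⊆ tsupport g :=
  closure_mono fun x => mt (h x)

theorem integrable_fderiv_apply_of_hasCompactSupport {f : Eucl N → ℝ} (hf : ContDiff ℝ 1 f)
    (hs : HasCompactSupport f) (v : Eucl N) : Integrable (fun x => fderiv ℝ f x v) :=
  ((hf.continuous_fderiv one_ne_zero).clm_apply continuous_const).integrable_of_hasCompactSupport
    (hs.fderiv_apply (𝕜 := ℝ) (v := v))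

theorem integral_fderiv_apply_of_hasCompactSupport {f : Eucl N → ℝ} (hf : ContDiff ℝ 1 f)
    (hs : HasCompactSupport f) (v : Eucl N) : ∫ x, fderiv ℝ f x v = 0 := by
  simpa using integral_mul_fderiv_eq_neg_fderiv_mul_of_integrable
    (μ := (volume : Measure (Eucl N))) (f := fun _ => (1 : ℝ)) (g := f) (v := v) (by simp)
    (by simpa using integrable_fderiv_apply_of_hasCompactSupport hf hs v)
    (by simpa using hf.continuous.integrable_of_hasCompactSupport hs)
    (by simp) (fun x _ => hf.differentiable one_ne_zero x)

theorem setIntegral_fderiv_apply_of_tsupport_subset {f : Eucl N → ℝ} (hf : ContDiff ℝ 1 f)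
    (hs : HasCompactSupport f) (hsΩ : tsupport f ⊆ Ω) (v : Eucl N) :
    ∫ x in Ω, fderiv ℝ f x v = 0 := by
  rw [setIntegral_eq_integral_of_forall_compl_eq_zero fun x hx => ?_,
    integral_fderiv_apply_of_hasCompactSupport hf hs]
  rw [fderiv_of_notMem_tsupport ℝ (mt (@hsΩ x) hx), zero_apply]

theorem sum_fderiv_inner_stdVec {M : Eucl N → (Eucl N →L[ℝ] Eucl N)} {φ : Eucl N → Eucl N}
    {x : Eucl N} (hM : DifferentiableAt ℝ M x) (hφ : DifferentiableAt ℝ φ x) :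
    ∑ j, fderiv ℝ (fun y => (inner ℝ (M y (stdVec j)) (φ y) : ℝ)) x (stdVec j) =
      (inner ℝ (tensorDiv M x) (φ x) : ℝ) + frob (M x) (fderiv ℝ φ x) := by
  have hcolumn (j : Fin N) : HasFDerivAt (fun y => M y (stdVec j))
      ((fderiv ℝ M x).flip (stdVec j)) x := by
    simpa using hM.hasFDerivAt.clm_apply (hasFDerivAt_const (stdVec j : Eucl N) x)
  have hterm (j : Fin N) :
      fderiv ℝ (fun y => (inner ℝ (M y (stdVec j)) (φ y) : ℝ)) x (stdVec j) =
        (inner ℝ (M x (stdVec j)) (fderiv ℝ φ x (stdVec j)) : ℝ)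
          + inner ℝ (fderiv ℝ M x (stdVec j) (stdVec j)) (φ x) := by
    rw [((hcolumn j).inner ℝ hφ.hasFDerivAt).fderiv]
    simp
  simp only [hterm, Finset.sum_add_distrib, tensorDiv, sum_inner, frob_eq_sum_inner]
  ring

theorem contDiff_of_tsupport {E F : Type*} [NormedAddCommGroup E] [NormedSpace ℝ E]
    [NormedAddCommGroup F] [NormedSpace ℝ F] {n : ℕ∞ω} {f : E → F}
    (h : ∀ x ∈ tsupport f, ContDiffAt ℝ n f x) : ContDiff ℝ n f :=
  contMDiff_iff_contDiff.1 <| contMDiff_of_tsupport fun x hx =>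
    contMDiffAt_iff_contDiffAt.2 (h x hx)

theorem integral_tensorDiv_of_tsupport_subset (hΩ : IsOpen Ω)
    {M : Eucl N → (Eucl N →L[ℝ] Eucl N)} (hM : ContDiffOn ℝ 1 M Ω) {φ : Eucl N → Eucl N}
    (hφ : ContDiff ℝ 1 φ) (hs : HasCompactSupport φ) (hsΩ : tsupport φ ⊆ Ω) :
    IntegrableOn (fun x => (inner ℝ (tensorDiv M x) (φ x) : ℝ) + frob (M x) (fderiv ℝ φ x)) Ω ∧
    ∫ x in Ω, ((inner ℝ (tensorDiv M x) (φ x) : ℝ) + frob (M x) (fderiv ℝ φ x)) = 0 := by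
  set f : Fin N → Eucl N → ℝ := fun j x => (inner ℝ (M x (stdVec j)) (φ x) : ℝ)
  have hMx (x : Eucl N) (hx : x ∈ Ω) : ContDiffAt ℝ 1 M x := hM.contDiffAt (hΩ.mem_nhds hx)
  have hsub (j : Fin N) : tsupport (f j) ⊆ tsupport φ :=
    tsupport_subset_of_forall_eq_zero fun x hx => by simp [f, hx]
  have hf (j : Fin N) : ContDiff ℝ 1 (f j) := contDiff_of_tsupport fun x hx =>
    ((hMx x (hsΩ (hsub j hx))).clm_apply contDiffAt_const).inner ℝ hφ.contDiffAt
  have hfs (j : Fin N) : HasCompactSupport (f j) :=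
    hs.of_isClosed_subset (isClosed_tsupport _) (hsub j)
  have hsum (x : Eucl N) (hx : x ∈ Ω) := sum_fderiv_inner_stdVec
    ((hMx x hx).differentiableAt one_ne_zero) (hφ.differentiable one_ne_zero x)
  have hint (j : Fin N) (_ : j ∈ Finset.univ) :
      IntegrableOn (fun x => fderiv ℝ (f j) x (stdVec j)) Ω :=
    (integrable_fderiv_apply_of_hasCompactSupport (hf j) (hfs j) _).integrableOn
  refine ⟨IntegrableOn.congr_fun (integrable_finsetSum _ hint) hsum hΩ.measurableSet, ?_⟩
  rw [← setIntegral_congr_fun hΩ.measurableSet hsum, integral_finsetSum _ hint]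
  exact Finset.sum_eq_zero fun j _ =>
    setIntegral_fderiv_apply_of_tsupport_subset (hf j) (hfs j) ((hsub j).trans hsΩ) _

theorem tensorDiv_smul_id {f : Eucl N → ℝ} {x : Eucl N} (hf : DifferentiableAt ℝ f x) :
    tensorDiv (fun y => f y • ContinuousLinearMap.id ℝ (Eucl N)) x =
      ∑ j, fderiv ℝ f x (stdVec j) • stdVec j := by
  refine Finset.sum_congr rfl fun j _ => ?_
  rw [(hf.hasFDerivAt.smul_const (ContinuousLinearMap.id ℝ (Eucl N))).fderiv]
  simp

theorem tensorDiv_adjoint_fderiv {φ : Eucl N → Eucl N} (hφ : ContDiff ℝ 2 φ) (x : Eucl N) :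
    tensorDiv (fun y => ContinuousLinearMap.adjoint (fderiv ℝ φ y)) x =
      tensorDiv (fun y => tr (fderiv ℝ φ y) • ContinuousLinearMap.id ℝ (Eucl N)) x := by
  have hsymm : IsSymmSndFDerivAt ℝ φ x := hφ.contDiffAt.isSymmSndFDerivAt (by simp)
  have hD : HasFDerivAt (fderiv ℝ φ) (fderiv ℝ (fderiv ℝ φ) x) x :=
    ((hφ.fderiv_right (m := 1) (by norm_num)).differentiable one_ne_zero x).hasFDerivAt
  have htr : HasFDerivAt (fun y => tr (fderiv ℝ φ y)) ((trL N).comp (fderiv ℝ (fderiv ℝ φ) x)) x :=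
    (trL N).hasFDerivAt.comp x hD
  have hadj : HasFDerivAt (fun y => ContinuousLinearMap.adjoint (fderiv ℝ φ y))
      ((transposeL N).comp (fderiv ℝ (fderiv ℝ φ) x)) x :=
    (transposeL N).hasFDerivAt.comp x hD
  rw [tensorDiv_smul_id htr.differentiableAt, htr.fderiv, tensorDiv, hadj.fderiv]
  ext i
  simp only [ContinuousLinearMap.comp_apply, transposeL_apply, trL_apply, WithLp.ofLp_sum,
    Finset.sum_apply, PiLp.smul_apply, adjoint_stdVec_apply, stdVec_apply, smul_eq_mul, mul_ite,
    mul_one, mul_zero, Finset.sum_ite_eq, Finset.mem_univ, if_true, tr]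
  exact Finset.sum_congr rfl fun j _ => by rw [hsymm.eq]

-- Both `(∇φ)ᵗ` and `(div φ) I` have divergence `∇ div φ`.
theorem integral_frob_adjoint_sub_tr_sq (hΩ : IsOpen Ω) {φ : Eucl N → Eucl N}
    (hφ : ContDiff ℝ 2 φ) (hs : HasCompactSupport φ) (hsΩ : tsupport φ ⊆ Ω) :
    IntegrableOn (fun x => frob (ContinuousLinearMap.adjoint (fderiv ℝ φ x)) (fderiv ℝ φ x)
      - tr (fderiv ℝ φ x) ^ 2) Ω ∧
    ∫ x in Ω, (frob (ContinuousLinearMap.adjoint (fderiv ℝ φ x)) (fderiv ℝ φ x)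
      - tr (fderiv ℝ φ x) ^ 2) = 0 := by
  have hD : ContDiff ℝ 1 (fderiv ℝ φ) := hφ.fderiv_right (by norm_num)
  have hφ1 : ContDiff ℝ 1 φ := hφ.of_le one_le_two
  obtain ⟨hi, h⟩ := integral_tensorDiv_of_tsupport_subset hΩ
    (M := fun x => ContinuousLinearMap.adjoint (fderiv ℝ φ x))
    ((transposeL N).contDiff.comp hD).contDiffOn hφ1 hs hsΩ
  obtain ⟨hi', h'⟩ := integral_tensorDiv_of_tsupport_subset hΩ
    (M := fun x => tr (fderiv ℝ φ x) • ContinuousLinearMap.id ℝ (Eucl N))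
    (((trL N).contDiff.comp hD).smul contDiff_const).contDiffOn hφ1 hs hsΩ
  have hdiff (x : Eucl N) : frob (ContinuousLinearMap.adjoint (fderiv ℝ φ x)) (fderiv ℝ φ x)
      - tr (fderiv ℝ φ x) ^ 2 =
      ((inner ℝ (tensorDiv (fun y => ContinuousLinearMap.adjoint (fderiv ℝ φ y)) x) (φ x) : ℝ)
        + frob (ContinuousLinearMap.adjoint (fderiv ℝ φ x)) (fderiv ℝ φ x))
      - ((inner ℝ (tensorDiv (fun y => tr (fderiv ℝ φ y) •
          ContinuousLinearMap.id ℝ (Eucl N)) x) (φ x) : ℝ)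
        + frob (tr (fderiv ℝ φ x) • ContinuousLinearMap.id ℝ (Eucl N)) (fderiv ℝ φ x)) := by
    rw [tensorDiv_adjoint_fderiv hφ x, frob_smul_left, frob_id_left]
    ring
  simp only [hdiff]
  exact ⟨hi.sub hi', by rw [integral_sub hi hi', h, h', sub_zero]⟩

end IntegrationByParts

section Coercivity

variable {N : ℕ} {Ω : Set (Eucl N)}

theorem integrable_bilin_fderiv_of_hasCompactSupport {φ : Eucl N → Eucl N} (hφ : ContDiff ℝ 1 φ)
    (hs : HasCompactSupport φ)
    (b : (Eucl N →L[ℝ] Eucl N) →L[ℝ] (Eucl N →L[ℝ] Eucl N) →L[ℝ] ℝ) :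
    Integrable (fun x => b (fderiv ℝ φ x) (fderiv ℝ φ x)) := by
  have : Continuous (fderiv ℝ φ) := hφ.continuous_fderiv one_ne_zero
  exact Continuous.integrable_of_hasCompactSupport (by fun_prop)
    ((hs.fderiv (𝕜 := ℝ)).comp_left (g := fun A => b A A) (by simp))

theorem integrable_frob_fderiv_of_hasCompactSupport {φ : Eucl N → Eucl N} (hφ : ContDiff ℝ 1 φ)
    (hs : HasCompactSupport φ) : Integrable (fun x => frob (fderiv ℝ φ x) (fderiv ℝ φ x)) :=
  integrable_bilin_fderiv_of_hasCompactSupport hφ hs (frobL N)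

theorem integrable_tr_fderiv_sq_of_hasCompactSupport {φ : Eucl N → Eucl N} (hφ : ContDiff ℝ 1 φ)
    (hs : HasCompactSupport φ) : Integrable (fun x => tr (fderiv ℝ φ x) ^ 2) := by
  simpa [sq, trL_apply] using integrable_bilin_fderiv_of_hasCompactSupport hφ hs
    ((ContinuousLinearMap.mul ℝ ℝ).bilinearComp (trL N) (trL N))

theorem integrable_norm_sq_of_hasCompactSupport {φ : Eucl N → Eucl N} (hφ : Continuous φ)
    (hs : HasCompactSupport φ) : Integrable (fun x => ‖φ x‖ ^ 2) :=
  Continuous.integrable_of_hasCompactSupport (by fun_prop)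
    (hs.comp_left (g := fun v : Eucl N => ‖v‖ ^ 2) (by simp))

theorem norm_apply_stdVec_sq_le (A : Eucl N →L[ℝ] Eucl N) (j : Fin N) :
    ‖A (stdVec j)‖ ^ 2 ≤ frob A A := by
  rw [frob_eq_sum_inner, ← real_inner_self_eq_norm_sq]
  exact Finset.single_le_sum
    (f := fun i => (inner ℝ (A (stdVec i)) (A (stdVec i)) : ℝ))
    (fun i _ => real_inner_self_nonneg) (Finset.mem_univ j)

theorem half_norm_sq_le_fderiv_coord_mul {R : ℝ} {φ : Eucl N → Eucl N} {x : Eucl N}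
    (hx : ‖x‖ ≤ R) (hφ : DifferentiableAt ℝ φ x) (j : Fin N) :
    1 / 2 * ‖φ x‖ ^ 2 ≤ fderiv ℝ (fun y : Eucl N => y j * ‖φ y‖ ^ 2) x (stdVec j)
      + 2 * R ^ 2 * frob (fderiv ℝ φ x) (fderiv ℝ φ x) := by
  have hcoord : HasFDerivAt (fun y : Eucl N => y j) (EuclideanSpace.proj (𝕜 := ℝ) j) x :=
    (EuclideanSpace.proj (𝕜 := ℝ) j).hasFDerivAt
  have hderiv : fderiv ℝ (fun y : Eucl N => y j * ‖φ y‖ ^ 2) x (stdVec j) =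
      x j * (2 * (inner ℝ (φ x) (fderiv ℝ φ x (stdVec j)) : ℝ)) + ‖φ x‖ ^ 2 := by
    rw [(hcoord.fun_mul hφ.hasFDerivAt.norm_sq).fderiv]
    simp [stdVec_apply]
  have hinner : |x j * (inner ℝ (φ x) (fderiv ℝ φ x (stdVec j)) : ℝ)| ≤
      R * (‖φ x‖ * ‖fderiv ℝ φ x (stdVec j)‖) := by
    have hxj : |x j| ≤ R := (PiLp.norm_apply_le x j).trans hx
    rw [abs_mul]
    exact mul_le_mul hxj (abs_real_inner_le_norm _ _) (abs_nonneg _) ((abs_nonneg _).trans hxj)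
  have hcol := mul_le_mul_of_nonneg_left (norm_apply_stdVec_sq_le (fderiv ℝ φ x) j) (sq_nonneg R)
  rw [hderiv]
  nlinarith [sq_nonneg (‖φ x‖ - 2 * R * ‖fderiv ℝ φ x (stdVec j)‖), (abs_le.1 hinner).1]

-- Integrate `∂_j (x_j |φ|²) = |φ|² + 2 x_j φ · ∂_j φ`, where `|x_j| ≤ R` on `Ω`.
theorem integral_norm_sq_le_of_tsupport_subset (hN : 0 < N) (hΩ : IsOpen Ω) {R : ℝ}
    (hR : ∀ x ∈ Ω, ‖x‖ ≤ R) {φ : Eucl N → Eucl N} (hφ : ContDiff ℝ 1 φ)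
    (hs : HasCompactSupport φ) (hsΩ : tsupport φ ⊆ Ω) :
    ∫ x in Ω, ‖φ x‖ ^ 2 ≤ 4 * R ^ 2 * ∫ x in Ω, frob (fderiv ℝ φ x) (fderiv ℝ φ x) := by
  set j : Fin N := ⟨0, hN⟩
  set f : Eucl N → ℝ := fun x => x j * ‖φ x‖ ^ 2
  have hf : ContDiff ℝ 1 f := (EuclideanSpace.proj (𝕜 := ℝ) j).contDiff.mul (hφ.norm_sq ℝ)
  have hsub : tsupport f ⊆ tsupport φ :=
    tsupport_subset_of_forall_eq_zero fun x hx => by simp [f, hx]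
  have hfs : HasCompactSupport f := hs.of_isClosed_subset (isClosed_tsupport _) hsub
  have hif := (integrable_fderiv_apply_of_hasCompactSupport hf hfs (stdVec j)).integrableOn (s := Ω)
  have hiD := (integrable_frob_fderiv_of_hasCompactSupport hφ hs).integrableOn (s := Ω)
  have hle := setIntegral_mono_on
    ((integrable_norm_sq_of_hasCompactSupport hφ.continuous hs).integrableOn.const_mul (1 / 2))
    (hif.add (hiD.const_mul (2 * R ^ 2))) hΩ.measurableSet fun x hx =>
      half_norm_sq_le_fderiv_coord_mul (hR x hx) (hφ.differentiable one_ne_zero x) j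
  simp only [Pi.add_apply] at hle
  rw [integral_add hif (hiD.const_mul _), integral_const_mul, integral_const_mul,
    setIntegral_fderiv_apply_of_tsupport_subset hf hfs (hsub.trans hsΩ), zero_add] at hle
  linarith

theorem exists_pos_mul_frob_le (hN : 0 < N) {μ lam : ℝ} (hμ : 0 < μ) (hlam : 0 ≤ lam)
    (hvisc : N = 1 → 0 < lam) :
    ∃ k > 0, ∀ A : Eucl N →L[ℝ] Eucl N,
      k * frob A A ≤ μ * frob A A + (μ - 2 * μ / N + lam) * tr A ^ 2 := by
  obtain rfl | hN2 : N = 1 ∨ 2 ≤ N := by omega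
  · refine ⟨lam, hvisc rfl, fun A => ?_⟩
    have htr : frob A A = tr A ^ 2 := by simp [frob, tr, sq]
    rw [htr, Nat.cast_one, div_one]
    linarith
  · refine ⟨μ, hμ, fun A => ?_⟩
    have hcoeff : 2 * μ / N ≤ μ := by
      rw [div_le_iff₀ (Nat.cast_pos.2 hN), mul_comm]
      gcongr
      exact_mod_cast hN2
    have := mul_nonneg (by linarith : 0 ≤ μ - 2 * μ / N + lam) (sq_nonneg (tr A))
    linarith

theorem integral_frob_stress_of_tsupport_subset (μ lam : ℝ) (hΩ : IsOpen Ω)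
    {φ : Eucl N → Eucl N} (hφ : ContDiff ℝ 2 φ) (hs : HasCompactSupport φ)
    (hsΩ : tsupport φ ⊆ Ω) :
    ∫ x in Ω, frob (stress μ lam (fderiv ℝ φ x)) (fderiv ℝ φ x) =
      ∫ x in Ω, (μ * frob (fderiv ℝ φ x) (fderiv ℝ φ x)
        + (μ - 2 * μ / N + lam) * tr (fderiv ℝ φ x) ^ 2) := by
  have hφ1 : ContDiff ℝ 1 φ := hφ.of_le one_le_two
  have hiD := (integrable_frob_fderiv_of_hasCompactSupport hφ1 hs).integrableOn (s := Ω)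
  have hiT := (integrable_tr_fderiv_sq_of_hasCompactSupport hφ1 hs).integrableOn (s := Ω)
  obtain ⟨hiK, hK⟩ := integral_frob_adjoint_sub_tr_sq hΩ hφ hs hsΩ
  have hsplit (A : Eucl N →L[ℝ] Eucl N) : frob (stress μ lam A) A =
      (μ * frob A A + (μ - 2 * μ / N + lam) * tr A ^ 2)
        + μ * (frob (ContinuousLinearMap.adjoint A) A - tr A ^ 2) := by
    rw [frob_stress]
    ring
  have hiB : IntegrableOn (fun x => μ * frob (fderiv ℝ φ x) (fderiv ℝ φ x)
      + (μ - 2 * μ / N + lam) * tr (fderiv ℝ φ x) ^ 2) Ω :=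
    (hiD.const_mul _).add (hiT.const_mul _)
  simp only [hsplit]
  rw [integral_add hiB (hiK.const_mul μ), integral_const_mul, hK, mul_zero, add_zero]

theorem exists_coercivity_stress (hN : 0 < N) (hΩ : IsOpen Ω) (hb : Bornology.IsBounded Ω)
    {μ lam : ℝ} (hμ : 0 < μ) (hlam : 0 ≤ lam) (hvisc : N = 1 → 0 < lam) :
    ∃ c > 0, ∀ φ : Eucl N → Eucl N, ContDiff ℝ 2 φ → HasCompactSupport φ → tsupport φ ⊆ Ω →
      c * (∫ x in Ω, ‖φ x‖ ^ 2 + tr (fderiv ℝ φ x) ^ 2) ≤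
        ∫ x in Ω, frob (stress μ lam (fderiv ℝ φ x)) (fderiv ℝ φ x) := by
  obtain ⟨R, hR⟩ := hb.exists_norm_le
  obtain ⟨k, hk, hkA⟩ := exists_pos_mul_frob_le hN hμ hlam hvisc
  have : (0 : ℝ) < N := Nat.cast_pos.2 hN
  refine ⟨k / (4 * R ^ 2 + N), by positivity, fun φ hφ hs hsΩ => ?_⟩
  have hφ1 : ContDiff ℝ 1 φ := hφ.of_le one_le_two
  have hiD := (integrable_frob_fderiv_of_hasCompactSupport hφ1 hs).integrableOn (s := Ω)
  have hiT := (integrable_tr_fderiv_sq_of_hasCompactSupport hφ1 hs).integrableOn (s := Ω)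
  have hi := (integrable_norm_sq_of_hasCompactSupport hφ.continuous hs).integrableOn (s := Ω)
  have hpoincare := integral_norm_sq_le_of_tsupport_subset hN hΩ hR hφ1 hs hsΩ
  have htrace : ∫ x in Ω, tr (fderiv ℝ φ x) ^ 2 ≤
      N * ∫ x in Ω, frob (fderiv ℝ φ x) (fderiv ℝ φ x) := by
    rw [← integral_const_mul]
    exact setIntegral_mono hiT (hiD.const_mul _) fun x => tr_sq_le _
  have hkorn : k * ∫ x in Ω, frob (fderiv ℝ φ x) (fderiv ℝ φ x) ≤
      ∫ x in Ω, frob (stress μ lam (fderiv ℝ φ x)) (fderiv ℝ φ x) := by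
    rw [integral_frob_stress_of_tsupport_subset μ lam hΩ hφ hs hsΩ, ← integral_const_mul]
    exact setIntegral_mono (hiD.const_mul _) ((hiD.const_mul _).add (hiT.const_mul _))
      fun x => hkA _
  refine le_trans ?_ hkorn
  rw [integral_add hi hiT, div_mul_eq_mul_div, div_le_iff₀ (by positivity), mul_assoc]
  gcongr
  linarith

end Coercivity

section Sobolev

variable {N : ℕ} {Ω : Set (Eucl N)} {v w : Eucl N → Eucl N}
  {G K : Eucl N → (Eucl N →L[ℝ] Eucl N)}

/-- `v ∈ W^{1,2}_0(Ω; ℝ^N)` with weak gradient `G`, as an `L²` limit of pairs `(φ, ∇φ)` with `φ`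
merely of class `C²_c(Ω)`: fields of that regularity are in reach of a truncation argument. -/
def MemH10 (Ω : Set (Eucl N)) (v : Eucl N → Eucl N)
    (G : Eucl N → (Eucl N →L[ℝ] Eucl N)) : Prop :=
  MemLp v 2 (volume.restrict Ω) ∧ MemLp G 2 (volume.restrict Ω) ∧
  ∃ φ : ℕ → Eucl N → Eucl N,
    (∀ n, ContDiff ℝ 2 (φ n) ∧ HasCompactSupport (φ n) ∧ tsupport (φ n) ⊆ Ω) ∧
    Tendsto (fun n => eLpNorm (fun x => φ n x - v x) 2 (volume.restrict Ω)) atTop (𝓝 0) ∧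
    Tendsto (fun n => eLpNorm (fun x => fderiv ℝ (φ n) x - G x) 2 (volume.restrict Ω))
      atTop (𝓝 0)

theorem MemW012.memH10 (h : MemW012 Ω v G) : MemH10 Ω v G :=
  let ⟨hv, hG, φ, hφ, hφv, hφG⟩ := h
  ⟨hv, hG, φ, fun n => ⟨contDiff_infty.1 (hφ n).1 2, (hφ n).2⟩, hφv, hφG⟩

theorem memLp_two_of_hasCompactSupport {φ : Eucl N → Eucl N} (hφ : ContDiff ℝ 2 φ)
    (hs : HasCompactSupport φ) :
    MemLp φ 2 (volume.restrict Ω) ∧ MemLp (fderiv ℝ φ) 2 (volume.restrict Ω) :=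
  ⟨(hφ.continuous.memLp_of_hasCompactSupport hs).restrict Ω,
    ((hφ.continuous_fderiv two_ne_zero).memLp_of_hasCompactSupport
      (hs.fderiv (𝕜 := ℝ))).restrict Ω⟩

theorem tendsto_eLpNorm_sub_self {α F : Type*} [MeasurableSpace α] {ν : Measure α}
    [NormedAddCommGroup F] {p : ℝ≥0∞} (f : α → F) :
    Tendsto (fun _ : ℕ => eLpNorm (fun x => f x - f x) p ν) atTop (𝓝 0) := by
  simp

theorem tendsto_eLpNorm_sub_sub {α F : Type*} [MeasurableSpace α] {ν : Measure α}
    [NormedAddCommGroup F] {p : ℝ≥0∞} (hp : 1 ≤ p) {f g : ℕ → α → F} {f' g' : α → F}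
    (hfm : ∀ n, AEStronglyMeasurable (fun x => f n x - f' x) ν)
    (hgm : ∀ n, AEStronglyMeasurable (fun x => g n x - g' x) ν)
    (hf : Tendsto (fun n => eLpNorm (fun x => f n x - f' x) p ν) atTop (𝓝 0))
    (hg : Tendsto (fun n => eLpNorm (fun x => g n x - g' x) p ν) atTop (𝓝 0)) :
    Tendsto (fun n => eLpNorm (fun x => (f n x - g n x) - (f' x - g' x)) p ν) atTop (𝓝 0) := by
  refine tendsto_of_tendsto_of_tendsto_of_le_of_le tendsto_const_nhds
    (by simpa using hf.add hg) (fun _ => zero_le) fun n => ?_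
  have hswap : (fun x => (f n x - g n x) - (f' x - g' x)) =
      (fun x => f n x - f' x) - (fun x => g n x - g' x) :=
    funext fun x => sub_sub_sub_comm (f n x) (g n x) (f' x) (g' x)
  exact hswap ▸ eLpNorm_sub_le (hfm n) (hgm n) hp

theorem MemH10.sub (hv : MemH10 Ω v G) (hw : MemH10 Ω w K) :
    MemH10 Ω (fun x => v x - w x) (fun x => G x - K x) := by
  obtain ⟨hv, hG, φ, hφ, hφv, hφG⟩ := hv
  obtain ⟨hw, hK, ψ, hψ, hψw, hψK⟩ := hw
  have hφ2 (n : ℕ) := memLp_two_of_hasCompactSupport (Ω := Ω) (hφ n).1 (hφ n).2.1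
  have hψ2 (n : ℕ) := memLp_two_of_hasCompactSupport (Ω := Ω) (hψ n).1 (hψ n).2.1
  have hfderiv (n : ℕ) (x : Eucl N) :
      fderiv ℝ (fun y => φ n y - ψ n y) x = fderiv ℝ (φ n) x - fderiv ℝ (ψ n) x :=
    fderiv_fun_sub ((hφ n).1.differentiable two_ne_zero x)
      ((hψ n).1.differentiable two_ne_zero x)
  refine ⟨hv.sub hw, hG.sub hK, fun n x => φ n x - ψ n x, fun n => ⟨?_, ?_, ?_⟩, ?_, ?_⟩
  · exact (hφ n).1.sub (hψ n).1
  · exact (hφ n).2.1.sub (hψ n).2.1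
  · exact (tsupport_sub (φ n) (ψ n)).trans (union_subset (hφ n).2.2 (hψ n).2.2)
  · exact tendsto_eLpNorm_sub_sub one_le_two (fun n => ((hφ2 n).1.sub hv).1)
      (fun n => ((hψ2 n).1.sub hw).1) hφv hψw
  · simp only [hfderiv]
    exact tendsto_eLpNorm_sub_sub one_le_two (fun n => ((hφ2 n).2.sub hG).1)
      (fun n => ((hψ2 n).2.sub hK).1) hφG hψK

theorem integrable_bilin_of_memLp_two {α V W : Type*} [MeasurableSpace α] {ν : Measure α}
    [NormedAddCommGroup V] [NormedSpace ℝ V] [NormedAddCommGroup W] [NormedSpace ℝ W]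
    (b : V →L[ℝ] W →L[ℝ] ℝ) {f : α → V} {g : α → W} (hf : MemLp f 2 ν) (hg : MemLp g 2 ν) :
    Integrable (fun x => b (f x) (g x)) ν :=
  memLp_one_iff_integrable.1 (b.memLp_of_bilin 1 hf hg)

theorem tendsto_integral_bilin {α V W : Type*} [MeasurableSpace α] {ν : Measure α}
    [NormedAddCommGroup V] [NormedSpace ℝ V] [NormedAddCommGroup W] [NormedSpace ℝ W]
    (b : V →L[ℝ] W →L[ℝ] ℝ) {f : ℕ → α → V} {g : ℕ → α → W} {f' : α → V} {g' : α → W}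
    (hf : ∀ n, MemLp (f n) 2 ν) (hg : ∀ n, MemLp (g n) 2 ν) (hf' : MemLp f' 2 ν)
    (hg' : MemLp g' 2 ν)
    (hff' : Tendsto (fun n => eLpNorm (fun x => f n x - f' x) 2 ν) atTop (𝓝 0))
    (hgg' : Tendsto (fun n => eLpNorm (fun x => g n x - g' x) 2 ν) atTop (𝓝 0)) :
    Tendsto (fun n => ∫ x, b (f n x) (g n x) ∂ν) atTop (𝓝 (∫ x, b (f' x) (g' x) ∂ν)) := by
  have hpair {k : α → V} {l : α → W} (hk : MemLp k 2 ν) (hl : MemLp l 2 ν) :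
      b.lpPairing ν 2 2 (hk.toLp k) (hl.toLp l) = ∫ x, b (k x) (l x) ∂ν := by
    rw [ContinuousLinearMap.lpPairing_eq_integral]
    refine integral_congr_ae ?_
    filter_upwards [hk.coeFn_toLp, hl.coeFn_toLp] with x hx hy
    rw [hx, hy]
  have hLp := (Lp.tendsto_Lp_iff_tendsto_eLpNorm'' f hf f' hf').2 hff' |>.prodMk_nhds <|
    (Lp.tendsto_Lp_iff_tendsto_eLpNorm'' g hg g' hg').2 hgg'
  simpa only [Function.comp_def, Function.uncurry_apply_pair, hpair, hf, hg, hf', hg'] using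
    ((b.lpPairing ν 2 2).continuous₂.tendsto (hf'.toLp f', hg'.toLp g')).comp hLp

theorem memLp_of_continuousOn_of_bound {F : Type*} [NormedAddCommGroup F]
    [SecondCountableTopologyEither (Eucl N) F] {f : Eucl N → F} {p : ℝ≥0∞} (hΩ : IsOpen Ω)
    (hb : Bornology.IsBounded Ω) (hf : ContinuousOn f Ω) {C : ℝ} (hC : ∀ x ∈ Ω, ‖f x‖ ≤ C) :
    MemLp f p (volume.restrict Ω) := by
  have : IsFiniteMeasure (volume.restrict Ω) := isFiniteMeasure_restrict.2 hb.measure_lt_top.ne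
  exact MemLp.of_bound (hf.aestronglyMeasurable hΩ.measurableSet) C
    (ae_restrict_of_forall_mem hΩ.measurableSet hC)

theorem MemH10.integral_tensorDiv (hΩ : IsOpen Ω) (hb : Bornology.IsBounded Ω)
    {M : Eucl N → (Eucl N →L[ℝ] Eucl N)} (hM : ContDiffOn ℝ 1 M Ω) {C : ℝ}
    (hC : ∀ x ∈ Ω, ‖M x‖ ≤ C) {C' : ℝ} (hC' : ∀ x ∈ Ω, ‖tensorDiv M x‖ ≤ C')
    (h : MemH10 Ω v G) :
    ∫ x in Ω, ((inner ℝ (tensorDiv M x) (v x) : ℝ) + frob (M x) (G x)) = 0 := by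
  obtain ⟨hv, hG, φ, hφ, hφv, hφG⟩ := h
  have hφ2 (n : ℕ) := memLp_two_of_hasCompactSupport (Ω := Ω) (hφ n).1 (hφ n).2.1
  have hdivc : ContinuousOn (tensorDiv M) Ω :=
    continuousOn_finsetSum _ fun j _ => ((hM.continuousOn_fderiv_of_isOpen hΩ le_rfl).clm_apply
      continuousOn_const).clm_apply continuousOn_const
  have hM2 : MemLp M 2 (volume.restrict Ω) :=
    memLp_of_continuousOn_of_bound hΩ hb hM.continuousOn hC
  have hdiv2 : MemLp (tensorDiv M) 2 (volume.restrict Ω) :=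
    memLp_of_continuousOn_of_bound hΩ hb hdivc hC'
  have hlim := (tendsto_integral_bilin (innerSL ℝ) (fun _ => hdiv2) (fun n => (hφ2 n).1) hdiv2 hv
      (tendsto_eLpNorm_sub_self _) hφv).add
    (tendsto_integral_bilin (frobL N) (fun _ => hM2) (fun n => (hφ2 n).2) hM2 hG
      (tendsto_eLpNorm_sub_self M) hφG)
  simp only [← integral_add (integrable_bilin_of_memLp_two (innerSL ℝ) hdiv2 (hφ2 _).1)
      (integrable_bilin_of_memLp_two (frobL N) hM2 (hφ2 _).2),
    ← integral_add (integrable_bilin_of_memLp_two (innerSL ℝ) hdiv2 hv)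
      (integrable_bilin_of_memLp_two (frobL N) hM2 hG)] at hlim
  refine tendsto_nhds_unique hlim (tendsto_const_nhds.congr fun n => ?_)
  exact (integral_tensorDiv_of_tsupport_subset hΩ hM ((hφ n).1.of_le one_le_two) (hφ n).2.1
    (hφ n).2.2).2.symm

theorem MemH10.integral_div (hΩ : IsOpen Ω) (hb : Bornology.IsBounded Ω)
    {f : Eucl N → ℝ} (hf : ContDiffOn ℝ 1 f Ω) {C : ℝ}
    (hC : ∀ x ∈ Ω, ‖f x‖ ≤ C) {C' : ℝ} (hC' : ∀ x ∈ Ω, ‖fderiv ℝ f x‖ ≤ C')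
    (h : MemH10 Ω v G) :
    ∫ x in Ω, (fderiv ℝ f x (v x) + f x * tr (G x)) = 0 := by
  set M : Eucl N → (Eucl N →L[ℝ] Eucl N) := fun y => f y • ContinuousLinearMap.id ℝ (Eucl N)
  have hdiv (x : Eucl N) (hx : x ∈ Ω) :
      tensorDiv M x = ∑ j, fderiv ℝ f x (stdVec j) • stdVec j :=
    tensorDiv_smul_id ((hf.contDiffAt (hΩ.mem_nhds hx)).differentiableAt one_ne_zero)
  have hM (x : Eucl N) (hx : x ∈ Ω) : ‖M x‖ ≤ C * ‖ContinuousLinearMap.id ℝ (Eucl N)‖ := by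
    rw [norm_smul]
    gcongr
    exact hC x hx
  have hM' (x : Eucl N) (hx : x ∈ Ω) : ‖tensorDiv M x‖ ≤ ∑ _j : Fin N, C' := by
    rw [hdiv x hx]
    refine norm_sum_le_of_le _ fun j _ => ?_
    rw [norm_smul, norm_stdVec, mul_one]
    exact ((fderiv ℝ f x).unit_le_opNorm _ (norm_stdVec j).le).trans (hC' x hx)
  rw [← h.integral_tensorDiv hΩ hb (M := M) (hf.smul contDiffOn_const) hM hM']
  refine setIntegral_congr_fun hΩ.measurableSet fun x hx => ?_
  have hfrob : frob (M x) (G x) = f x * tr (G x) := by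
    simp only [M, frob_smul_left, frob_id_left]
  rw [hfrob, hdiv x hx, sum_inner, ← sum_smul_map_stdVec (fderiv ℝ f x) (v x)]
  simp only [inner_smul_left, inner_stdVec_left, smul_eq_mul, conj_trivial, mul_comm]

theorem exists_coercivity_stress_of_memH10 (hN : 0 < N) (hΩ : IsOpen Ω)
    (hb : Bornology.IsBounded Ω)
    {μ lam : ℝ} (hμ : 0 < μ) (hlam : 0 ≤ lam) (hvisc : N = 1 → 0 < lam) :
    ∃ c > 0, ∀ (v : Eucl N → Eucl N) (G : Eucl N → (Eucl N →L[ℝ] Eucl N)), MemH10 Ω v G →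
      c * (∫ x in Ω, (‖v x‖ ^ 2 + tr (G x) ^ 2)) ≤ ∫ x in Ω, frob (stress μ lam (G x)) (G x) := by
  obtain ⟨c, hc, hcoer⟩ := exists_coercivity_stress hN hΩ hb hμ hlam hvisc
  refine ⟨c, hc, fun v G ⟨hv, hG, φ, hφ, hφv, hφG⟩ => ?_⟩
  have hφ2 (n : ℕ) := memLp_two_of_hasCompactSupport (Ω := Ω) (hφ n).1 (hφ n).2.1
  set trSq : (Eucl N →L[ℝ] Eucl N) →L[ℝ] (Eucl N →L[ℝ] Eucl N) →L[ℝ] ℝ :=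
    (ContinuousLinearMap.mul ℝ ℝ).bilinearComp (trL N) (trL N)
  have hsum {w : Eucl N → Eucl N} {K : Eucl N → (Eucl N →L[ℝ] Eucl N)}
      (hw : MemLp w 2 (volume.restrict Ω)) (hK : MemLp K 2 (volume.restrict Ω)) :
      (∫ x in Ω, innerSL ℝ (w x) (w x)) + ∫ x in Ω, trSq (K x) (K x) =
        ∫ x in Ω, (‖w x‖ ^ 2 + tr (K x) ^ 2) := by
    rw [← integral_add (integrable_bilin_of_memLp_two (innerSL ℝ) hw hw)
      (integrable_bilin_of_memLp_two trSq hK hK)]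
    refine integral_congr_ae (ae_of_all _ fun x => ?_)
    change (inner ℝ (w x) (w x) : ℝ) + tr (K x) * tr (K x) = _
    rw [real_inner_self_eq_norm_sq, ← sq]
  have hlower := ((tendsto_integral_bilin (innerSL ℝ) (fun n => (hφ2 n).1) (fun n => (hφ2 n).1)
    hv hv hφv hφv).add (tendsto_integral_bilin trSq (fun n => (hφ2 n).2) (fun n => (hφ2 n).2)
    hG hG hφG hφG)).const_mul c
  have hupper := tendsto_integral_bilin ((frobL N).comp (stressL N μ lam)) (fun n => (hφ2 n).2)
    (fun n => (hφ2 n).2) hG hG hφG hφG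
  rw [hsum hv hG] at hlower
  refine le_of_tendsto_of_tendsto' hlower hupper fun n => ?_
  rw [hsum (hφ2 n).1 (hφ2 n).2]
  exact hcoer (φ n) (hφ n).1 (hφ n).2.1 (hφ n).2.2

end Sobolev

section Truncation

variable {N : ℕ} {Ω : Set (Eucl N)} {V : Eucl N → Eucl N} {κ : ℝ} {x : Eucl N}

theorem tendsto_eLpNorm_of_bounded {α F : Type*} [MeasurableSpace α] {ν : Measure α}
    [IsFiniteMeasure ν] [NormedAddCommGroup F] {p : ℝ≥0∞} (hp : 1 ≤ p) (hp' : p ≠ ⊤)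
    {f : ℕ → α → F} {C : ℝ} (hm : ∀ n, AEStronglyMeasurable (f n) ν)
    (hC : ∀ n, ∀ᵐ x ∂ν, ‖f n x‖ ≤ C) (hlim : ∀ᵐ x ∂ν, Tendsto (fun n => f n x) atTop (𝓝 0)) :
    Tendsto (fun n => eLpNorm (f n) p ν) atTop (𝓝 0) := by
  have hui : UnifIntegrable f p ν := by
    refine unifIntegrable_of hp hp' hm fun ε _ => ⟨C.toNNReal + 1, fun n => ?_⟩
    have hzero : {x | C.toNNReal + 1 ≤ ‖f n x‖₊}.indicator (f n) =ᵐ[ν] 0 := by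
      filter_upwards [hC n] with x hx
      refine indicator_of_notMem (fun h => ?_) _
      have hle : C.toNNReal + 1 ≤ ‖f n x‖ := h
      linarith [Real.le_coe_toNNReal C]
    rw [eLpNorm_congr_ae hzero, eLpNorm_zero]
    exact zero_le
  simpa using tendsto_Lp_finite_of_tendsto_ae hp hp' hm MemLp.zero hui hlim

theorem ae_fderiv_eq_zero_of_eq_zero (hΩ : IsOpen Ω) (hV : DifferentiableOn ℝ V Ω) :
    ∀ᵐ x ∂(volume.restrict Ω), V x = 0 → fderiv ℝ V x = 0 := by
  have hzeros : Ω ∩ V ⁻¹' {0} = Ω \ (Ω ∩ V ⁻¹' {0}ᶜ) := by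
    rw [preimage_compl]
    grind
  have hmeas : MeasurableSet (Ω ∩ V ⁻¹' {0}) := hzeros ▸ hΩ.measurableSet.diff
    (hV.continuousOn.isOpen_inter_preimage hΩ isOpen_compl_singleton).measurableSet
  have happrox : ApproximatesLinearOn V (0 : Eucl N →L[ℝ] Eucl N) (Ω ∩ V ⁻¹' {0}) 0 := by
    rintro x ⟨-, hx : V x = 0⟩ y ⟨-, hy : V y = 0⟩
    simp [hx, hy]
  have h := happrox.norm_fderiv_sub_le volume hmeas (fderiv ℝ V) fun x hx =>
    ((hV x hx.1).differentiableAt (hΩ.mem_nhds hx.1)).hasFDerivAt.hasFDerivWithinAt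
  rw [ae_restrict_iff' hmeas] at h
  rw [ae_restrict_iff' hΩ.measurableSet]
  filter_upwards [h] with x hx hxΩ hx0
  simpa using hx ⟨hxΩ, hx0⟩

/-- A smooth field that agrees with the identity far away and vanishes near the origin. -/
def truncField (N : ℕ) (v : Eucl N) : Eucl N := Real.smoothTransition (‖v‖ ^ 2 - 1) • v

theorem contDiff_truncField : ContDiff ℝ ∞ (truncField N) :=
  (Real.smoothTransition.contDiff.comp
    ((contDiff_id.norm_sq ℝ).sub contDiff_const)).smul contDiff_id

theorem truncField_of_norm_sq_le {v : Eucl N} (h : ‖v‖ ^ 2 ≤ 1) : truncField N v = 0 := by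
  rw [truncField, Real.smoothTransition.zero_of_nonpos (by linarith), zero_smul]

theorem truncField_of_le_norm_sq {v : Eucl N} (h : 2 ≤ ‖v‖ ^ 2) : truncField N v = v := by
  rw [truncField, Real.smoothTransition.one_of_one_le (by linarith), one_smul]

theorem fderiv_truncField_of_lt_norm_sq {v : Eucl N} (h : 2 < ‖v‖ ^ 2) :
    fderiv ℝ (truncField N) v = ContinuousLinearMap.id ℝ (Eucl N) := by
  have hid : truncField N =ᶠ[𝓝 v] id :=
    (continuous_norm.pow 2).continuousAt.eventually_const_lt h |>.mono fun w hw =>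
      truncField_of_le_norm_sq hw.le
  rw [hid.fderiv_eq, fderiv_id]

theorem exists_bound_truncField :
    ∃ K : ℝ, (∀ v, ‖truncField N v - v‖ ≤ K) ∧ ∀ v, ‖fderiv ℝ (truncField N) v‖ ≤ K := by
  have hc : ContDiff ℝ ∞ (fun v => truncField N v - v) := contDiff_truncField.sub contDiff_id
  have hs : HasCompactSupport (fun v => truncField N v - v) := by
    refine HasCompactSupport.intro (isCompact_closedBall (0 : Eucl N) 2) fun v hv => ?_
    rw [mem_closedBall_zero_iff, not_le] at hv
    rw [truncField_of_le_norm_sq (by nlinarith), sub_self]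
  obtain ⟨K₁, hK₁⟩ := hc.continuous.bounded_above_of_compact_support hs
  obtain ⟨K₂, hK₂⟩ := (hc.continuous_fderiv (by simp)).bounded_above_of_compact_support
    (hs.fderiv (𝕜 := ℝ))
  refine ⟨max K₁ (K₂ + 1), fun v => (hK₁ v).trans (le_max_left _ _), fun v => ?_⟩
  have hfderiv : fderiv ℝ (fun v => truncField N v - v) v =
      fderiv ℝ (truncField N) v - ContinuousLinearMap.id ℝ (Eucl N) :=
    ((contDiff_truncField.differentiable (by simp) v).hasFDerivAt.sub (hasFDerivAt_id v)).fderiv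
  calc ‖fderiv ℝ (truncField N) v‖
      ≤ ‖fderiv ℝ (truncField N) v - ContinuousLinearMap.id ℝ (Eucl N)‖ +
          ‖ContinuousLinearMap.id ℝ (Eucl N)‖ := norm_le_norm_sub_add _ _
    _ ≤ K₂ + 1 := add_le_add (hfderiv ▸ hK₂ v) ContinuousLinearMap.norm_id_le
    _ ≤ max K₁ (K₂ + 1) := le_max_right _ _

/-- The truncation `κ⁻¹ T(κ V)` of `V` at height `κ⁻¹`, with `T` the field `truncField`, extended
by zero outside `Ω`. For a field vanishing on `∂Ω` it is compactly supported in `Ω`. -/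
def truncApprox (Ω : Set (Eucl N)) (V : Eucl N → Eucl N) (κ : ℝ) : Eucl N → Eucl N :=
  Ω.indicator fun x => κ⁻¹ • truncField N (κ • V x)

theorem truncApprox_eventuallyEq (hΩ : IsOpen Ω) (hx : x ∈ Ω) :
    truncApprox Ω V κ =ᶠ[𝓝 x] fun x => κ⁻¹ • truncField N (κ • V x) :=
  eventually_of_mem (hΩ.mem_nhds hx) fun _ hy => indicator_of_mem hy _

theorem fderiv_truncApprox (hΩ : IsOpen Ω) (hV : DifferentiableAt ℝ V x) (hκ : κ ≠ 0)
    (hx : x ∈ Ω) :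
    fderiv ℝ (truncApprox Ω V κ) x =
      (fderiv ℝ (truncField N) (κ • V x)).comp (fderiv ℝ V x) := by
  have hT : HasFDerivAt (truncField N) (fderiv ℝ (truncField N) (κ • V x)) (κ • V x) :=
    (contDiff_truncField.differentiable (by simp) _).hasFDerivAt
  have hcomp := (hT.comp x (hV.hasFDerivAt.const_smul κ)).const_smul κ⁻¹
  rw [ContinuousLinearMap.comp_smul, inv_smul_smul₀ hκ] at hcomp
  exact (truncApprox_eventuallyEq hΩ hx).fderiv_eq.trans hcomp.fderiv

theorem norm_truncApprox_sub_le {K : ℝ} (hK : ∀ v, ‖truncField N v - v‖ ≤ K) (hκ : 0 < κ)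
    (hx : x ∈ Ω) : ‖truncApprox Ω V κ x - V x‖ ≤ κ⁻¹ * K := by
  have hscale : truncApprox Ω V κ x - V x = κ⁻¹ • (truncField N (κ • V x) - κ • V x) := by
    rw [truncApprox, indicator_of_mem hx, smul_sub, inv_smul_smul₀ hκ.ne']
  rw [hscale, norm_smul, Real.norm_of_nonneg (inv_nonneg.2 hκ.le)]
  gcongr
  exact hK _

theorem tsupport_truncApprox_subset (hVc : ContinuousOn V (closure Ω)) :
    tsupport (truncApprox Ω V κ) ⊆ closure Ω ∩ V ⁻¹' {v | 1 ≤ ‖κ • v‖ ^ 2} := by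
  refine closure_minimal (fun x hx => ?_) (hVc.preimage_isClosed_of_isClosed isClosed_closure
    (isClosed_le continuous_const (by fun_prop)))
  have hxΩ : x ∈ Ω := by
    by_contra h
    exact hx (indicator_of_notMem h _)
  refine ⟨subset_closure hxΩ, le_of_not_gt (a := (1 : ℝ)) fun h => hx ?_⟩
  rw [truncApprox, indicator_of_mem hxΩ, truncField_of_norm_sq_le h.le, smul_zero]

theorem tsupport_truncApprox_subset_of_vanishing (hΩ : IsOpen Ω)
    (hVc : ContinuousOn V (closure Ω)) (hV0 : ∀ x ∈ frontier Ω, V x = 0) :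
    tsupport (truncApprox Ω V κ) ⊆ Ω := by
  intro x hx
  obtain ⟨hxΩ, hx1 : 1 ≤ ‖κ • V x‖ ^ 2⟩ := tsupport_truncApprox_subset hVc hx
  by_contra h
  have hVx : V x = 0 := hV0 x (hΩ.frontier_eq ▸ ⟨hxΩ, h⟩)
  norm_num [hVx] at hx1

theorem hasCompactSupport_truncApprox (hb : Bornology.IsBounded Ω)
    (hVc : ContinuousOn V (closure Ω)) : HasCompactSupport (truncApprox Ω V κ) :=
  hb.isCompact_closure.of_isClosed_subset (isClosed_tsupport _)
    ((tsupport_truncApprox_subset hVc).trans inter_subset_left)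

theorem contDiff_truncApprox (hΩ : IsOpen Ω) (hV : ContDiffOn ℝ 2 V Ω)
    (hs : tsupport (truncApprox Ω V κ) ⊆ Ω) : ContDiff ℝ 2 (truncApprox Ω V κ) :=
  contDiff_of_tsupport fun x hx =>
    ((((contDiff_infty.1 contDiff_truncField 2).contDiffAt.comp x
      ((hV.contDiffAt (hΩ.mem_nhds (hs hx))).const_smul κ)).const_smul κ⁻¹).congr_of_eventuallyEq
      (truncApprox_eventuallyEq hΩ (hs hx)))

theorem eventually_fderiv_truncApprox_eq {κ : ℕ → ℝ} (hκ : Tendsto κ atTop atTop) (hΩ : IsOpen Ω)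
    (hV : DifferentiableAt ℝ V x) (hx : x ∈ Ω) (hVx : V x = 0 → fderiv ℝ V x = 0) :
    ∀ᶠ n in atTop, fderiv ℝ (truncApprox Ω V (κ n)) x = fderiv ℝ V x := by
  by_cases h0 : V x = 0
  · filter_upwards [hκ.eventually_ne_atTop 0] with n hn
    rw [fderiv_truncApprox hΩ hV hn hx, hVx h0, ContinuousLinearMap.comp_zero]
  · filter_upwards [hκ.eventually_gt_atTop 0,
      (hκ.atTop_mul_const (norm_pos_iff.2 h0)).eventually_gt_atTop 2] with n hn hn2
    have hlarge : 2 < ‖κ n • V x‖ ^ 2 := by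
      rw [norm_smul, Real.norm_of_nonneg hn.le]
      nlinarith
    rw [fderiv_truncApprox hΩ hV hn.ne' hx, fderiv_truncField_of_lt_norm_sq hlarge,
      ContinuousLinearMap.id_comp]

theorem tendsto_eLpNorm_truncApprox_sub {κ : ℕ → ℝ} (hκ : Tendsto κ atTop atTop)
    (hκ1 : ∀ n, 1 ≤ κ n) (hΩ : IsOpen Ω) (hb : Bornology.IsBounded Ω)
    (hm : ∀ n, AEStronglyMeasurable (fun x => truncApprox Ω V (κ n) x - V x)
      (volume.restrict Ω)) :
    Tendsto (fun n => eLpNorm (fun x => truncApprox Ω V (κ n) x - V x) 2 (volume.restrict Ω))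
      atTop (𝓝 0) := by
  have : IsFiniteMeasure (volume.restrict Ω) := isFiniteMeasure_restrict.2 hb.measure_lt_top.ne
  obtain ⟨K, hK, -⟩ := exists_bound_truncField (N := N)
  have hbound (n : ℕ) {x : Eucl N} (hx : x ∈ Ω) : ‖truncApprox Ω V (κ n) x - V x‖ ≤ (κ n)⁻¹ * K :=
    norm_truncApprox_sub_le hK (one_pos.trans_le (hκ1 n)) hx
  refine tendsto_eLpNorm_of_bounded one_le_two ENNReal.ofNat_ne_top (C := K) hm
    (fun n => ae_restrict_of_forall_mem hΩ.measurableSet fun x hx => ?_)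
    (ae_restrict_of_forall_mem hΩ.measurableSet fun x hx => ?_)
  · exact (hbound n hx).trans
      (mul_le_of_le_one_left ((norm_nonneg _).trans (hK 0)) (inv_le_one_of_one_le₀ (hκ1 n)))
  · exact squeeze_zero_norm (fun n => hbound n hx)
      (by simpa using hκ.inv_tendsto_atTop.mul_const K)

theorem tendsto_eLpNorm_fderiv_truncApprox_sub {κ : ℕ → ℝ} (hκ : Tendsto κ atTop atTop)
    (hκ0 : ∀ n, κ n ≠ 0) (hΩ : IsOpen Ω) (hb : Bornology.IsBounded Ω)
    (hV : DifferentiableOn ℝ V Ω) {C : ℝ} (hC : ∀ x ∈ Ω, ‖fderiv ℝ V x‖ ≤ C)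
    (hm : ∀ n, AEStronglyMeasurable (fun x => fderiv ℝ (truncApprox Ω V (κ n)) x - fderiv ℝ V x)
      (volume.restrict Ω)) :
    Tendsto (fun n => eLpNorm (fun x => fderiv ℝ (truncApprox Ω V (κ n)) x - fderiv ℝ V x) 2
      (volume.restrict Ω)) atTop (𝓝 0) := by
  have : IsFiniteMeasure (volume.restrict Ω) := isFiniteMeasure_restrict.2 hb.measure_lt_top.ne
  have hVd {x : Eucl N} (hx : x ∈ Ω) : DifferentiableAt ℝ V x :=
    hV.differentiableAt (hΩ.mem_nhds hx)
  obtain ⟨K, -, hK⟩ := exists_bound_truncField (N := N)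
  refine tendsto_eLpNorm_of_bounded one_le_two ENNReal.ofNat_ne_top (C := K * C + C) hm
    (fun n => ae_restrict_of_forall_mem hΩ.measurableSet fun x hx => ?_) ?_
  · rw [fderiv_truncApprox hΩ (hVd hx) (hκ0 n) hx]
    exact (norm_sub_le _ _).trans (add_le_add ((ContinuousLinearMap.opNorm_comp_le _ _).trans
      (mul_le_mul (hK _) (hC x hx) (norm_nonneg _) ((norm_nonneg _).trans (hK 0)))) (hC x hx))
  · filter_upwards [ae_fderiv_eq_zero_of_eq_zero hΩ hV, ae_restrict_mem hΩ.measurableSet]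
      with x hx0 hx
    refine tendsto_const_nhds.congr' ?_
    filter_upwards [eventually_fderiv_truncApprox_eq hκ hΩ (hVd hx) hx hx0] with n hn
    rw [hn, sub_self]

theorem memH10_of_vanishing (hΩ : IsOpen Ω) (hb : Bornology.IsBounded Ω)
    (hV : ContDiffOn ℝ 2 V Ω) (hVc : ContinuousOn V (closure Ω))
    (hV0 : ∀ x ∈ frontier Ω, V x = 0) {C : ℝ} (hC : ∀ x ∈ Ω, ‖fderiv ℝ V x‖ ≤ C) :
    MemH10 Ω V (fderiv ℝ V) := by
  obtain ⟨CV, hCV⟩ := hb.isCompact_closure.exists_bound_of_continuousOn hVc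
  have hV2 : MemLp V 2 (volume.restrict Ω) :=
    memLp_of_continuousOn_of_bound hΩ hb hV.continuousOn fun x hx => hCV x (subset_closure hx)
  have hG2 : MemLp (fderiv ℝ V) 2 (volume.restrict Ω) :=
    memLp_of_continuousOn_of_bound hΩ hb (hV.continuousOn_fderiv_of_isOpen hΩ one_le_two) hC
  set κ : ℕ → ℝ := fun n => n + 1 with hκ
  have hκ1 (n : ℕ) : 1 ≤ κ n := by simp [hκ]
  have hκtop : Tendsto κ atTop atTop :=
    tendsto_atTop_add_const_right _ _ tendsto_natCast_atTop_atTop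
  have hsub (n : ℕ) := tsupport_truncApprox_subset_of_vanishing (κ := κ n) hΩ hVc hV0
  have hsupp (n : ℕ) := hasCompactSupport_truncApprox (κ := κ n) hb hVc
  have hsmooth (n : ℕ) := contDiff_truncApprox hΩ hV (hsub n)
  have hφ2 (n : ℕ) := memLp_two_of_hasCompactSupport (Ω := Ω) (hsmooth n) (hsupp n)
  exact ⟨hV2, hG2, fun n => truncApprox Ω V (κ n), fun n => ⟨hsmooth n, hsupp n, hsub n⟩,
    tendsto_eLpNorm_truncApprox_sub hκtop hκ1 hΩ hb fun n => ((hφ2 n).1.sub hV2).1,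
    tendsto_eLpNorm_fderiv_truncApprox_sub hκtop (fun n => (one_pos.trans_le (hκ1 n)).ne') hΩ hb
      (hV.differentiableOn two_ne_zero) hC fun n => ((hφ2 n).2.sub hG2).1⟩

end Truncation

section RelativePotential

variable {a γ : ℝ}

/-- The isentropic part `a/(γ-1) s^γ` of the pressure potential. -/
def potential (a γ s : ℝ) : ℝ := a / (γ - 1) * s ^ γ

/-- The derivative of `potential`. -/
def enthalpy (a γ s : ℝ) : ℝ := a * γ / (γ - 1) * s ^ (γ - 1)

/-- The derivative of `enthalpy`. -/
def enthalpyDeriv (a γ s : ℝ) : ℝ := a * γ * s ^ (γ - 2)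

/-- The Bregman distance of the isentropic potential. -/
def relPotential (a γ s r : ℝ) : ℝ :=
  potential a γ s - enthalpy a γ r * (s - r) - potential a γ r

theorem rpow_eq_mul_rpow_sub_one {s : ℝ} (hs : 0 < s) (p : ℝ) : s ^ p = s * s ^ (p - 1) := by
  rw [Real.rpow_sub_one hs.ne', mul_div_cancel₀ _ hs.ne']

theorem hasDerivAt_enthalpy (hγ : 1 < γ) {s : ℝ} (hs : 0 < s) :
    HasDerivAt (enthalpy a γ) (enthalpyDeriv a γ s) s := by
  refine ((Real.hasDerivAt_rpow_const (p := γ - 1) (Or.inl hs.ne')).const_mul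
    (a * γ / (γ - 1))).congr_deriv ?_
  have : γ - 1 ≠ 0 := by linarith
  rw [enthalpyDeriv, show γ - 1 - 1 = γ - 2 by ring]
  field_simp

theorem hasDerivAt_rpow_pressure {s : ℝ} (hs : 0 < s) :
    HasDerivAt (fun s => a * s ^ γ) (s * enthalpyDeriv a γ s) s := by
  refine ((Real.hasDerivAt_rpow_const (p := γ) (Or.inl hs.ne')).const_mul a).congr_deriv ?_
  rw [rpow_eq_mul_rpow_sub_one hs (γ - 1), enthalpyDeriv, show γ - 1 - 1 = γ - 2 by ring]
  ring

theorem sub_one_mul_potential (hγ : 1 < γ) (s : ℝ) : (γ - 1) * potential a γ s = a * s ^ γ := by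
  have : γ - 1 ≠ 0 := by linarith
  rw [potential]
  field_simp

theorem mul_enthalpy_sub_potential (hγ : 1 < γ) {s : ℝ} (hs : 0 < s) :
    s * enthalpy a γ s - potential a γ s = a * s ^ γ := by
  have : γ - 1 ≠ 0 := by linarith
  rw [enthalpy, potential, rpow_eq_mul_rpow_sub_one hs γ]
  field_simp

theorem sub_one_mul_enthalpy (hγ : 1 < γ) {s : ℝ} (hs : 0 < s) :
    (γ - 1) * enthalpy a γ s = s * enthalpyDeriv a γ s := by
  have : γ - 1 ≠ 0 := by linarith
  rw [enthalpy, enthalpyDeriv, rpow_eq_mul_rpow_sub_one hs (γ - 1),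
    show γ - 1 - 1 = γ - 2 by ring]
  field_simp

theorem relPotential_nonneg (ha : 0 ≤ a) (hγ : 1 < γ) {s r : ℝ} (hs : 0 ≤ s) (hr : 0 < r) :
    0 ≤ relPotential a γ s r := by
  have hbernoulli : (1 + γ * (s / r - 1)) * r ^ γ ≤ s ^ γ := by
    have h := one_add_mul_self_le_rpow_one_add (s := s / r - 1) (p := γ)
      (by linarith [div_nonneg hs hr.le]) hγ.le
    rwa [add_sub_cancel, Real.div_rpow hs hr.le,
      le_div_iff₀ (Real.rpow_pos_of_pos hr γ)] at h
  have htangent : relPotential a γ s r =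
      a / (γ - 1) * (s ^ γ - (1 + γ * (s / r - 1)) * r ^ γ) := by
    rw [relPotential, potential, enthalpy, potential, rpow_eq_mul_rpow_sub_one hr γ]
    field_simp
    ring
  rw [htangent]
  exact mul_nonneg (div_nonneg ha (by linarith)) (by linarith)

theorem relPotential_eq_add (s m r : ℝ) :
    relPotential a γ s r = relPotential a γ s m + relPotential a γ m r
      + (enthalpy a γ m - enthalpy a γ r) * (s - m) := by
  simp only [relPotential]
  ring

theorem enthalpy_mono (ha : 0 ≤ a) (hγ : 1 < γ) {x y : ℝ} (hx : 0 ≤ x) (hxy : x ≤ y) :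
    enthalpy a γ x ≤ enthalpy a γ y := by
  unfold enthalpy
  have : 0 ≤ a * γ / (γ - 1) := div_nonneg (by positivity) (by linarith)
  gcongr

theorem exists_enthalpy_increment (ha : 0 < a) (hγ : 1 < γ) {r₀ R₀ : ℝ} (h0 : 0 < r₀)
    (hrR : r₀ ≤ R₀) :
    ∃ c > 0, ∀ x ∈ Icc r₀ R₀, ∀ y ∈ Icc r₀ R₀, x ≤ y →
      c * (y - x) ≤ enthalpy a γ y - enthalpy a γ x := by
  have hcont : ContinuousOn (enthalpyDeriv a γ) (Icc r₀ R₀) :=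
    continuousOn_const.mul
      (continuousOn_id.rpow_const fun x hx => Or.inl (h0.trans_le hx.1).ne')
  obtain ⟨z, hz, hmin⟩ := isCompact_Icc.exists_isMinOn ⟨r₀, le_rfl, hrR⟩ hcont
  have hderiv {x : ℝ} (hx : x ∈ Icc r₀ R₀) : HasDerivAt (enthalpy a γ) (enthalpyDeriv a γ x) x :=
    hasDerivAt_enthalpy hγ (h0.trans_le hx.1)
  refine ⟨enthalpyDeriv a γ z, ?_, (convex_Icc r₀ R₀).mul_sub_le_image_sub_of_le_deriv
    (fun x hx => (hderiv hx).continuousAt.continuousWithinAt)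
    (fun x hx => (hderiv (interior_subset hx)).differentiableAt.differentiableWithinAt)
    fun x hx => ?_⟩
  · exact mul_pos (by positivity) (Real.rpow_pos_of_pos (h0.trans_le hz.1) _)
  · rw [(hderiv (interior_subset hx)).deriv]
    exact hmin (interior_subset hx)

/-- The gauge `min(z², |z|)`, which the relative potential dominates: quadratic near the diagonal,
linear far from it. -/
def sqMinAbs (z : ℝ) : ℝ := min (z ^ 2) |z|

theorem sqMinAbs_le_sq (z : ℝ) : sqMinAbs z ≤ z ^ 2 := min_le_left _ _

theorem sqMinAbs_le_abs (z : ℝ) : sqMinAbs z ≤ |z| := min_le_right _ _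

theorem sqMinAbs_nonneg (z : ℝ) : 0 ≤ sqMinAbs z := le_min (sq_nonneg z) (abs_nonneg z)

theorem sqMinAbs_of_abs_le_one {z : ℝ} (hz : |z| ≤ 1) : sqMinAbs z = z ^ 2 :=
  min_eq_left (by rw [← sq_abs]; nlinarith [abs_nonneg z])

theorem sqMinAbs_of_one_le_abs {z : ℝ} (hz : 1 ≤ |z|) : sqMinAbs z = |z| :=
  min_eq_right (by rw [← sq_abs]; nlinarith)

theorem min_mul_sqMinAbs_le {ρ : ℝ} (hρ : 0 ≤ ρ) (z : ℝ) :
    min (1 / 2) ρ * sqMinAbs z ≤ min (|z| / 2) ρ * |z| := by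
  rcases le_total (|z| / 2) ρ with h | h
  · calc min (1 / 2) ρ * sqMinAbs z ≤ 1 / 2 * z ^ 2 :=
          mul_le_mul (min_le_left _ _) (sqMinAbs_le_sq z) (sqMinAbs_nonneg z) (by norm_num)
      _ = min (|z| / 2) ρ * |z| := by rw [min_eq_left h, ← sq_abs]; ring
  · rw [min_eq_right h]
    exact mul_le_mul (min_le_right _ _) (sqMinAbs_le_abs z) (sqMinAbs_nonneg z) hρ

theorem exists_enthalpy_midpoint_increment (ha : 0 < a) (hγ : 1 < γ) {r₀ R₀ : ℝ} (h0 : 0 < r₀)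
    (hrR : r₀ ≤ R₀) :
    ∃ c > 0, ∀ r ∈ Icc r₀ R₀, ∀ s, 0 ≤ s →
      c * (min (|s - r| / 2) (r₀ / 2) * |s - r|) ≤
        (enthalpy a γ ((s + r) / 2) - enthalpy a γ r) * (s - r) := by
  obtain ⟨c, hc, hinc⟩ := exists_enthalpy_increment ha hγ (r₀ := r₀ / 2) (R₀ := R₀ + r₀ / 2)
    (by linarith) (by linarith)
  refine ⟨c, hc, fun r ⟨hr₀, hR₀⟩ s hs => ?_⟩
  have hrJ : r ∈ Icc (r₀ / 2) (R₀ + r₀ / 2) := ⟨by linarith, by linarith⟩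
  set t := min (|s - r| / 2) (r₀ / 2)
  have ht0 : 0 ≤ t := le_min (by positivity) (by positivity)
  have ht1 : t ≤ |s - r| / 2 := min_le_left _ _
  have ht2 : t ≤ r₀ / 2 := min_le_right _ _
  rcases le_total r s with h | h
  · rw [abs_of_nonneg (sub_nonneg.2 h)] at ht1 ⊢
    have hstep := hinc r hrJ (r + t) ⟨by linarith, by linarith⟩ (by linarith)
    have hmono := enthalpy_mono ha.le hγ (x := r + t) (y := (s + r) / 2) (by linarith)
      (by linarith)
    rw [← mul_assoc]
    exact mul_le_mul_of_nonneg_right (by linarith) (sub_nonneg.2 h)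
  · rw [abs_of_nonpos (sub_nonpos.2 h)] at ht1 ⊢
    have hstep := hinc (r - t) ⟨by linarith, by linarith⟩ r hrJ (by linarith)
    have hmono := enthalpy_mono ha.le hγ (x := (s + r) / 2) (y := r - t) (by linarith)
      (by linarith)
    nlinarith

-- Inserting the midpoint `m` into the Bregman distance leaves, besides two nonnegative terms, the
-- increment of the monotone enthalpy between `r` and `m`.
theorem exists_coercivity_relPotential (ha : 0 < a) (hγ : 1 < γ) {r₀ R₀ : ℝ} (h0 : 0 < r₀)
    (hrR : r₀ ≤ R₀) :
    ∃ c > 0, ∀ r ∈ Icc r₀ R₀, ∀ s, 0 ≤ s → c * sqMinAbs (s - r) ≤ relPotential a γ s r := by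
  obtain ⟨c, hc, hinc⟩ := exists_enthalpy_midpoint_increment ha hγ h0 hrR
  refine ⟨c / 2 * min (1 / 2) (r₀ / 2), by positivity, fun r hr s hs => ?_⟩
  have hr0 : 0 < r := h0.trans_le hr.1
  have hm0 : 0 < (s + r) / 2 := by linarith
  have hgauge := mul_le_mul_of_nonneg_left
    (min_mul_sqMinAbs_le (half_pos h0).le (s - r)) (half_pos hc).le
  have hsm := relPotential_nonneg ha.le hγ hs hm0
  have hmr := relPotential_nonneg ha.le hγ hm0.le hr0
  rw [relPotential_eq_add s ((s + r) / 2) r, show s - (s + r) / 2 = (s - r) / 2 by ring]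
  linarith [hinc r hr s hs]

theorem eq_of_relPotential_eq_zero (ha : 0 < a) (hγ : 1 < γ) {s r : ℝ} (hs : 0 ≤ s) (hr : 0 < r)
    (h : relPotential a γ s r = 0) : s = r := by
  obtain ⟨c, hc, hcoer⟩ := exists_coercivity_relPotential ha hγ hr le_rfl
  by_contra hne
  have hpos : 0 < sqMinAbs (s - r) :=
    lt_min (sq_pos_of_ne_zero (sub_ne_zero.2 hne)) (abs_pos.2 (sub_ne_zero.2 hne))
  exact (mul_pos hc hpos).not_ge (h ▸ hcoer r ⟨le_rfl, le_rfl⟩ s hs)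

end RelativePotential

section Remainder

theorem mul_le_mul_sq_add_sq_div {δ : ℝ} (hδ : 0 < δ) (x y : ℝ) :
    x * y ≤ δ * y ^ 2 + x ^ 2 / (4 * δ) := by
  have hsq : δ * y ^ 2 + x ^ 2 / (4 * δ) - x * y = (2 * δ * y - x) ^ 2 / (4 * δ) := by
    field_simp
    ring
  have : 0 ≤ (2 * δ * y - x) ^ 2 / (4 * δ) := by positivity
  linarith

theorem sq_sub_le_or_abs_sub_le {s r R : ℝ} (hs : 0 ≤ s) (hr : 0 ≤ r) (hrR : r ≤ R) :
    (s - r) ^ 2 ≤ (1 + R) * sqMinAbs (s - r) ∨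
      |s - r| ≤ s ∧ |s - r| = sqMinAbs (s - r) := by
  have hz := abs_nonneg (s - r)
  rcases le_total |s - r| 1 with h | h
  · rw [sqMinAbs_of_abs_le_one h]
    exact Or.inl (le_mul_of_one_le_left (sq_nonneg _) (by linarith))
  · rw [sqMinAbs_of_one_le_abs h]
    rcases le_total s r with hsr | hsr
    · refine Or.inl ?_
      have : |s - r| ≤ R := by
        rw [abs_of_nonpos (sub_nonpos.2 hsr)]
        linarith
      rw [← sq_abs]
      nlinarith
    · exact Or.inr ⟨by rw [abs_of_nonneg (sub_nonneg.2 hsr)]; linarith, rfl⟩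

theorem mul_abs_sub_mul_le {s r R K δ : ℝ} (hs : 0 ≤ s) (hr : 0 ≤ r) (hrR : r ≤ R) (hK : 0 ≤ K)
    (hδ : 0 < δ) (W : ℝ) :
    K * (|s - r| * W) ≤
      δ * W ^ 2 + K * (s * W ^ 2) + (K ^ 2 * (1 + R) / (4 * δ) + K) * sqMinAbs (s - r) := by
  have hR : 0 ≤ R := hr.trans hrR
  have hg := sqMinAbs_nonneg (s - r)
  have hsW : 0 ≤ K * (s * W ^ 2) := by positivity
  have hKg : 0 ≤ K * sqMinAbs (s - r) := by positivity
  rw [add_mul]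
  rcases sq_sub_le_or_abs_sub_le hs hr hrR with h | ⟨hle, heq⟩
  · have hyoung := mul_le_mul_sq_add_sq_div hδ (K * |s - r|) W
    have hquad : (K * |s - r|) ^ 2 / (4 * δ) ≤
        K ^ 2 * (1 + R) / (4 * δ) * sqMinAbs (s - r) := by
      rw [mul_pow, sq_abs, div_mul_eq_mul_div, mul_assoc]
      gcongr
    linarith
  · have hlin : |s - r| * W ≤ s * W ^ 2 + sqMinAbs (s - r) := by
      have hsq : |s - r| * W ^ 2 ≤ s * W ^ 2 := by gcongr
      rw [← heq]
      nlinarith [mul_nonneg (abs_nonneg (s - r)) (sq_nonneg (W - 1)),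
        mul_nonneg (abs_nonneg (s - r)) (sq_nonneg (W + 1))]
    have : 0 ≤ δ * W ^ 2 := by positivity
    have : 0 ≤ K ^ 2 * (1 + R) / (4 * δ) * sqMinAbs (s - r) := by positivity
    linarith [mul_le_mul_of_nonneg_left hlin hK]

theorem sq_sub_le_mul_sqMinAbs {q : ℝ → ℝ} {L : NNReal} {Q : ℝ} (hL : LipschitzWith L q)
    (hQ : ∀ s, ‖q s‖ ≤ Q) (s r : ℝ) :
    (q s - q r) ^ 2 ≤ (L ^ 2 + 2 * Q * L) * sqMinAbs (s - r) := by
  have hQ0 : 0 ≤ Q := (norm_nonneg _).trans (hQ 0)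
  have hlip : |q s - q r| ≤ L * |s - r| := hL.dist_le_mul s r
  have hbdd : |q s - q r| ≤ 2 * Q := (norm_sub_le (q s) (q r)).trans (by linarith [hQ s, hQ r])
  rw [← sq_abs (q s - q r)]
  rcases le_total |s - r| 1 with h | h
  · rw [sqMinAbs_of_abs_le_one h, ← sq_abs (s - r)]
    calc |q s - q r| ^ 2 ≤ (L * |s - r|) ^ 2 := by gcongr
      _ = L ^ 2 * |s - r| ^ 2 := mul_pow _ _ _
      _ ≤ (L ^ 2 + 2 * Q * L) * |s - r| ^ 2 := by
        gcongr
        exact le_add_of_nonneg_right (by positivity)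
  · rw [sqMinAbs_of_one_le_abs h]
    calc |q s - q r| ^ 2 = |q s - q r| * |q s - q r| := sq _
      _ ≤ 2 * Q * (L * |s - r|) := mul_le_mul hbdd hlip (abs_nonneg _) (by positivity)
      _ = 2 * Q * L * |s - r| := (mul_assoc _ _ _).symm
      _ ≤ (L ^ 2 + 2 * Q * L) * |s - r| := by
        gcongr
        exact le_add_of_nonneg_left (by positivity)

theorem IsTestOnPos.exists_abs_sub_mul_abs_le {q : ℝ → ℝ} (hq : IsTestOnPos q) {δ : ℝ}
    (hδ : 0 < δ) :
    ∃ C ≥ 0, ∀ s r D : ℝ, |q s - q r| * |D| ≤ δ * D ^ 2 + C * sqMinAbs (s - r) := by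
  obtain ⟨L, hL⟩ := hq.1.lipschitzWith_of_hasCompactSupport hq.2.1 (by simp)
  obtain ⟨Q, hQ⟩ := hq.1.continuous.bounded_above_of_compact_support hq.2.1
  have hQ0 : 0 ≤ Q := (norm_nonneg _).trans (hQ 0)
  refine ⟨(L ^ 2 + 2 * Q * L) / (4 * δ), by positivity, fun s r D => ?_⟩
  calc |q s - q r| * |D| ≤ δ * |D| ^ 2 + |q s - q r| ^ 2 / (4 * δ) :=
        mul_le_mul_sq_add_sq_div hδ _ _
    _ ≤ δ * D ^ 2 + (L ^ 2 + 2 * Q * L) / (4 * δ) * sqMinAbs (s - r) := by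
      rw [sq_abs, sq_abs, div_mul_eq_mul_div]
      gcongr
      exact sq_sub_le_mul_sqMinAbs hL hQ s r

theorem exists_remainder_bound {a γ : ℝ} (ha : 0 < a) (hγ : 1 < γ) {q : ℝ → ℝ}
    (hq : IsTestOnPos q) {r₀ R₀ : ℝ} (h0 : 0 < r₀) (hrR : r₀ ≤ R₀) {KB KF Kt δ : ℝ}
    (hKB : 0 ≤ KB) (hKF : 0 ≤ KF) (hKt : 0 ≤ Kt) (hδ : 0 < δ) :
    ∃ C, ∀ r ∈ Icc r₀ R₀, ∀ s, 0 ≤ s → ∀ W D : ℝ,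
      KB * (s * W ^ 2) + KF * (|s - r| * W) + Kt * ((γ - 1) * relPotential a γ s r)
        + |q s - q r| * |D| ≤
      C * (1 / 2 * s * W ^ 2 + relPotential a γ s r) + δ * (W ^ 2 + D ^ 2) := by
  obtain ⟨c, hc, hcoer⟩ := exists_coercivity_relPotential ha hγ h0 hrR
  obtain ⟨Cq, hCq, hqD⟩ := hq.exists_abs_sub_mul_abs_le hδ
  have hR₀ : 0 ≤ R₀ := h0.le.trans hrR
  have : 0 < γ - 1 := sub_pos.2 hγ
  set CF : ℝ := KF ^ 2 * (1 + R₀) / (4 * δ) + KF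
  have : 0 ≤ CF := by positivity
  refine ⟨2 * (KB + KF) + (CF + Cq) / c + Kt * (γ - 1), fun r hr s hs W D => ?_⟩
  have hr0 : 0 < r := h0.trans_le hr.1
  have hforce := mul_abs_sub_mul_le hs hr0.le hr.2 hKF hδ W
  have hgauge : (CF + Cq) * sqMinAbs (s - r) ≤ (CF + Cq) / c * relPotential a γ s r := by
    rw [div_mul_eq_mul_div, le_div_iff₀ hc, mul_assoc, mul_comm (sqMinAbs _) c]
    exact mul_le_mul_of_nonneg_left (hcoer r hr s hs) (by positivity)
  have hrel := relPotential_nonneg ha.le hγ hs hr0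
  have : 0 ≤ (KB + KF) * relPotential a γ s r := by positivity
  have : 0 ≤ ((CF + Cq) / c + Kt * (γ - 1)) * (s * W ^ 2) := by positivity
  linarith [hqD s r D]

end Remainder

section PressurePotential

variable {q : ℝ → ℝ}

theorem IsTestOnPos.eq_zero_of_nonpos (hq : IsTestOnPos q) {s : ℝ} (hs : s ≤ 0) : q s = 0 :=
  image_eq_zero_of_notMem_tsupport fun h => hs.not_gt (hq.2.2 h)

theorem IsTestOnPos.contDiff_div_sq (hq : IsTestOnPos q) :
    ContDiff ℝ 1 (fun z => q z / z ^ 2) := by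
  refine contDiff_of_tsupport fun x hx => ?_
  have hsub : tsupport (fun z => q z / z ^ 2) ⊆ tsupport q :=
    closure_mono fun z hz hqz => hz (by simp only [hqz, zero_div])
  have hx0 : 0 < x := hq.2.2 (hsub hx)
  exact (contDiff_infty.1 hq.1 1).contDiffAt.div (contDiffAt_id.pow 2) (by positivity)

theorem IsTestOnPos.integrable_div_sq (hq : IsTestOnPos q) :
    Integrable (fun z => q z / z ^ 2) :=
  hq.contDiff_div_sq.continuous.integrable_of_hasCompactSupport
    (hq.2.1.mono fun _ hz hqz => hz (by simp only [hqz, zero_div]))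

theorem integral_Ioi_eq_sub_intervalIntegral {f : ℝ → ℝ} (hf : Integrable f) (b s : ℝ) :
    ∫ z in Ioi s, f z = (∫ z in Ioi b, f z) - ∫ z in b..s, f z := by
  rw [← intervalIntegral.integral_Ioi_sub_Ioi' hf.integrableOn hf.integrableOn, sub_sub_cancel]

theorem hasDerivAt_integral_Ioi {f : ℝ → ℝ} (hf : Continuous f) (hfi : Integrable f) (s : ℝ) :
    HasDerivAt (fun s => ∫ z in Ioi s, f z) (-f s) s := by
  have heq : (fun s => ∫ z in Ioi s, f z) = fun s => (∫ z in Ioi 0, f z) - ∫ z in (0 : ℝ)..s, f z :=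
    funext (integral_Ioi_eq_sub_intervalIntegral hfi 0)
  rw [heq]
  exact (intervalIntegral.integral_hasDerivAt_right (hf.intervalIntegrable _ _)
    (hf.stronglyMeasurableAtFilter _ _) hf.continuousAt).const_sub _

/-- The part of `pressurePotential` that stems from the perturbation `q` of the isentropic law. -/
def perturbationPotential (q : ℝ → ℝ) (s : ℝ) : ℝ := s * ∫ z in (1 : ℝ)..s, q z / z ^ 2

theorem pressurePotential_eq_add (a γ s : ℝ) :
    pressurePotential a γ q s = potential a γ s + perturbationPotential q s := rfl

/-- The potential `-s ∫_s^∞ q(z)/z² dz` of the perturbation `q`. It differs from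
`perturbationPotential` by a linear term; unlike the latter it is constant for large `s`, hence
admissible in the renormalized continuity equation. -/
def testPotential (q : ℝ → ℝ) (s : ℝ) : ℝ := -(s * ∫ z in Ioi s, q z / z ^ 2)

theorem IsTestOnPos.perturbationPotential_eq (hq : IsTestOnPos q) (s : ℝ) :
    perturbationPotential q s = (∫ z in Ioi 1, q z / z ^ 2) * s + testPotential q s := by
  rw [perturbationPotential, testPotential,
    integral_Ioi_eq_sub_intervalIntegral hq.integrable_div_sq 1 s]
  ring

theorem IsTestOnPos.hasDerivAt_testPotential (hq : IsTestOnPos q) (s : ℝ) :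
    HasDerivAt (testPotential q) (s * (q s / s ^ 2) - ∫ z in Ioi s, q z / z ^ 2) s := by
  refine ((hasDerivAt_id s).mul (hasDerivAt_integral_Ioi hq.contDiff_div_sq.continuous
    hq.integrable_div_sq s)).fun_neg.congr_deriv ?_
  simp only [id]
  ring

theorem IsTestOnPos.contDiff_testPotential (hq : IsTestOnPos q) :
    ContDiff ℝ 1 (testPotential q) := by
  refine contDiff_one_iff_deriv.2 ⟨fun s => (hq.hasDerivAt_testPotential s).differentiableAt, ?_⟩
  have hderiv : deriv (testPotential q) =
      fun s => s * (q s / s ^ 2) - ∫ z in Ioi s, q z / z ^ 2 :=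
    funext fun s => (hq.hasDerivAt_testPotential s).deriv
  rw [hderiv]
  exact (continuous_id.mul hq.contDiff_div_sq.continuous).sub <|
    continuous_iff_continuousAt.2 fun s => (hasDerivAt_integral_Ioi hq.contDiff_div_sq.continuous
      hq.integrable_div_sq s).continuousAt

theorem IsTestOnPos.testPotential_sub_deriv_mul (hq : IsTestOnPos q) (s : ℝ) :
    testPotential q s - deriv (testPotential q) s * s = -q s := by
  rw [(hq.hasDerivAt_testPotential s).deriv, testPotential]
  rcases eq_or_ne s 0 with rfl | hs
  · simp [hq.eq_zero_of_nonpos le_rfl]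
  · field_simp
    ring

theorem IsTestOnPos.exists_integral_Ioi_eq_zero (hq : IsTestOnPos q) :
    ∃ R : ℝ, ∀ s, R ≤ s → q s = 0 ∧ ∫ z in Ioi s, q z / z ^ 2 = 0 := by
  obtain ⟨R, hR⟩ := hq.2.1.isCompact.bddAbove
  have hzero {z : ℝ} (hz : R < z) : q z = 0 :=
    image_eq_zero_of_notMem_tsupport fun h => hz.not_ge (hR h)
  refine ⟨R + 1, fun s hs => ⟨hzero (by linarith), ?_⟩⟩
  refine setIntegral_eq_zero_of_forall_eq_zero fun z (hz : s < z) => ?_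
  rw [hzero (by linarith), zero_div]

theorem IsTestOnPos.exists_deriv_testPotential_eq_zero (hq : IsTestOnPos q) :
    ∃ R : ℝ, ∀ s, R ≤ s → deriv (testPotential q) s = 0 := by
  obtain ⟨R, hR⟩ := hq.exists_integral_Ioi_eq_zero
  refine ⟨R, fun s hs => ?_⟩
  rw [(hq.hasDerivAt_testPotential s).deriv, (hR s hs).1, (hR s hs).2, zero_div, mul_zero, sub_zero]

theorem IsTestOnPos.exists_bound_testPotential (hq : IsTestOnPos q) :
    ∃ K : ℝ, ∀ s, 0 ≤ s → |testPotential q s| ≤ K := by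
  obtain ⟨R, hR⟩ := hq.exists_integral_Ioi_eq_zero
  obtain ⟨K, hK⟩ := (isCompact_Icc (a := (0 : ℝ)) (b := R)).exists_bound_of_continuousOn
    hq.contDiff_testPotential.continuous.continuousOn
  refine ⟨max K 0, fun s hs => ?_⟩
  rcases le_total s R with h | h
  · exact (hK s ⟨hs, h⟩).trans (le_max_left _ _)
  · rw [testPotential, (hR s h).2, mul_zero, neg_zero, abs_zero]
    exact le_max_right _ _

theorem IsTestOnPos.exists_bound_perturbationPotential (hq : IsTestOnPos q) :
    ∃ K : ℝ, ∀ s, 0 ≤ s → |perturbationPotential q s| ≤ K * (1 + s) := by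
  obtain ⟨K, hK⟩ := hq.exists_bound_testPotential
  refine ⟨|∫ z in Ioi 1, q z / z ^ 2| + K, fun s hs => ?_⟩
  have hK0 : 0 ≤ K := (abs_nonneg _).trans (hK s hs)
  rw [hq.perturbationPotential_eq]
  refine (abs_add_le _ _).trans ?_
  rw [abs_mul, abs_of_nonneg hs]
  nlinarith [hK s hs, abs_nonneg (∫ z in Ioi 1, q z / z ^ 2), mul_nonneg hK0 hs]

end PressurePotential

section CylinderIntegrals

variable {N : ℕ} {Ω : Set (Eucl N)} {T : ℝ}

theorem restrict_cylinder : (volume : Measure (ℝ × Eucl N)).restrict (cylinder Ω T) =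
    (volume.restrict (Ioo 0 T)).prod (volume.restrict Ω) := by
  rw [cylinder, Measure.volume_eq_prod, Measure.prod_restrict]

theorem cylinder_mono {τ : ℝ} (hτ : τ ≤ T) : cylinder Ω τ ⊆ cylinder Ω T :=
  prod_mono (Ioo_subset_Ioo_right hτ) Subset.rfl

theorem intervalIntegral_eq_integral_cylinder {f : ℝ → Eucl N → ℝ} {τ : ℝ} (h0 : 0 ≤ τ)
    (hτ : τ ≤ T)
    (hf : Integrable (fun z : ℝ × Eucl N => f z.1 z.2) (volume.restrict (cylinder Ω T))) :
    ∫ t in (0 : ℝ)..τ, ∫ x in Ω, f t x = ∫ z in cylinder Ω τ, f z.1 z.2 := by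
  have hf' : IntegrableOn (fun z : ℝ × Eucl N => f z.1 z.2) (cylinder Ω τ) :=
    IntegrableOn.mono_set hf (cylinder_mono hτ)
  rw [intervalIntegral.integral_of_le h0, integral_Ioc_eq_integral_Ioo]
  exact (setIntegral_prod (fun z : ℝ × Eucl N => f z.1 z.2) hf').symm

theorem integrable_cylinder_of_slices {f : ℝ → Eucl N → ℝ} {C : ℝ}
    (hm : AEStronglyMeasurable (fun z : ℝ × Eucl N => f z.1 z.2)
      (volume.restrict (cylinder Ω T)))
    (h : ∀ᵐ t ∂(volume.restrict (Ioo 0 T)), IntegrableOn (f t) Ω ∧ ∫ x in Ω, ‖f t x‖ ≤ C) :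
    Integrable (fun z : ℝ × Eucl N => f z.1 z.2) (volume.restrict (cylinder Ω T)) := by
  rw [restrict_cylinder] at hm ⊢
  rw [integrable_prod_iff hm]
  refine ⟨h.mono fun t ht => ht.1, ?_⟩
  refine Integrable.mono' (g := fun _ => C) (integrable_const _) hm.norm.integral_prod_right' ?_
  filter_upwards [h] with t ht
  rw [Real.norm_of_nonneg (integral_nonneg fun _ => norm_nonneg _)]
  exact ht.2

theorem ae_cylinder_nonneg {f : ℝ → Eucl N → ℝ}
    (hm : AEStronglyMeasurable (fun z : ℝ × Eucl N => f z.1 z.2)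
      (volume.restrict (cylinder Ω T)))
    (h : ∀ᵐ t ∂(volume.restrict (Ioo 0 T)), ∀ᵐ x ∂(volume.restrict Ω), 0 ≤ f t x) :
    ∀ᵐ z ∂(volume.restrict (cylinder Ω T)), 0 ≤ f z.1 z.2 := by
  obtain ⟨g, hg, hfg⟩ := hm
  have hms : MeasurableSet {z : ℝ × Eucl N | 0 ≤ g z} :=
    measurableSet_le measurable_const hg.measurable
  have hg0 : ∀ᵐ z ∂(volume.restrict (cylinder Ω T)), 0 ≤ g z := by
    rw [restrict_cylinder] at hfg ⊢
    rw [Measure.ae_prod_iff_ae_ae hms]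
    filter_upwards [h, Measure.ae_ae_of_ae_prod hfg] with t hft hfgt
    filter_upwards [hft, hfgt] with x hfx hfgx
    exact hfx.trans_eq hfgx
  filter_upwards [hg0, hfg] with z hgz hfgz
  exact hgz.trans_eq hfgz.symm

theorem isFiniteMeasure_restrict_cylinder (hb : Bornology.IsBounded Ω) :
    IsFiniteMeasure ((volume : Measure (ℝ × Eucl N)).restrict (cylinder Ω T)) := by
  have : IsFiniteMeasure (volume.restrict Ω) :=
    isFiniteMeasure_restrict.2 hb.measure_lt_top.ne
  rw [restrict_cylinder]
  infer_instance

theorem integral_cylinder_nonneg {f : ℝ → Eucl N → ℝ} {τ : ℝ} (h0 : 0 ≤ τ) (hτ : τ ≤ T)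
    (hf : Integrable (fun z : ℝ × Eucl N => f z.1 z.2) (volume.restrict (cylinder Ω T)))
    (h : ∀ᵐ t ∂(volume.restrict (Ioo 0 T)), 0 ≤ ∫ x in Ω, f t x) :
    0 ≤ ∫ z in cylinder Ω τ, f z.1 z.2 := by
  rw [← intervalIntegral_eq_integral_cylinder h0 hτ hf, intervalIntegral.integral_of_le h0,
    integral_Ioc_eq_integral_Ioo]
  exact integral_nonneg_of_ae (ae_mono (Measure.restrict_mono (Ioo_subset_Ioo_right hτ) le_rfl) h)

theorem integral_cylinder_eq_zero {f : ℝ → Eucl N → ℝ} {τ : ℝ} (h0 : 0 ≤ τ)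
    (hτ : τ ≤ T)
    (hf : Integrable (fun z : ℝ × Eucl N => f z.1 z.2) (volume.restrict (cylinder Ω T)))
    (h : ∀ᵐ t ∂(volume.restrict (Ioo 0 T)), ∫ x in Ω, f t x = 0) :
    ∫ z in cylinder Ω τ, f z.1 z.2 = 0 := by
  rw [← intervalIntegral_eq_integral_cylinder h0 hτ hf, intervalIntegral.integral_of_le h0,
    integral_Ioc_eq_integral_Ioo]
  exact integral_eq_zero_of_ae (ae_mono (Measure.restrict_mono
    (Ioo_subset_Ioo_right hτ) le_rfl) h)

end CylinderIntegrals

section WeakSolutions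

variable {N : ℕ} {Ω : Set (Eucl N)} {T μ lam a γ : ℝ} {q : ℝ → ℝ}
  {ρ : ℝ → Eucl N → ℝ} {u : ℝ → Eucl N → Eucl N} {Du : ℝ → Eucl N → (Eucl N →L[ℝ] Eucl N)}

/-- A dissipative weak solution `[ρ, u]` whose weak velocity gradient `Du` is a parameter instead of
being hidden under an existential quantifier; only what the relative energy method needs is kept. -/
structure IsWeakSolutionWithGradient (Ω : Set (Eucl N)) (T μ lam a γ : ℝ) (q : ℝ → ℝ)
    (ρ : ℝ → Eucl N → ℝ) (u : ℝ → Eucl N → Eucl N)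
    (Du : ℝ → Eucl N → (Eucl N →L[ℝ] Eucl N)) : Prop where
  integrableOn_density : ∀ t ∈ Icc (0 : ℝ) T, IntegrableOn (ρ t) Ω
  integrableOn_momentum : ∀ t ∈ Icc (0 : ℝ) T, IntegrableOn (fun x => ρ t x • u t x) Ω
  ae_nonneg : ∀ t ∈ Icc (0 : ℝ) T, ∀ᵐ x ∂(volume.restrict Ω), 0 ≤ ρ t x
  aestronglyMeasurable_density : AEStronglyMeasurable (fun z : ℝ × Eucl N => ρ z.1 z.2)
    (volume.restrict (cylinder Ω T))
  velocity : MemL2W012 Ω T u Du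
  continuity : WeakContinuity Ω T ρ u
  momentum : WeakMomentum Ω T μ lam a γ q ρ u Du
  renormalized : RenormalizedContinuity Ω T ρ u Du
  energy : EnergyInequality Ω T μ lam a γ q ρ u Du

theorem IsDissipativeWeakSolution.exists_gradient
    (h : IsDissipativeWeakSolution Ω T μ lam a γ q ρ u) :
    ∃ Du, IsWeakSolutionWithGradient Ω T μ lam a γ q ρ u Du :=
  let ⟨hint, hnn, hρ, _, Du, hu, hC, hM, hR, hE⟩ := h
  ⟨Du, fun t ht => (hint t ht).1, fun t ht => (hint t ht).2, hnn, hρ.1, hu, hC, hM, hR, hE⟩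

namespace IsWeakSolutionWithGradient

theorem integral_density_eq (h : IsWeakSolutionWithGradient Ω T μ lam a γ q ρ u Du) {τ : ℝ}
    (hτ : τ ∈ Icc (0 : ℝ) T) : ∫ x in Ω, ρ τ x = ∫ x in Ω, ρ 0 x := by
  have hmass := h.continuity (fun _ _ => 1) contDiffOn_const τ hτ
  simp only [mul_one, deriv_const, mul_zero, fderiv_fun_const, Pi.zero_apply, zero_add,
    zero_apply, integral_zero, intervalIntegral.integral_zero] at hmass
  exact sub_eq_zero.1 hmass

theorem integrable_density (h : IsWeakSolutionWithGradient Ω T μ lam a γ q ρ u Du) :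
    Integrable (fun z : ℝ × Eucl N => ρ z.1 z.2) (volume.restrict (cylinder Ω T)) := by
  refine integrable_cylinder_of_slices (C := ∫ x in Ω, ρ 0 x) h.aestronglyMeasurable_density
    (ae_restrict_of_forall_mem measurableSet_Ioo fun t ht => ?_)
  have ht' := Ioo_subset_Icc_self ht
  refine ⟨h.integrableOn_density t ht', (h.integral_density_eq ht').symm ▸ le_of_eq ?_⟩
  refine integral_congr_ae ?_
  filter_upwards [h.ae_nonneg t ht'] with x hx using Real.norm_of_nonneg hx

theorem ae_nonneg_cylinder (h : IsWeakSolutionWithGradient Ω T μ lam a γ q ρ u Du) :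
    ∀ᵐ z ∂(volume.restrict (cylinder Ω T)), 0 ≤ ρ z.1 z.2 :=
  ae_cylinder_nonneg h.aestronglyMeasurable_density
    (ae_restrict_of_forall_mem measurableSet_Ioo fun t ht => h.ae_nonneg t (Ioo_subset_Icc_self ht))

theorem integrableOn_testPotential (h : IsWeakSolutionWithGradient Ω T μ lam a γ q ρ u Du)
    (hb : Bornology.IsBounded Ω) (hq : IsTestOnPos q) {t : ℝ} (ht : t ∈ Icc (0 : ℝ) T) :
    IntegrableOn (fun x => testPotential q (ρ t x)) Ω := by
  have : IsFiniteMeasure (volume.restrict Ω) :=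
    isFiniteMeasure_restrict.2 hb.measure_lt_top.ne
  obtain ⟨K, hK⟩ := hq.exists_bound_testPotential
  refine Integrable.mono' (integrable_const K)
    (hq.contDiff_testPotential.continuous.comp_aestronglyMeasurable
      (h.integrableOn_density t ht).1) ?_
  filter_upwards [h.ae_nonneg t ht] with x hx using hK _ hx

theorem integrableOn_perturbationPotential
    (h : IsWeakSolutionWithGradient Ω T μ lam a γ q ρ u Du)
    (hb : Bornology.IsBounded Ω) (hq : IsTestOnPos q) {t : ℝ} (ht : t ∈ Icc (0 : ℝ) T) :
    IntegrableOn (fun x => perturbationPotential q (ρ t x)) Ω := by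
  simp only [hq.perturbationPotential_eq]
  exact ((h.integrableOn_density t ht).const_mul _).add (h.integrableOn_testPotential hb hq ht)

theorem integral_testPotential_sub (h : IsWeakSolutionWithGradient Ω T μ lam a γ q ρ u Du)
    (hq : IsTestOnPos q) {τ : ℝ} (hτ : τ ∈ Icc (0 : ℝ) T) :
    (∫ x in Ω, testPotential q (ρ τ x)) - (∫ x in Ω, testPotential q (ρ 0 x)) =
      -∫ t in (0 : ℝ)..τ, ∫ x in Ω, q (ρ t x) * tr (Du t x) := by
  have hderiv (s : ℝ) (hs : 0 ≤ s) :
      derivWithin (testPotential q) (Ici 0) s = deriv (testPotential q) s :=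
    (hq.contDiff_testPotential.differentiable one_ne_zero s).derivWithin
      (uniqueDiffOn_Ici 0 s hs)
  obtain ⟨R, hR⟩ := hq.exists_deriv_testPotential_eq_zero
  have hbal := h.renormalized (testPotential q) hq.contDiff_testPotential.contDiffOn
    ⟨max R 0, fun s hs => (hderiv s ((le_max_right _ _).trans hs)).trans
      (hR s ((le_max_left _ _).trans hs))⟩ (fun _ _ => 1) contDiffOn_const τ hτ
  simp only [mul_one, deriv_const, mul_zero, fderiv_fun_const, Pi.zero_apply, zero_add,
    zero_apply] at hbal
  rw [hbal, ← intervalIntegral.integral_neg]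
  refine intervalIntegral.integral_congr fun t ht => ?_
  rw [uIcc_of_le hτ.1] at ht
  rw [← integral_neg]
  refine integral_congr_ae ?_
  filter_upwards [h.ae_nonneg t ⟨ht.1, ht.2.trans hτ.2⟩] with x hx
  rw [hderiv _ hx, hq.testPotential_sub_deriv_mul, neg_mul]

theorem integral_perturbationPotential_sub
    (h : IsWeakSolutionWithGradient Ω T μ lam a γ q ρ u Du)
    (hb : Bornology.IsBounded Ω) (hq : IsTestOnPos q) {τ : ℝ} (hτ : τ ∈ Icc (0 : ℝ) T) :
    (∫ x in Ω, perturbationPotential q (ρ τ x)) - (∫ x in Ω, perturbationPotential q (ρ 0 x)) =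
      -∫ t in (0 : ℝ)..τ, ∫ x in Ω, q (ρ t x) * tr (Du t x) := by
  have hsplit {t : ℝ} (ht : t ∈ Icc (0 : ℝ) T) : ∫ x in Ω, perturbationPotential q (ρ t x) =
      (∫ z in Ioi 1, q z / z ^ 2) * (∫ x in Ω, ρ t x) + ∫ x in Ω, testPotential q (ρ t x) := by
    simp only [hq.perturbationPotential_eq]
    rw [integral_add ((h.integrableOn_density t ht).const_mul _)
      (h.integrableOn_testPotential hb hq ht), integral_const_mul]
  rw [hsplit hτ, hsplit ⟨le_rfl, hτ.1.trans hτ.2⟩, h.integral_density_eq hτ,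
    ← h.integral_testPotential_sub hq hτ]
  ring

theorem integrable_dissipation (h : IsWeakSolutionWithGradient Ω T μ lam a γ q ρ u Du) :
    Integrable (fun z : ℝ × Eucl N => frob (stress μ lam (Du z.1 z.2)) (Du z.1 z.2))
      (volume.restrict (cylinder Ω T)) :=
  integrable_bilin_of_memLp_two ((frobL N).comp (stressL N μ lam)) h.velocity.2.1 h.velocity.2.1

theorem exists_bound_integral_energyDensity
    (h : IsWeakSolutionWithGradient Ω T μ lam a γ q ρ u Du) :
    ∃ C, ∀ᵐ t ∂(volume.restrict (Ioo 0 T)), ∫ x in Ω, energyDensity a γ q (ρ t x) (u t x) ≤ C := by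
  refine ⟨(∫ x in Ω, energyDensity a γ q (ρ 0 x) (u 0 x)) +
    ∫ z in cylinder Ω T, ‖frob (stress μ lam (Du z.1 z.2)) (Du z.1 z.2)‖, ?_⟩
  filter_upwards [h.energy.2, ae_restrict_mem measurableSet_Ioo] with t ht htT
  have hdiss : -(∫ z in cylinder Ω T, ‖frob (stress μ lam (Du z.1 z.2)) (Du z.1 z.2)‖) ≤
      ∫ s in (0 : ℝ)..t, ∫ x in Ω, frob (stress μ lam (Du s x)) (Du s x) := by
    rw [intervalIntegral_eq_integral_cylinder htT.1.le htT.2.le h.integrable_dissipation]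
    refine (abs_le.1 (abs_integral_le_integral_abs.trans ?_)).1
    exact setIntegral_mono_set h.integrable_dissipation.norm (ae_of_all _ fun z => abs_nonneg _)
      (LE.le.eventuallyLE (cylinder_mono htT.2.le))
  linarith [ht.2]

theorem integrable_kinetic_add_potential (h : IsWeakSolutionWithGradient Ω T μ lam a γ q ρ u Du)
    (hb : Bornology.IsBounded Ω) (ha : 0 ≤ a) (hγ : 1 < γ) (hq : IsTestOnPos q) :
    Integrable (fun z : ℝ × Eucl N =>
      1 / 2 * ρ z.1 z.2 * ‖u z.1 z.2‖ ^ 2 + potential a γ (ρ z.1 z.2))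
      (volume.restrict (cylinder Ω T)) := by
  have : IsFiniteMeasure (volume.restrict Ω) :=
    isFiniteMeasure_restrict.2 hb.measure_lt_top.ne
  obtain ⟨C, hC⟩ := h.exists_bound_integral_energyDensity
  obtain ⟨K, hK⟩ := hq.exists_bound_perturbationPotential
  have hm := h.aestronglyMeasurable_density
  refine integrable_cylinder_of_slices
    (f := fun t x => 1 / 2 * ρ t x * ‖u t x‖ ^ 2 + potential a γ (ρ t x))
    (C := C + K * (volume.real Ω + ∫ x in Ω, ρ 0 x))
    (((hm.const_mul _).mul (h.velocity.1.1.norm.pow 2)).add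
      ((hm.aemeasurable.pow_const γ).const_mul _).aestronglyMeasurable) ?_
  filter_upwards [hC, h.energy.2, ae_restrict_mem measurableSet_Ioo] with t htC htE htT
  have ht := Ioo_subset_Icc_self htT
  have hsplit (x : Eucl N) : 1 / 2 * ρ t x * ‖u t x‖ ^ 2 + potential a γ (ρ t x) =
      energyDensity a γ q (ρ t x) (u t x) - perturbationPotential q (ρ t x) := by
    rw [energyDensity, pressurePotential_eq_add]
    ring
  have hpert := h.integrableOn_perturbationPotential hb hq ht
  have hbound : IntegrableOn (fun x => K * (1 + ρ t x)) Ω :=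
    ((integrable_const 1).add (h.integrableOn_density t ht)).const_mul K
  refine ⟨by simpa only [hsplit] using! htE.1.sub hpert, ?_⟩
  calc ∫ x in Ω, ‖1 / 2 * ρ t x * ‖u t x‖ ^ 2 + potential a γ (ρ t x)‖
      = ∫ x in Ω, (energyDensity a γ q (ρ t x) (u t x) - perturbationPotential q (ρ t x)) := by
        refine integral_congr_ae ?_
        filter_upwards [h.ae_nonneg t ht] with x hx
        have : 0 ≤ potential a γ (ρ t x) :=
          mul_nonneg (div_nonneg ha (by linarith)) (Real.rpow_nonneg hx γ)
        rw [Real.norm_of_nonneg (by positivity), hsplit]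
    _ ≤ ∫ x in Ω, (energyDensity a γ q (ρ t x) (u t x) + K * (1 + ρ t x)) := by
        refine integral_mono_ae (htE.1.sub hpert) (htE.1.add hbound) ?_
        filter_upwards [h.ae_nonneg t ht] with x hx
        linarith [neg_le_of_abs_le (hK _ hx)]
    _ = (∫ x in Ω, energyDensity a γ q (ρ t x) (u t x)) +
          K * (volume.real Ω + ∫ x in Ω, ρ 0 x) := by
        rw [integral_add htE.1 hbound, integral_const_mul,
          integral_add (integrable_const 1) (h.integrableOn_density t ht),
          h.integral_density_eq ht, integral_const, smul_eq_mul, mul_one,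
          measureReal_restrict_apply_univ]
    _ ≤ C + K * (volume.real Ω + ∫ x in Ω, ρ 0 x) := by gcongr

theorem integrable_kinetic (h : IsWeakSolutionWithGradient Ω T μ lam a γ q ρ u Du)
    (hb : Bornology.IsBounded Ω) (ha : 0 ≤ a) (hγ : 1 < γ) (hq : IsTestOnPos q) :
    Integrable (fun z : ℝ × Eucl N => ρ z.1 z.2 * ‖u z.1 z.2‖ ^ 2)
      (volume.restrict (cylinder Ω T)) := by
  refine ((h.integrable_kinetic_add_potential hb ha hγ hq).const_mul 2).mono'
    (h.aestronglyMeasurable_density.mul (h.velocity.1.1.norm.pow 2)) ?_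
  filter_upwards [h.ae_nonneg_cylinder] with z hz
  have : 0 ≤ potential a γ (ρ z.1 z.2) :=
    mul_nonneg (div_nonneg ha (by linarith)) (Real.rpow_nonneg hz γ)
  rw [Real.norm_of_nonneg (by positivity)]
  linarith

theorem integrable_potential (h : IsWeakSolutionWithGradient Ω T μ lam a γ q ρ u Du)
    (hb : Bornology.IsBounded Ω) (ha : 0 ≤ a) (hγ : 1 < γ) (hq : IsTestOnPos q) :
    Integrable (fun z : ℝ × Eucl N => potential a γ (ρ z.1 z.2))
      (volume.restrict (cylinder Ω T)) := by
  refine ((h.integrable_kinetic_add_potential hb ha hγ hq).sub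
    ((h.integrable_kinetic hb ha hγ hq).const_mul (1 / 2))).congr (ae_of_all _ fun z => ?_)
  simp only [Pi.sub_apply]
  ring

theorem integrable_momentum (h : IsWeakSolutionWithGradient Ω T μ lam a γ q ρ u Du)
    (hb : Bornology.IsBounded Ω) (ha : 0 ≤ a) (hγ : 1 < γ) (hq : IsTestOnPos q) :
    Integrable (fun z : ℝ × Eucl N => ρ z.1 z.2 • u z.1 z.2) (volume.restrict (cylinder Ω T)) := by
  refine Integrable.mono' (h.integrable_density.add (h.integrable_kinetic hb ha hγ hq))
    (h.aestronglyMeasurable_density.smul h.velocity.1.1) ?_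
  filter_upwards [h.ae_nonneg_cylinder] with z hz
  rw [norm_smul, Real.norm_of_nonneg hz, Pi.add_apply]
  nlinarith [mul_nonneg hz (sq_nonneg (‖u z.1 z.2‖ - 1)), mul_nonneg hz (sq_nonneg ‖u z.1 z.2‖)]

end IsWeakSolutionWithGradient

end WeakSolutions

section TestedBalances

variable {N : ℕ} {Ω : Set (Eucl N)} {T μ lam a γ : ℝ} {q : ℝ → ℝ}
  {ρ : ℝ → Eucl N → ℝ} {u : ℝ → Eucl N → Eucl N} {Du : ℝ → Eucl N → (Eucl N →L[ℝ] Eucl N)}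
  {φ : ℝ → Eucl N → ℝ} {ψ : ℝ → Eucl N → Eucl N}

/-- The integrand on the right-hand side of `WeakContinuity`. -/
def massFlux (ρ : ℝ → Eucl N → ℝ) (u : ℝ → Eucl N → Eucl N) (φ : ℝ → Eucl N → ℝ) (t : ℝ)
    (x : Eucl N) : ℝ :=
  ρ t x * deriv (fun s => φ s x) t + ρ t x * fderiv ℝ (φ t) x (u t x)

/-- The non-viscous part of the integrand on the right-hand side of `WeakMomentum`. -/
def momentumFlux (a γ : ℝ) (q : ℝ → ℝ) (ρ : ℝ → Eucl N → ℝ) (u : ℝ → Eucl N → Eucl N)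
    (ψ : ℝ → Eucl N → Eucl N) (t : ℝ) (x : Eucl N) : ℝ :=
  (inner ℝ (ρ t x • u t x) (deriv (fun s => ψ s x) t) : ℝ)
    + frob (tensor (ρ t x • u t x) (u t x)) (fderiv ℝ (ψ t) x)
    + pressure a γ q (ρ t x) * tr (fderiv ℝ (ψ t) x)

theorem integrable_bilin_of_memLp_top {α V W : Type*} [MeasurableSpace α] {ν : Measure α}
    [NormedAddCommGroup V] [NormedSpace ℝ V] [NormedAddCommGroup W] [NormedSpace ℝ W]
    (b : V →L[ℝ] W →L[ℝ] ℝ) {f : α → V} {g : α → W} (hf : Integrable f ν) (hg : MemLp g ⊤ ν) :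
    Integrable (fun x => b (f x) (g x)) ν :=
  memLp_one_iff_integrable.1 (b.memLp_of_bilin 1 (memLp_one_iff_integrable.2 hf) hg)

theorem IsC1.memLp_slice {F : Type*} [NormedAddCommGroup F] [NormedSpace ℝ F]
    [SecondCountableTopologyEither (Eucl N) F] {f : ℝ → Eucl N → F} (hf : IsC1 Ω T f)
    (hΩ : IsOpen Ω) (hb : Bornology.IsBounded Ω) {t : ℝ} (ht : t ∈ Icc 0 T) (p : ℝ≥0∞) :
    MemLp (f t) p (volume.restrict Ω) :=
  let ⟨_, hC⟩ := hf.exists_bound hb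
  memLp_of_continuousOn_of_bound hΩ hb ((hf.continuousOn_slice ht).mono subset_closure)
    fun x hx => hC t ht x (subset_closure hx)

theorem IsTestOnPos.memLp_top_comp {α : Type*} [MeasurableSpace α] {ν : Measure α} {f : α → ℝ}
    (hq : IsTestOnPos q) (hf : AEStronglyMeasurable f ν) : MemLp (fun x => q (f x)) ⊤ ν :=
  let ⟨K, hK⟩ := hq.1.continuous.bounded_above_of_compact_support hq.2.1
  memLp_top_of_bound (hq.1.continuous.comp_aestronglyMeasurable hf) K (ae_of_all _ fun _ => hK _)

namespace IsWeakSolutionWithGradient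

theorem integrable_tensor_momentum (h : IsWeakSolutionWithGradient Ω T μ lam a γ q ρ u Du)
    (hb : Bornology.IsBounded Ω) (ha : 0 ≤ a) (hγ : 1 < γ) (hq : IsTestOnPos q) :
    Integrable (fun z : ℝ × Eucl N => tensor (ρ z.1 z.2 • u z.1 z.2) (u z.1 z.2))
      (volume.restrict (cylinder Ω T)) := by
  have hu := h.velocity.1.1
  refine (h.integrable_kinetic hb ha hγ hq).mono
    ((tensorL N).aestronglyMeasurable_comp₂ (h.aestronglyMeasurable_density.smul hu) hu)
    (ae_of_all _ fun z => le_of_eq ?_)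
  rw [tensor, ContinuousLinearMap.norm_smulRight_apply, innerSL_apply_norm, norm_smul, norm_mul,
    norm_pow, norm_norm]
  ring

theorem integrable_pressure (h : IsWeakSolutionWithGradient Ω T μ lam a γ q ρ u Du)
    (hb : Bornology.IsBounded Ω) (ha : 0 ≤ a) (hγ : 1 < γ) (hq : IsTestOnPos q) :
    Integrable (fun z : ℝ × Eucl N => pressure a γ q (ρ z.1 z.2))
      (volume.restrict (cylinder Ω T)) := by
  have := isFiniteMeasure_restrict_cylinder (T := T) hb
  simp only [pressure, ← sub_one_mul_potential hγ]
  exact ((h.integrable_potential hb ha hγ hq).const_mul _).add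
    ((hq.memLp_top_comp h.aestronglyMeasurable_density).integrable le_top)

theorem integrable_perturbation_mul_tr (h : IsWeakSolutionWithGradient Ω T μ lam a γ q ρ u Du)
    (hb : Bornology.IsBounded Ω) (hq : IsTestOnPos q) :
    Integrable (fun z : ℝ × Eucl N => q (ρ z.1 z.2) * tr (Du z.1 z.2))
      (volume.restrict (cylinder Ω T)) := by
  have := isFiniteMeasure_restrict_cylinder (T := T) hb
  exact integrable_bilin_of_memLp_two (ContinuousLinearMap.mul ℝ ℝ)
    ((hq.memLp_top_comp h.aestronglyMeasurable_density).mono_exponent le_top)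
    ((trL N).comp_memLp' h.velocity.2.1)

theorem integrable_massFlux (h : IsWeakSolutionWithGradient Ω T μ lam a γ q ρ u Du)
    (hΩ : IsOpen Ω) (hb : Bornology.IsBounded Ω) (ha : 0 ≤ a) (hγ : 1 < γ) (hq : IsTestOnPos q)
    (hφ : IsC1 Ω T φ) :
    Integrable (fun z : ℝ × Eucl N => massFlux ρ u φ z.1 z.2) (volume.restrict (cylinder Ω T)) := by
  refine ((integrable_bilin_of_memLp_top (ContinuousLinearMap.mul ℝ ℝ) h.integrable_density
    (hφ.memLp_top_deriv_time hΩ hb)).add (integrable_bilin_of_memLp_top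
      (ContinuousLinearMap.id ℝ (Eucl N →L[ℝ] ℝ)).flip (h.integrable_momentum hb ha hγ hq)
      (hφ.memLp_top_fderiv_slice hΩ hb))).congr (ae_of_all _ fun z => ?_)
  simp [massFlux]

theorem integrable_momentumFlux (h : IsWeakSolutionWithGradient Ω T μ lam a γ q ρ u Du)
    (hΩ : IsOpen Ω) (hb : Bornology.IsBounded Ω) (ha : 0 ≤ a) (hγ : 1 < γ) (hq : IsTestOnPos q)
    (hψ : IsC1 Ω T ψ) :
    Integrable (fun z : ℝ × Eucl N => momentumFlux a γ q ρ u ψ z.1 z.2)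
      (volume.restrict (cylinder Ω T)) :=
  ((integrable_bilin_of_memLp_top (innerSL ℝ) (h.integrable_momentum hb ha hγ hq)
    (hψ.memLp_top_deriv_time hΩ hb)).add (integrable_bilin_of_memLp_top (frobL N)
      (h.integrable_tensor_momentum hb ha hγ hq) (hψ.memLp_top_fderiv_slice hΩ hb))).add
    (integrable_bilin_of_memLp_top (ContinuousLinearMap.mul ℝ ℝ) (h.integrable_pressure hb ha hγ hq)
      ((trL N).comp_memLp' (hψ.memLp_top_fderiv_slice hΩ hb)))

theorem integrable_stress_pairing (h : IsWeakSolutionWithGradient Ω T μ lam a γ q ρ u Du)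
    (hΩ : IsOpen Ω) (hb : Bornology.IsBounded Ω) (hψ : IsC1 Ω T ψ) :
    Integrable (fun z : ℝ × Eucl N => frob (stress μ lam (Du z.1 z.2)) (fderiv ℝ (ψ z.1) z.2))
      (volume.restrict (cylinder Ω T)) := by
  have := isFiniteMeasure_restrict_cylinder (T := T) hb
  exact integrable_bilin_of_memLp_two ((frobL N).comp (stressL N μ lam)) h.velocity.2.1
    ((hψ.memLp_top_fderiv_slice hΩ hb).mono_exponent le_top)

theorem integral_density_mul_sub (h : IsWeakSolutionWithGradient Ω T μ lam a γ q ρ u Du)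
    (hΩ : IsOpen Ω) (hb : Bornology.IsBounded Ω) (ha : 0 ≤ a) (hγ : 1 < γ) (hq : IsTestOnPos q)
    (hφ : IsC1 Ω T φ) {τ : ℝ} (hτ : τ ∈ Icc 0 T) :
    (∫ x in Ω, ρ τ x * φ τ x) - (∫ x in Ω, ρ 0 x * φ 0 x) =
      ∫ z in cylinder Ω τ, massFlux ρ u φ z.1 z.2 :=
  (h.continuity φ hφ τ hτ).trans (intervalIntegral_eq_integral_cylinder hτ.1 hτ.2
    (h.integrable_massFlux hΩ hb ha hγ hq hφ))

theorem integral_inner_momentum_sub (h : IsWeakSolutionWithGradient Ω T μ lam a γ q ρ u Du)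
    (hΩ : IsOpen Ω) (hb : Bornology.IsBounded Ω) (ha : 0 ≤ a) (hγ : 1 < γ) (hq : IsTestOnPos q)
    (hψ : IsC1 Ω T ψ) (hψ0 : VanishesOnBoundary Ω T ψ) {τ : ℝ} (hτ : τ ∈ Icc 0 T) :
    (∫ x in Ω, (inner ℝ (ρ τ x • u τ x) (ψ τ x) : ℝ))
        - (∫ x in Ω, (inner ℝ (ρ 0 x • u 0 x) (ψ 0 x) : ℝ)) =
      (∫ z in cylinder Ω τ, momentumFlux a γ q ρ u ψ z.1 z.2)
        - ∫ z in cylinder Ω τ, frob (stress μ lam (Du z.1 z.2)) (fderiv ℝ (ψ z.1) z.2) := by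
  rw [h.momentum ψ hψ hψ0 τ hτ]
  exact congrArg₂ (· - ·)
    (intervalIntegral_eq_integral_cylinder hτ.1 hτ.2 (h.integrable_momentumFlux hΩ hb ha hγ hq hψ))
    (intervalIntegral_eq_integral_cylinder hτ.1 hτ.2 (h.integrable_stress_pairing hΩ hb hψ))

end IsWeakSolutionWithGradient

end TestedBalances

section ClassicalSolutions

variable {N : ℕ} {Ω : Set (Eucl N)} {T μ lam a γ : ℝ} {q : ℝ → ℝ}
  {r : ℝ → Eucl N → ℝ} {U : ℝ → Eucl N → Eucl N} {t : ℝ} {x : Eucl N}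

theorem IsC1.comp_contDiffOn {f : ℝ → ℝ} {s : Set ℝ} (hr : IsC1 Ω T r) (hf : ContDiffOn ℝ 1 f s)
    (hs : ∀ t ∈ Icc (0 : ℝ) T, ∀ x ∈ closure Ω, r t x ∈ s) : IsC1 Ω T (fun t x => f (r t x)) :=
  ContDiffOn.comp (g := f) (f := fun z : ℝ × Eucl N => r z.1 z.2) hf hr
    fun z hz => hs z.1 hz.1 z.2 hz.2

theorem IsC1.mul_rpow (hr : IsC1 Ω T r) (hγ : 1 < γ) : IsC1 Ω T (fun t x => a * r t x ^ γ) :=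
  hr.comp_contDiffOn (f := fun s => a * s ^ γ) (s := univ)
    (contDiff_const.mul (Real.contDiff_rpow_const_of_le (by exact_mod_cast hγ.le))).contDiffOn
    fun _ _ _ _ => mem_univ _

theorem IsC1.comp_isTestOnPos (hr : IsC1 Ω T r) (hq : IsTestOnPos q) :
    IsC1 Ω T (fun t x => q (r t x)) :=
  hr.comp_contDiffOn (contDiff_infty.1 hq.1 1).contDiffOn fun _ _ _ _ => mem_univ _

theorem IsC1.pressure (hr : IsC1 Ω T r) (hγ : 1 < γ) (hq : IsTestOnPos q) :
    IsC1 Ω T (fun t x => pressure a γ q (r t x)) :=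
  (hr.mul_rpow hγ).add (hr.comp_isTestOnPos hq)

theorem IsC1.enthalpy (hr : IsC1 Ω T r)
    (hpos : ∀ t ∈ Icc (0 : ℝ) T, ∀ x ∈ closure Ω, 0 < r t x) :
    IsC1 Ω T (fun t x => enthalpy a γ (r t x)) :=
  hr.comp_contDiffOn
    (contDiffOn_const.mul (contDiffOn_id.rpow_const_of_ne fun _ hs => (mem_Ioi.1 hs).ne')) hpos

theorem IsC1.integral_div (hr : IsC1 Ω T r) (hΩ : IsOpen Ω) (hb : Bornology.IsBounded Ω)
    (ht : t ∈ Ioo 0 T) {v : Eucl N → Eucl N} {G : Eucl N → (Eucl N →L[ℝ] Eucl N)}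
    (h : MemH10 Ω v G) : ∫ x in Ω, (fderiv ℝ (r t) x (v x) + r t x * tr (G x)) = 0 := by
  obtain ⟨C, hC⟩ := hr.exists_bound hb
  obtain ⟨C', hC'⟩ := hr.exists_bound_fderiv_slice hΩ hb
  have ht' := Ioo_subset_Icc_self ht
  exact h.integral_div hΩ hb ((hr.contDiffOn_slice ht').mono subset_closure)
    (fun x hx => hC t ht' x (subset_closure hx)) (hC' t ht)

theorem IsC1.integral_sub_integral_eq (hr : IsC1 Ω T r) (hΩ : IsOpen Ω)
    (hb : Bornology.IsBounded Ω) {τ : ℝ} (hτ : τ ∈ Icc 0 T) :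
    (∫ x in Ω, r τ x) - (∫ x in Ω, r 0 x) =
      ∫ z in cylinder Ω τ, deriv (fun s => r s z.2) z.1 := by
  have := isFiniteMeasure_restrict_cylinder (T := T) hb
  have : IsFiniteMeasure (volume.restrict Ω) := isFiniteMeasure_restrict.2 hb.measure_lt_top.ne
  have hint : IntegrableOn (fun z : ℝ × Eucl N => deriv (fun s => r s z.2) z.1) (cylinder Ω τ) :=
    IntegrableOn.mono_set ((hr.memLp_top_deriv_time hΩ hb).integrable le_top) (cylinder_mono hτ.2)
  have hslice (t : ℝ) (ht : t ∈ Icc 0 T) : IntegrableOn (r t) Ω :=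
    (hr.memLp_slice hΩ hb ht 1).integrable le_rfl
  rw [← integral_sub (hslice τ hτ) (hslice 0 ⟨le_rfl, hτ.1.trans hτ.2⟩)]
  rw [IntegrableOn, restrict_cylinder] at hint
  rw [restrict_cylinder, integral_prod_symm _ hint]
  refine integral_congr_ae ?_
  filter_upwards [hint.prod_left_ae, ae_restrict_mem hΩ.measurableSet] with x hx hxΩ
  rw [← integral_Ioc_eq_integral_Ioo, ← intervalIntegral.integral_of_le hτ.1]
  refine (intervalIntegral.integral_eq_sub_of_hasDerivAt_of_le hτ.1
    ((hr.continuousOn_time (subset_closure hxΩ)).mono (Icc_subset_Icc_right hτ.2))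
    (fun t ht => hr.hasDerivAt_time hΩ ⟨ht.1, ht.2.trans_le hτ.2⟩ hxΩ) ?_).symm
  rw [intervalIntegrable_iff_integrableOn_Ioo_of_le hτ.1]
  exact hx

/-- The material derivative `∂ₜU + ∇U U` of a velocity field along itself. -/
def materialDeriv (U : ℝ → Eucl N → Eucl N) (t : ℝ) (x : Eucl N) : Eucl N :=
  deriv (fun s => U s x) t + fderiv ℝ (U t) x (U t x)

theorem IsC1.exists_bound_materialDeriv (hU : IsC1 Ω T U) (hΩ : IsOpen Ω)
    (hb : Bornology.IsBounded Ω) : ∃ C : ℝ, ∀ t ∈ Ioo 0 T, ∀ x ∈ Ω, ‖materialDeriv U t x‖ ≤ C := by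
  obtain ⟨C, hC⟩ := hU.exists_bound hb
  obtain ⟨Ct, hCt⟩ := hU.exists_bound_deriv_time hΩ hb
  obtain ⟨Cx, hCx⟩ := hU.exists_bound_fderiv_slice hΩ hb
  exact ⟨Ct + Cx * C, fun t ht x hx => norm_add_le_of_le (hCt t ht x hx)
    (ContinuousLinearMap.le_of_opNorm_le_of_le _ (hCx t ht x hx)
      (hC t (Ioo_subset_Icc_self ht) x (subset_closure hx)))⟩

theorem IsC1.memLp_top_materialDeriv (hU : IsC1 Ω T U) (hΩ : IsOpen Ω)
    (hb : Bornology.IsBounded Ω) :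
    MemLp (fun z : ℝ × Eucl N => materialDeriv U z.1 z.2) ⊤ (volume.restrict (cylinder Ω T)) :=
  let ⟨_, hC⟩ := hU.exists_bound_materialDeriv hΩ hb
  memLp_top_of_continuousOn_cylinder hΩ ((hU.continuousOn_deriv_time hΩ).add
    ((hU.continuousOn_fderiv_slice hΩ).clm_apply
      (hU.continuousOn.mono cylinder_subset_Icc_prod_closure))) hC

theorem tensorDiv_sub {M M' : Eucl N → (Eucl N →L[ℝ] Eucl N)} (hM : DifferentiableAt ℝ M x)
    (hM' : DifferentiableAt ℝ M' x) :
    tensorDiv (fun y => M y - M' y) x = tensorDiv M x - tensorDiv M' x := by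
  simp only [tensorDiv, fderiv_fun_sub hM hM', sub_apply, Finset.sum_sub_distrib]

theorem tensorDiv_tensor {V W : Eucl N → Eucl N} (hV : DifferentiableAt ℝ V x)
    (hW : DifferentiableAt ℝ W x) :
    tensorDiv (fun y => tensor (V y) (W y)) x =
      fderiv ℝ V x (W x) + tr (fderiv ℝ W x) • V x := by
  have hd : HasFDerivAt (fun y => tensor (V y) (W y)) _ x :=
    (tensorL N).hasFDerivAt_of_bilinear hV.hasFDerivAt hW.hasFDerivAt
  rw [tensorDiv, hd.fderiv, ← sum_smul_map_stdVec (fderiv ℝ V x) (W x), tr, Finset.sum_smul,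
    ← Finset.sum_add_distrib]
  refine Finset.sum_congr rfl fun j _ => ?_
  simp [tensorL_apply, tensor, inner_stdVec_right, add_comm]

theorem gradient_eq_sum (f : Eucl N → ℝ) :
    gradient f x = ∑ j, fderiv ℝ f x (stdVec j) • stdVec j := by
  simp_rw [← inner_gradient_left, inner_stdVec_right, sum_smul_stdVec]

theorem fderiv_mul_rpow {E : Type*} [NormedAddCommGroup E] [NormedSpace ℝ E] {f : E → ℝ} {y : E}
    (hγ : 1 < γ) (hf : DifferentiableAt ℝ f y) (hpos : 0 < f y) :
    fderiv ℝ (fun y => a * f y ^ γ) y = f y • fderiv ℝ (fun y => enthalpy a γ (f y)) y := by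
  have hP : HasFDerivAt (fun y => a * f y ^ γ) _ y :=
    (hasDerivAt_rpow_pressure hpos).comp_hasFDerivAt y hf.hasFDerivAt
  have hH : HasFDerivAt (fun y => enthalpy a γ (f y)) _ y :=
    (hasDerivAt_enthalpy hγ hpos).comp_hasFDerivAt y hf.hasFDerivAt
  rw [hP.fderiv, hH.fderiv, smul_smul]

theorem deriv_mul_rpow {f : ℝ → ℝ} (hγ : 1 < γ) (hf : DifferentiableAt ℝ f t) (hpos : 0 < f t) :
    deriv (fun s => a * f s ^ γ) t = f t * deriv (fun s => enthalpy a γ (f s)) t := by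
  rw [← fderiv_apply_one_eq_deriv, fderiv_mul_rpow hγ hf hpos, smul_apply,
    fderiv_apply_one_eq_deriv, smul_eq_mul]

/-- The total stress `S(∇U) - p(r) I` of a flow with density `r` and velocity `U`. -/
def cauchyStress (μ lam a γ : ℝ) (q : ℝ → ℝ) (r : ℝ → Eucl N → ℝ) (U : ℝ → Eucl N → Eucl N)
    (t : ℝ) (x : Eucl N) : Eucl N →L[ℝ] Eucl N :=
  stress μ lam (fderiv ℝ (U t) x) - pressure a γ q (r t x) • ContinuousLinearMap.id ℝ (Eucl N)

namespace IsClassicalSolution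

theorem deriv_density (hc : IsClassicalSolution Ω T μ lam a γ q r U) (hΩ : IsOpen Ω)
    (ht : t ∈ Ioo 0 T) (hx : x ∈ Ω) :
    deriv (fun s => r s x) t = -(r t x * tr (fderiv ℝ (U t) x)) - fderiv ℝ (r t) x (U t x) := by
  have h := hc.continuity_eq t ht x hx
  rw [tr_fderiv_smul (hc.density_C1.hasFDerivAt_slice hΩ ht hx).differentiableAt
    (hc.velocity_C1.hasFDerivAt_slice hΩ ht hx).differentiableAt] at h
  linarith

theorem density_pos (hc : IsClassicalSolution Ω T μ lam a γ q r U) (hΩ : IsOpen Ω)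
    (hb : Bornology.IsBounded Ω) (hne : Ω.Nonempty) (hT : 0 < T)
    (hpos : ∀ x ∈ closure Ω, 0 < r 0 x) (ht : t ∈ Icc 0 T) (hx : x ∈ closure Ω) : 0 < r t x :=
  let ⟨_, hδ, hle⟩ := exists_pos_le_of_transport_eq hΩ hb hne hT hc.density_C1 hc.velocity_C1
    hc.no_slip hc.density_nonneg (fun _ ht _ hx => hc.deriv_density hΩ ht hx) hpos
  hδ.trans_le (hle t ht x hx)

theorem memH10_velocity (hc : IsClassicalSolution Ω T μ lam a γ q r U) (hΩ : IsOpen Ω)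
    (hb : Bornology.IsBounded Ω) (ht : t ∈ Ioo 0 T) : MemH10 Ω (U t) (fderiv ℝ (U t)) :=
  let ⟨_, hC⟩ := hc.velocity_C1.exists_bound_fderiv_slice hΩ hb
  memH10_of_vanishing hΩ hb (hc.velocity_C2 t ht)
    (hc.velocity_C1.continuousOn_slice (Ioo_subset_Icc_self ht))
    (hc.no_slip t (Ioo_subset_Icc_self ht)) (hC t ht)

theorem deriv_enthalpy (hc : IsClassicalSolution Ω T μ lam a γ q r U) (hΩ : IsOpen Ω) (hγ : 1 < γ)
    (ht : t ∈ Ioo 0 T) (hx : x ∈ Ω) (hpos : 0 < r t x) :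
    deriv (fun s => enthalpy a γ (r s x)) t =
      -((γ - 1) * enthalpy a γ (r t x) * tr (fderiv ℝ (U t) x))
        - fderiv ℝ (fun y => enthalpy a γ (r t y)) x (U t x) := by
  have htime : HasDerivAt (fun s => enthalpy a γ (r s x)) _ t :=
    HasDerivAt.comp (h₂ := enthalpy a γ) t (hasDerivAt_enthalpy hγ hpos)
      (hc.density_C1.hasDerivAt_time hΩ ht hx)
  have hspace : HasFDerivAt (fun y => enthalpy a γ (r t y)) _ x :=
    (hasDerivAt_enthalpy hγ hpos).comp_hasFDerivAt x (hc.density_C1.hasFDerivAt_slice hΩ ht hx)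
  rw [htime.deriv, hspace.fderiv, hc.deriv_density hΩ ht hx, sub_one_mul_enthalpy hγ hpos,
    smul_apply, smul_eq_mul]
  ring

theorem contDiffOn_cauchyStress (hc : IsClassicalSolution Ω T μ lam a γ q r U) (hΩ : IsOpen Ω)
    (hγ : 1 < γ) (hq : IsTestOnPos q) (ht : t ∈ Ioo 0 T) :
    ContDiffOn ℝ 1 (cauchyStress μ lam a γ q r U t) Ω :=
  ((stressL N μ lam).contDiff.comp_contDiffOn
    ((hc.velocity_C2 t ht).fderiv_of_isOpen hΩ (by norm_num))).sub
    ((((hc.density_C1.pressure hγ hq).contDiffOn_slice (Ioo_subset_Icc_self ht)).mono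
      subset_closure).smul contDiffOn_const)

theorem tensorDiv_cauchyStress (hc : IsClassicalSolution Ω T μ lam a γ q r U) (hΩ : IsOpen Ω)
    (hγ : 1 < γ) (hq : IsTestOnPos q) (ht : t ∈ Ioo 0 T) (hx : x ∈ Ω) :
    tensorDiv (cauchyStress μ lam a γ q r U t) x = r t x • materialDeriv U t x := by
  have hr := (hc.density_C1.hasFDerivAt_slice hΩ ht hx).differentiableAt
  have hU := (hc.velocity_C1.hasFDerivAt_slice hΩ ht hx).differentiableAt
  have hp : DifferentiableAt ℝ (fun y => pressure a γ q (r t y)) x :=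
    ((hc.density_C1.pressure hγ hq).hasFDerivAt_slice hΩ ht hx).differentiableAt
  have hDU : DifferentiableAt ℝ (fun y => stress μ lam (fderiv ℝ (U t) y)) x :=
    (stressL N μ lam).differentiableAt.comp x
      ((((hc.velocity_C2 t ht).fderiv_of_isOpen (m := 1) hΩ (by norm_num)).differentiableOn
        one_ne_zero).differentiableAt (hΩ.mem_nhds hx))
  have hmomentum : deriv (fun s => r s x • U s x) t =
      r t x • deriv (fun s => U s x) t + deriv (fun s => r s x) t • U t x :=
    ((hc.density_C1.hasDerivAt_time hΩ ht hx).smul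
      (hc.velocity_C1.hasDerivAt_time hΩ ht hx)).deriv
  unfold cauchyStress
  rw [tensorDiv_sub hDU (hp.smul_const _), ← hc.momentum_eq t ht x hx, tensorDiv_smul_id hp,
    gradient_eq_sum, add_sub_cancel_right, hmomentum, tensorDiv_tensor (hr.fun_smul hU) hU,
    fderiv_fun_smul hr hU, hc.deriv_density hΩ ht hx, materialDeriv]
  simp only [add_apply, smul_apply, ContinuousLinearMap.smulRight_apply]
  module

theorem exists_bound_cauchyStress (hc : IsClassicalSolution Ω T μ lam a γ q r U) (hΩ : IsOpen Ω)
    (hb : Bornology.IsBounded Ω) (hγ : 1 < γ) (hq : IsTestOnPos q) :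
    ∃ C : ℝ, ∀ t ∈ Ioo 0 T, ∀ x ∈ Ω, ‖cauchyStress μ lam a γ q r U t x‖ ≤ C := by
  obtain ⟨Cx, hCx⟩ := hc.velocity_C1.exists_bound_fderiv_slice hΩ hb
  obtain ⟨Cp, hCp⟩ := (hc.density_C1.pressure (a := a) hγ hq).exists_bound hb
  refine ⟨‖stressL N μ lam‖ * Cx + Cp * ‖ContinuousLinearMap.id ℝ (Eucl N)‖, fun t ht x hx =>
    norm_sub_le_of_le (ContinuousLinearMap.le_opNorm_of_le (stressL N μ lam) (hCx t ht x hx)) ?_⟩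
  rw [norm_smul]
  exact mul_le_mul_of_nonneg_right (hCp t (Ioo_subset_Icc_self ht) x (subset_closure hx))
    (norm_nonneg _)

theorem integral_inner_materialDeriv (hc : IsClassicalSolution Ω T μ lam a γ q r U)
    (hΩ : IsOpen Ω) (hb : Bornology.IsBounded Ω) (hγ : 1 < γ) (hq : IsTestOnPos q)
    (ht : t ∈ Ioo 0 T) {v : Eucl N → Eucl N} {G : Eucl N → (Eucl N →L[ℝ] Eucl N)}
    (h : MemH10 Ω v G) :
    ∫ x in Ω, ((inner ℝ (r t x • materialDeriv U t x) (v x) : ℝ)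
      + frob (cauchyStress μ lam a γ q r U t x) (G x)) = 0 := by
  obtain ⟨Cr, hCr⟩ := hc.density_C1.exists_bound hb
  obtain ⟨Cm, hCm⟩ := hc.velocity_C1.exists_bound_materialDeriv hΩ hb
  obtain ⟨C, hC⟩ := hc.exists_bound_cauchyStress hΩ hb hγ hq
  have hdiv (x : Eucl N) (hx : x ∈ Ω) := hc.tensorDiv_cauchyStress hΩ hγ hq ht hx
  rw [← h.integral_tensorDiv (C' := Cr * Cm) hΩ hb (hc.contDiffOn_cauchyStress hΩ hγ hq ht)
    (hC t ht) fun x hx => ?_]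
  · exact setIntegral_congr_fun hΩ.measurableSet fun x hx => by simp only [hdiv x hx]
  · have hr := hCr t (Ioo_subset_Icc_self ht) x (subset_closure hx)
    rw [hdiv x hx, norm_smul]
    exact mul_le_mul hr (hCm t ht x hx) (norm_nonneg _) ((norm_nonneg _).trans hr)

end IsClassicalSolution

end ClassicalSolutions

section RelativeEnergy

variable {N : ℕ} {Ω : Set (Eucl N)} {T μ lam a γ : ℝ} {q : ℝ → ℝ}
  {ρ : ℝ → Eucl N → ℝ} {u : ℝ → Eucl N → Eucl N} {Du : ℝ → Eucl N → (Eucl N →L[ℝ] Eucl N)}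
  {r : ℝ → Eucl N → ℝ} {U : ℝ → Eucl N → Eucl N} {t : ℝ} {x : Eucl N}

/-- The density of the relative energy of the state `[s, v]` with respect to `[r, V]`. The potential
of `q` is left out: on it `relPotential` would not be convex. -/
def relEnergy (a γ s : ℝ) (v : Eucl N) (r : ℝ) (V : Eucl N) : ℝ :=
  1 / 2 * s * ‖v - V‖ ^ 2 + relPotential a γ s r

/-- The function that tests the continuity equation in the relative energy method: the coefficient
of `ρ` in the relative energy. -/
def densityMultiplier (a γ : ℝ) (r : ℝ → Eucl N → ℝ) (U : ℝ → Eucl N → Eucl N) (t : ℝ)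
    (x : Eucl N) : ℝ :=
  1 / 2 * ‖U t x‖ ^ 2 - enthalpy a γ (r t x)

/-- The rate at which the relative energy can grow, as it comes out of the energy inequality and of
the continuity and momentum equations tested with `densityMultiplier` and `U`. -/
def relEnergySource (μ lam a γ : ℝ) (q : ℝ → ℝ) (ρ : ℝ → Eucl N → ℝ) (u : ℝ → Eucl N → Eucl N)
    (Du : ℝ → Eucl N → (Eucl N →L[ℝ] Eucl N)) (r : ℝ → Eucl N → ℝ) (U : ℝ → Eucl N → Eucl N)
    (t : ℝ) (x : Eucl N) : ℝ :=
  -frob (stress μ lam (Du t x)) (Du t x) + q (ρ t x) * tr (Du t x)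
    - momentumFlux a γ q ρ u U t x + frob (stress μ lam (Du t x)) (fderiv ℝ (U t) x)
    + massFlux ρ u (densityMultiplier a γ r U) t x + deriv (fun s => a * r s x ^ γ) t

/-- The remainder of the relative energy inequality; each of its terms is quadratically small in
the distance from `[ρ, u]` to `[r, U]`. -/
def remainder (a γ : ℝ) (q : ℝ → ℝ) (ρ : ℝ → Eucl N → ℝ) (u : ℝ → Eucl N → Eucl N)
    (Du : ℝ → Eucl N → (Eucl N →L[ℝ] Eucl N)) (r : ℝ → Eucl N → ℝ) (U : ℝ → Eucl N → Eucl N)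
    (t : ℝ) (x : Eucl N) : ℝ :=
  -(ρ t x * (inner ℝ (u t x - U t x) (fderiv ℝ (U t) x (u t x - U t x)) : ℝ))
    - (ρ t x - r t x) * ((inner ℝ (u t x - U t x) (materialDeriv U t x) : ℝ)
        + fderiv ℝ (fun y => enthalpy a γ (r t y)) x (u t x - U t x))
    - (γ - 1) * relPotential a γ (ρ t x) (r t x) * tr (fderiv ℝ (U t) x)
    + (q (ρ t x) - q (r t x)) * tr (Du t x - fderiv ℝ (U t) x)

/-- The viscous dissipation of the velocity difference `u - U`. -/
def relDissipation (μ lam : ℝ) (Du : ℝ → Eucl N → (Eucl N →L[ℝ] Eucl N))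
    (U : ℝ → Eucl N → Eucl N) (t : ℝ) (x : Eucl N) : ℝ :=
  frob (stress μ lam (Du t x - fderiv ℝ (U t) x)) (Du t x - fderiv ℝ (U t) x)

theorem relEnergy_eq (hγ : 1 < γ) (hr : 0 < r t x) :
    relEnergy a γ (ρ t x) (u t x) (r t x) (U t x) =
      energyDensity a γ q (ρ t x) (u t x) - perturbationPotential q (ρ t x)
        - (inner ℝ (ρ t x • u t x) (U t x) : ℝ) + ρ t x * densityMultiplier a γ r U t x
        + a * r t x ^ γ := by
  rw [relEnergy, energyDensity, pressurePotential_eq_add, relPotential, densityMultiplier,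
    ← mul_enthalpy_sub_potential hγ hr, norm_sub_sq_real, real_inner_smul_left]
  ring

theorem relEnergy_nonneg (ha : 0 ≤ a) (hγ : 1 < γ) {s r : ℝ} (hs : 0 ≤ s) (hr : 0 < r)
    (v V : Eucl N) : 0 ≤ relEnergy a γ s v r V :=
  add_nonneg (by positivity) (relPotential_nonneg ha hγ hs hr)

section DensityMultiplier

variable (hr : IsC1 Ω T r) (hU : IsC1 Ω T U)
  (hpos : ∀ t ∈ Icc (0 : ℝ) T, ∀ x ∈ closure Ω, 0 < r t x)
include hr hU hpos

theorem isC1_densityMultiplier : IsC1 Ω T (densityMultiplier a γ r U) :=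
  (contDiffOn_const.mul (ContDiffOn.norm_sq ℝ hU)).sub (hr.enthalpy hpos)

theorem deriv_densityMultiplier (hΩ : IsOpen Ω) (ht : t ∈ Ioo 0 T) (hx : x ∈ Ω) :
    deriv (fun s => densityMultiplier a γ r U s x) t =
      (inner ℝ (U t x) (deriv (fun s => U s x) t) : ℝ)
        - deriv (fun s => enthalpy a γ (r s x)) t := by
  have hkin : HasDerivAt (fun s => 1 / 2 * ‖U s x‖ ^ 2) _ t :=
    (hU.hasDerivAt_time hΩ ht hx).norm_sq.const_mul (1 / 2)
  refine (hkin.sub ((hr.enthalpy hpos).hasDerivAt_time hΩ ht hx)).deriv.trans ?_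
  ring

theorem fderiv_densityMultiplier (hΩ : IsOpen Ω) (ht : t ∈ Ioo 0 T) (hx : x ∈ Ω) (v : Eucl N) :
    fderiv ℝ (densityMultiplier a γ r U t) x v =
      (inner ℝ (U t x) (fderiv ℝ (U t) x v) : ℝ)
        - fderiv ℝ (fun y => enthalpy a γ (r t y)) x v := by
  have hkin : HasFDerivAt (fun y => 1 / 2 * ‖U t y‖ ^ 2) _ x :=
    (hU.hasFDerivAt_slice hΩ ht hx).norm_sq.const_mul (1 / 2)
  have hd : HasFDerivAt (densityMultiplier a γ r U t) _ x :=
    hkin.sub ((hr.enthalpy hpos).hasFDerivAt_slice hΩ ht hx)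
  rw [hd.fderiv]
  simp

end DensityMultiplier

theorem neg_dissipation_sub_flux_eq (μ lam ps pr k s r qs qr Ht : ℝ) (u U Ut : Eucl N)
    (B G : Eucl N →L[ℝ] Eucl N) (g : Eucl N →L[ℝ] ℝ) (hHt : Ht = -(k * tr B) - g U) :
    -frob (stress μ lam G) G + qs * tr G
        - ((inner ℝ (s • u) Ut : ℝ) + frob (tensor (s • u) u) B + (ps + qs) * tr B)
        + frob (stress μ lam G) B
        + (s * ((inner ℝ U Ut : ℝ) - Ht) + s * ((inner ℝ U (B u) : ℝ) - g u)) + r * Ht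
      + ((inner ℝ (r • (Ut + B U)) (u - U) : ℝ)
        + frob (stress μ lam B - (pr + qr) • ContinuousLinearMap.id ℝ (Eucl N)) (G - B))
      + (r * g u + pr * tr G) =
    -(s * (inner ℝ (u - U) (B (u - U)) : ℝ))
      - (s - r) * ((inner ℝ (u - U) (Ut + B U) : ℝ) + g (u - U))
      - (ps - pr - k * (s - r)) * tr B + (qs - qr) * tr (G - B)
      - frob (stress μ lam (G - B)) (G - B) := by
  rw [real_inner_comm (u - U) (r • (Ut + B U)), real_inner_smul_right]
  simp only [frob_tensor, stress_sub, frob_sub_left, frob_sub_right, frob_smul_left, frob_id_left,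
    tr_sub, map_sub, inner_sub_left, inner_sub_right, inner_add_right, real_inner_smul_left, hHt]
  ring

/-- The pressure gradient of the classical solution acts on `u` through `r ∇h(r)`, where `h` is the
enthalpy; adding its weak form is what turns the source into a quadratic expression. -/
theorem IsClassicalSolution.relEnergySource_add
    (hc : IsClassicalSolution Ω T μ lam a γ q r U) (hΩ : IsOpen Ω) (hγ : 1 < γ)
    (hpos : ∀ t ∈ Icc (0 : ℝ) T, ∀ x ∈ closure Ω, 0 < r t x) (ht : t ∈ Ioo 0 T) (hx : x ∈ Ω) :
    relEnergySource μ lam a γ q ρ u Du r U t x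
      + ((inner ℝ (r t x • materialDeriv U t x) (u t x - U t x) : ℝ)
        + frob (cauchyStress μ lam a γ q r U t x) (Du t x - fderiv ℝ (U t) x))
      + (fderiv ℝ (fun y => a * r t y ^ γ) x (u t x) + a * r t x ^ γ * tr (Du t x)) =
    remainder a γ q ρ u Du r U t x - relDissipation μ lam Du U t x := by
  have hrx := hpos t (Ioo_subset_Icc_self ht) x (subset_closure hx)
  have hpotential : (γ - 1) * relPotential a γ (ρ t x) (r t x) =
      a * ρ t x ^ γ - a * r t x ^ γ - (γ - 1) * enthalpy a γ (r t x) * (ρ t x - r t x) := by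
    rw [← sub_one_mul_potential hγ, ← sub_one_mul_potential hγ, relPotential]
    ring
  have hr1 := hc.density_C1
  rw [relEnergySource, momentumFlux, massFlux,
    deriv_densityMultiplier hr1 hc.velocity_C1 hpos hΩ ht hx,
    fderiv_densityMultiplier hr1 hc.velocity_C1 hpos hΩ ht hx,
    fderiv_mul_rpow hγ (hr1.hasFDerivAt_slice hΩ ht hx).differentiableAt hrx,
    deriv_mul_rpow hγ (hr1.hasDerivAt_time hΩ ht hx).differentiableAt hrx, remainder, hpotential]
  exact neg_dissipation_sub_flux_eq _ _ _ _ _ _ _ _ _ _ _ _ _ _ _ _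
    (hc.deriv_enthalpy hΩ hγ ht hx hrx)

theorem IsC1.memLp_top_cauchyStress (hr : IsC1 Ω T r) (hU : IsC1 Ω T U) (hΩ : IsOpen Ω)
    (hb : Bornology.IsBounded Ω) (hγ : 1 < γ) (hq : IsTestOnPos q) :
    MemLp (fun z : ℝ × Eucl N => cauchyStress μ lam a γ q r U z.1 z.2) ⊤
      (volume.restrict (cylinder Ω T)) :=
  ((stressL N μ lam).comp_memLp' (hU.memLp_top_fderiv_slice hΩ hb)).sub
    ((ContinuousLinearMap.toSpanSingleton ℝ (ContinuousLinearMap.id ℝ (Eucl N))).comp_memLp'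
      ((hr.pressure hγ hq).memLp_top hΩ hb))

namespace IsWeakSolutionWithGradient

theorem integral_relEnergy_eq (h : IsWeakSolutionWithGradient Ω T μ lam a γ q ρ u Du)
    (hΩ : IsOpen Ω) (hb : Bornology.IsBounded Ω) (hγ : 1 < γ) (hq : IsTestOnPos q)
    (hr : IsC1 Ω T r) (hU : IsC1 Ω T U)
    (hpos : ∀ t ∈ Icc (0 : ℝ) T, ∀ x ∈ closure Ω, 0 < r t x) (ht : t ∈ Icc 0 T)
    (hE : IntegrableOn (fun x => energyDensity a γ q (ρ t x) (u t x)) Ω) :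
    IntegrableOn (fun x => relEnergy a γ (ρ t x) (u t x) (r t x) (U t x)) Ω ∧
    ∫ x in Ω, relEnergy a γ (ρ t x) (u t x) (r t x) (U t x) =
      (∫ x in Ω, energyDensity a γ q (ρ t x) (u t x))
        - (∫ x in Ω, perturbationPotential q (ρ t x))
        - (∫ x in Ω, (inner ℝ (ρ t x • u t x) (U t x) : ℝ))
        + (∫ x in Ω, ρ t x * densityMultiplier a γ r U t x) + ∫ x in Ω, a * r t x ^ γ := by
  have : IsFiniteMeasure (volume.restrict Ω) := isFiniteMeasure_restrict.2 hb.measure_lt_top.ne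
  have hmom : IntegrableOn (fun x => (inner ℝ (ρ t x • u t x) (U t x) : ℝ)) Ω :=
    integrable_bilin_of_memLp_top (innerSL ℝ) (h.integrableOn_momentum t ht)
      (hU.memLp_slice hΩ hb ht ⊤)
  have hmass : IntegrableOn (fun x => ρ t x * densityMultiplier a γ r U t x) Ω :=
    integrable_bilin_of_memLp_top (ContinuousLinearMap.mul ℝ ℝ) (h.integrableOn_density t ht)
      ((isC1_densityMultiplier hr hU hpos).memLp_slice hΩ hb ht ⊤)
  have hpressure : IntegrableOn (fun x => a * r t x ^ γ) Ω :=
    ((hr.mul_rpow hγ).memLp_slice hΩ hb ht 1).integrable le_rfl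
  have hperturb := h.integrableOn_perturbationPotential hb hq ht
  have heq (x : Eucl N) (hx : x ∈ Ω) :=
    relEnergy_eq (a := a) (q := q) (ρ := ρ) (u := u) (U := U) hγ (hpos t ht x (subset_closure hx))
  have hisentropic := hE.fun_sub hperturb
  have hisentropic_mom := hisentropic.fun_sub hmom
  have hlhs := hisentropic_mom.fun_add hmass
  refine ⟨(hlhs.add hpressure).congr
    (ae_restrict_of_forall_mem hΩ.measurableSet fun x hx => (heq x hx).symm), ?_⟩
  rw [setIntegral_congr_fun hΩ.measurableSet heq, integral_add hlhs hpressure,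
    integral_add hisentropic_mom hmass, integral_sub hisentropic hmom, integral_sub hE hperturb]

section Source

variable (h : IsWeakSolutionWithGradient Ω T μ lam a γ q ρ u Du) (hΩ : IsOpen Ω)
  (hb : Bornology.IsBounded Ω) (ha : 0 ≤ a) (hγ : 1 < γ) (hq : IsTestOnPos q)
include h hΩ hb ha hγ hq

theorem integrable_relEnergySource (hr : IsC1 Ω T r) (hU : IsC1 Ω T U)
    (hpos : ∀ t ∈ Icc (0 : ℝ) T, ∀ x ∈ closure Ω, 0 < r t x) :
    Integrable (fun z : ℝ × Eucl N => relEnergySource μ lam a γ q ρ u Du r U z.1 z.2)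
      (volume.restrict (cylinder Ω T)) :=
  have := isFiniteMeasure_restrict_cylinder (T := T) hb
  ((((h.integrable_dissipation.neg.add (h.integrable_perturbation_mul_tr hb hq)).sub
    (h.integrable_momentumFlux hΩ hb ha hγ hq hU)).add (h.integrable_stress_pairing hΩ hb hU)).add
    (h.integrable_massFlux hΩ hb ha hγ hq (isC1_densityMultiplier hr hU hpos))).add
    (((hr.mul_rpow hγ).memLp_top_deriv_time hΩ hb).integrable le_top)

theorem integral_relEnergySource_eq (hr : IsC1 Ω T r) (hU : IsC1 Ω T U)
    (hpos : ∀ t ∈ Icc (0 : ℝ) T, ∀ x ∈ closure Ω, 0 < r t x) {τ : ℝ} (hτ : τ ∈ Ioo 0 T) :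
    ∫ z in cylinder Ω τ, relEnergySource μ lam a γ q ρ u Du r U z.1 z.2 =
      -(∫ z in cylinder Ω τ, frob (stress μ lam (Du z.1 z.2)) (Du z.1 z.2))
        + (∫ z in cylinder Ω τ, q (ρ z.1 z.2) * tr (Du z.1 z.2))
        - (∫ z in cylinder Ω τ, momentumFlux a γ q ρ u U z.1 z.2)
        + (∫ z in cylinder Ω τ, frob (stress μ lam (Du z.1 z.2)) (fderiv ℝ (U z.1) z.2))
        + (∫ z in cylinder Ω τ, massFlux ρ u (densityMultiplier a γ r U) z.1 z.2)
        + ∫ z in cylinder Ω τ, deriv (fun s => a * r s z.2 ^ γ) z.1 := by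
  have := isFiniteMeasure_restrict_cylinder (T := T) hb
  have hle := Measure.restrict_mono (μ := volume) (cylinder_mono (Ω := Ω) hτ.2.le) le_rfl
  have hdiss := h.integrable_dissipation.mono_measure hle
  have hperturb := (h.integrable_perturbation_mul_tr hb hq).mono_measure hle
  have hmom := (h.integrable_momentumFlux hΩ hb ha hγ hq hU).mono_measure hle
  have hstress := (h.integrable_stress_pairing hΩ hb hU).mono_measure hle
  have hmass := (h.integrable_massFlux hΩ hb ha hγ hq
    (isC1_densityMultiplier (a := a) (γ := γ) hr hU hpos)).mono_measure hle
  have hpressure := (((hr.mul_rpow (a := a) hγ).memLp_top_deriv_time hΩ hb).integrable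
    le_top).mono_measure hle
  have hneg := hdiss.fun_neg
  have henergy := hneg.fun_add hperturb
  have henergy_mom := henergy.sub' hmom
  have hmomentum := henergy_mom.fun_add hstress
  have hbalance := hmomentum.fun_add hmass
  simp only [relEnergySource]
  rw [integral_add hbalance hpressure, integral_add hmomentum hmass,
    integral_add henergy_mom hstress, integral_sub henergy hmom,
    integral_add hneg hperturb, integral_neg]

theorem ae_integral_relEnergy_le_source (hr : IsC1 Ω T r) (hU : IsC1 Ω T U)
    (hU0 : VanishesOnBoundary Ω T U)
    (hpos : ∀ t ∈ Icc (0 : ℝ) T, ∀ x ∈ closure Ω, 0 < r t x) :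
    ∀ᵐ τ ∂(volume.restrict (Ioo 0 T)),
      IntegrableOn (fun x => relEnergy a γ (ρ τ x) (u τ x) (r τ x) (U τ x)) Ω ∧
      ∫ x in Ω, relEnergy a γ (ρ τ x) (u τ x) (r τ x) (U τ x) ≤
        (∫ x in Ω, relEnergy a γ (ρ 0 x) (u 0 x) (r 0 x) (U 0 x))
          + ∫ z in cylinder Ω τ, relEnergySource μ lam a γ q ρ u Du r U z.1 z.2 := by
  filter_upwards [h.energy.2, ae_restrict_mem measurableSet_Ioo] with τ hE hτ
  have hτ' := Ioo_subset_Icc_self hτ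
  have hsplit (t : ℝ) (ht : t ∈ Icc 0 T) := h.integral_relEnergy_eq hΩ hb hγ hq hr hU hpos ht
  obtain ⟨hint, hEτ⟩ := hsplit τ hτ' hE.1
  refine ⟨hint, ?_⟩
  have hmass := h.integral_density_mul_sub hΩ hb ha hγ hq
    (isC1_densityMultiplier (a := a) (γ := γ) hr hU hpos) hτ'
  have hmom := h.integral_inner_momentum_sub hΩ hb ha hγ hq hU hU0 hτ'
  have hperturb := h.integral_perturbationPotential_sub hb hq hτ'
  have hpressure := (hr.mul_rpow (a := a) hγ).integral_sub_integral_eq hΩ hb hτ'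
  have henergy := hE.2
  rw [intervalIntegral_eq_integral_cylinder hτ.1.le hτ.2.le
    (h.integrable_perturbation_mul_tr hb hq)] at hperturb
  rw [intervalIntegral_eq_integral_cylinder hτ.1.le hτ.2.le h.integrable_dissipation] at henergy
  rw [hEτ, (hsplit 0 ⟨le_rfl, hτ.1.le.trans hτ.2.le⟩ h.energy.1).2,
    h.integral_relEnergySource_eq hΩ hb ha hγ hq hr hU hpos hτ]
  linarith

end Source

theorem integrable_inner_add_frob_sub (h : IsWeakSolutionWithGradient Ω T μ lam a γ q ρ u Du)
    (hU : IsC1 Ω T U) (hΩ : IsOpen Ω) (hb : Bornology.IsBounded Ω)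
    {V : ℝ × Eucl N → Eucl N} {M : ℝ × Eucl N → (Eucl N →L[ℝ] Eucl N)}
    (hV : MemLp V ⊤ (volume.restrict (cylinder Ω T)))
    (hM : MemLp M ⊤ (volume.restrict (cylinder Ω T))) :
    Integrable (fun z : ℝ × Eucl N => (inner ℝ (V z) (u z.1 z.2 - U z.1 z.2) : ℝ)
      + frob (M z) (Du z.1 z.2 - fderiv ℝ (U z.1) z.2)) (volume.restrict (cylinder Ω T)) := by
  have := isFiniteMeasure_restrict_cylinder (T := T) hb
  exact (integrable_bilin_of_memLp_two (innerSL ℝ) (hV.mono_exponent le_top)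
      (h.velocity.1.sub ((hU.memLp_top hΩ hb).mono_exponent le_top))).add
    (integrable_bilin_of_memLp_two (frobL N) (hM.mono_exponent le_top)
      (h.velocity.2.1.sub ((hU.memLp_top_fderiv_slice hΩ hb).mono_exponent le_top)))

theorem integrable_fderiv_add_mul_tr (h : IsWeakSolutionWithGradient Ω T μ lam a γ q ρ u Du)
    {f : ℝ → Eucl N → ℝ} (hf : IsC1 Ω T f) (hΩ : IsOpen Ω) (hb : Bornology.IsBounded Ω) :
    Integrable (fun z : ℝ × Eucl N => fderiv ℝ (f z.1) z.2 (u z.1 z.2)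
      + f z.1 z.2 * tr (Du z.1 z.2)) (volume.restrict (cylinder Ω T)) := by
  have := isFiniteMeasure_restrict_cylinder (T := T) hb
  exact (integrable_bilin_of_memLp_two (ContinuousLinearMap.id ℝ (Eucl N →L[ℝ] ℝ))
      ((hf.memLp_top_fderiv_slice hΩ hb).mono_exponent le_top) h.velocity.1).add
    (integrable_bilin_of_memLp_two (ContinuousLinearMap.mul ℝ ℝ)
      ((hf.memLp_top hΩ hb).mono_exponent le_top) ((trL N).comp_memLp' h.velocity.2.1))

theorem ae_memH10_sub (h : IsWeakSolutionWithGradient Ω T μ lam a γ q ρ u Du)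
    (hc : IsClassicalSolution Ω T μ lam a γ q r U) (hΩ : IsOpen Ω) (hb : Bornology.IsBounded Ω) :
    ∀ᵐ t ∂(volume.restrict (Ioo 0 T)),
      MemH10 Ω (fun x => u t x - U t x) (fun x => Du t x - fderiv ℝ (U t) x) := by
  filter_upwards [h.velocity.2.2, ae_restrict_mem measurableSet_Ioo] with t hu ht
  exact hu.memH10.sub (hc.memH10_velocity hΩ hb ht)

section Remainder

variable (h : IsWeakSolutionWithGradient Ω T μ lam a γ q ρ u Du)
  (hc : IsClassicalSolution Ω T μ lam a γ q r U) (hΩ : IsOpen Ω) (hb : Bornology.IsBounded Ω)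
  (ha : 0 ≤ a) (hγ : 1 < γ) (hq : IsTestOnPos q)
  (hpos : ∀ t ∈ Icc (0 : ℝ) T, ∀ x ∈ closure Ω, 0 < r t x)
include h hc hΩ hb ha hγ hq hpos

theorem integral_remainder_sub_relDissipation :
    Integrable (fun z : ℝ × Eucl N => remainder a γ q ρ u Du r U z.1 z.2
      - relDissipation μ lam Du U z.1 z.2) (volume.restrict (cylinder Ω T)) ∧
    ∀ τ ∈ Ioo 0 T, ∫ z in cylinder Ω τ, (remainder a γ q ρ u Du r U z.1 z.2
        - relDissipation μ lam Du U z.1 z.2) =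
      ∫ z in cylinder Ω τ, relEnergySource μ lam a γ q ρ u Du r U z.1 z.2 := by
  have hU := hc.velocity_C1
  have hP := hc.density_C1.mul_rpow (a := a) hγ
  have hsource := h.integrable_relEnergySource hΩ hb ha hγ hq hc.density_C1 hU hpos
  have hmom := h.integrable_inner_add_frob_sub hU hΩ hb
    ((ContinuousLinearMap.lsmul ℝ ℝ).memLp_of_bilin ⊤ (hc.density_C1.memLp_top hΩ hb)
      (hU.memLp_top_materialDeriv hΩ hb))
    (hc.density_C1.memLp_top_cauchyStress (μ := μ) (lam := lam) (a := a) hU hΩ hb hγ hq)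
  have hpressure := h.integrable_fderiv_add_mul_tr hP hΩ hb
  have heq := ae_restrict_of_forall_mem (μ := volume) (isOpen_cylinder hΩ).measurableSet
    fun (z : ℝ × Eucl N) hz =>
      hc.relEnergySource_add (ρ := ρ) (u := u) (Du := Du) hΩ hγ hpos hz.1 hz.2
  refine ⟨((hsource.add hmom).add hpressure).congr heq, fun τ hτ => ?_⟩
  have hle := Measure.restrict_mono (μ := volume) (cylinder_mono (Ω := Ω) hτ.2.le) le_rfl
  have hmom0 := integral_cylinder_eq_zero hτ.1.le hτ.2.le hmom (by
    filter_upwards [h.ae_memH10_sub hc hΩ hb, ae_restrict_mem measurableSet_Ioo] with t hw ht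
    exact hc.integral_inner_materialDeriv hΩ hb hγ hq ht hw)
  have hpressure0 := integral_cylinder_eq_zero hτ.1.le hτ.2.le hpressure (by
    filter_upwards [h.velocity.2.2, ae_restrict_mem measurableSet_Ioo] with t hu ht
    exact hP.integral_div hΩ hb ht hu.memH10)
  rw [← integral_congr_ae (ae_mono hle heq)]
  refine (integral_add ((hsource.add hmom).mono_measure hle) (hpressure.mono_measure hle)).trans ?_
  rw [hpressure0, add_zero]
  refine (integral_add (hsource.mono_measure hle) (hmom.mono_measure hle)).trans ?_
  exact (congrArg (_ + ·) hmom0).trans (add_zero _)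

theorem ae_integral_relEnergy_le :
    ∀ᵐ τ ∂(volume.restrict (Ioo 0 T)),
      IntegrableOn (fun x => relEnergy a γ (ρ τ x) (u τ x) (r τ x) (U τ x)) Ω ∧
      ∫ x in Ω, relEnergy a γ (ρ τ x) (u τ x) (r τ x) (U τ x) ≤
        (∫ x in Ω, relEnergy a γ (ρ 0 x) (u 0 x) (r 0 x) (U 0 x))
          + ∫ z in cylinder Ω τ, (remainder a γ q ρ u Du r U z.1 z.2
            - relDissipation μ lam Du U z.1 z.2) := by
  filter_upwards [h.ae_integral_relEnergy_le_source hΩ hb ha hγ hq hc.density_C1 hc.velocity_C1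
    hc.no_slip hpos, ae_restrict_mem measurableSet_Ioo] with τ hτ hτT
  rwa [(h.integral_remainder_sub_relDissipation hc hΩ hb ha hγ hq hpos).2 τ hτT]

end Remainder

end IsWeakSolutionWithGradient

end RelativeEnergy

section Gronwall

variable {T C : ℝ}

theorem eq_zero_of_le_mul_integral {Y : ℝ → ℝ} (hY : ContinuousOn Y (Icc 0 T))
    (h0 : ∀ t ∈ Icc (0 : ℝ) T, 0 ≤ Y t)
    (h : ∀ t ∈ Icc (0 : ℝ) T, Y t ≤ C * ∫ s in (0 : ℝ)..t, Y s) {t : ℝ} (ht : t ∈ Icc 0 T) :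
    Y t = 0 := by
  have hint : IntegrableOn Y (uIcc 0 T) := by
    rw [uIcc_of_le (ht.1.trans ht.2)]
    exact hY.integrableOn_Icc
  have hderiv (s : ℝ) (hs : s ∈ Ico 0 T) :
      HasDerivWithinAt (fun τ => ∫ s in (0 : ℝ)..τ, Y s) (Y s) (Ici s) s := by
    have hle : 𝓝[>] s ≤ 𝓝[Icc 0 T] s := nhdsWithin_le_of_mem (Icc_mem_nhdsGT_of_mem hs)
    exact intervalIntegral.integral_hasDerivWithinAt_right
      ((hY.mono (Icc_subset_Icc_right hs.2.le)).intervalIntegrable_of_Icc hs.1)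
      ((hY.stronglyMeasurableAtFilter_nhdsWithin measurableSet_Icc s).filter_mono hle)
      ((hY s (Ico_subset_Icc_self hs)).mono_left hle)
  have hzero : ∫ s in (0 : ℝ)..t, Y s = 0 := by
    refine eq_zero_of_abs_deriv_le_mul_abs_self_of_eq_zero_right (f' := Y) (K := C) ?_ hderiv
      intervalIntegral.integral_same (fun s hs => ?_) t ht
    · exact uIcc_of_le (ht.1.trans ht.2) ▸ intervalIntegral.continuousOn_primitive_interval hint
    · have hs' := Ico_subset_Icc_self hs
      rw [Real.norm_of_nonneg (h0 s hs'), Real.norm_of_nonneg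
        (intervalIntegral.integral_nonneg hs.1 fun τ hτ => h0 τ ⟨hτ.1, hτ.2.trans hs.2.le⟩)]
      exact h s hs'
  exact le_antisymm ((h t ht).trans_eq (by rw [hzero, mul_zero])) (h0 t ht)

theorem integral_eq_zero_of_ae_le_mul_integral {X : ℝ → ℝ} (hT : 0 ≤ T)
    (hX : IntegrableOn X (Ioo 0 T)) (h0 : ∀ᵐ t ∂(volume.restrict (Ioo 0 T)), 0 ≤ X t)
    (h : ∀ᵐ t ∂(volume.restrict (Ioo 0 T)), X t ≤ C * ∫ s in (0 : ℝ)..t, X s) :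
    ∫ t in (0 : ℝ)..T, X t = 0 := by
  have hXi : IntegrableOn X (Icc 0 T) := by rwa [integrableOn_Icc_iff_integrableOn_Ioo]
  have hY : ContinuousOn (fun t => ∫ s in (0 : ℝ)..t, X s) (Icc 0 T) := by
    rw [← uIcc_of_le hT] at hXi ⊢
    exact intervalIntegral.continuousOn_primitive_interval hXi
  have hle {t : ℝ} (ht : t ∈ Icc 0 T) :
      volume.restrict (Ioc 0 t) ≤ (volume : Measure ℝ).restrict (Ioo 0 T) :=
    (Measure.restrict_mono (Ioc_subset_Ioc_right ht.2) le_rfl).trans_eq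
      restrict_Ioo_eq_restrict_Ioc.symm
  refine eq_zero_of_le_mul_integral (C := C) hY (fun t ht => ?_) (fun t ht => ?_) ⟨hT, le_rfl⟩
  · rw [intervalIntegral.integral_of_le ht.1]
    exact integral_nonneg_of_ae (ae_mono (hle ht) h0)
  · rw [← intervalIntegral.integral_const_mul, intervalIntegral.integral_of_le ht.1,
      intervalIntegral.integral_of_le ht.1]
    exact integral_mono_ae (Integrable.mono_measure hX (hle ht))
      (((hY.mono (Icc_subset_Icc_right ht.2)).const_smul C).integrableOn_Icc.mono_set
        Ioc_subset_Icc_self) (ae_mono (hle ht) h)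

end Gronwall

section Uniqueness

variable {N : ℕ} {Ω : Set (Eucl N)} {T μ lam a γ : ℝ} {q : ℝ → ℝ}
  {ρ : ℝ → Eucl N → ℝ} {u : ℝ → Eucl N → Eucl N} {Du : ℝ → Eucl N → (Eucl N →L[ℝ] Eucl N)}
  {r : ℝ → Eucl N → ℝ} {U : ℝ → Eucl N → Eucl N} {t : ℝ} {x : Eucl N}

theorem relEnergy_self (a γ r : ℝ) (V : Eucl N) : relEnergy a γ r V r V = 0 := by
  simp [relEnergy, relPotential]

theorem eq_of_relEnergy_eq_zero (ha : 0 < a) (hγ : 1 < γ) {s r : ℝ} (hs : 0 ≤ s) (hr : 0 < r)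
    {v V : Eucl N} (h : relEnergy a γ s v r V = 0) : s = r ∧ v = V := by
  obtain ⟨hkin, hpot⟩ := (add_eq_zero_iff_of_nonneg (by positivity)
    (relPotential_nonneg ha.le hγ hs hr)).1 h
  obtain rfl := eq_of_relPotential_eq_zero ha hγ hs hr hpot
  have hnorm : ‖v - V‖ ^ 2 = 0 := (mul_eq_zero.1 hkin).resolve_left (by positivity)
  exact ⟨rfl, sub_eq_zero.1 (norm_eq_zero.1 (pow_eq_zero_iff two_ne_zero |>.1 hnorm))⟩

theorem remainder_le {KB KF : ℝ} (ha : 0 ≤ a) (hγ : 1 < γ) (hρ : 0 ≤ ρ t x) (hr : 0 < r t x)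
    (hB : ‖fderiv ℝ (U t) x‖ ≤ KB)
    (hF : ‖materialDeriv U t x‖ + ‖fderiv ℝ (fun y => enthalpy a γ (r t y)) x‖ ≤ KF) :
    remainder a γ q ρ u Du r U t x ≤
      KB * (ρ t x * ‖u t x - U t x‖ ^ 2) + KF * (|ρ t x - r t x| * ‖u t x - U t x‖)
        + N * KB * ((γ - 1) * relPotential a γ (ρ t x) (r t x))
        + |q (ρ t x) - q (r t x)| * |tr (Du t x - fderiv ℝ (U t) x)| := by
  set w := u t x - U t x
  set B := fderiv ℝ (U t) x
  set g := fderiv ℝ (fun y => enthalpy a γ (r t y)) x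
  set p := (γ - 1) * relPotential a γ (ρ t x) (r t x)
  have hp : 0 ≤ p := mul_nonneg (sub_nonneg.2 hγ.le) (relPotential_nonneg ha hγ hρ hr)
  have hconv : -(ρ t x * (inner ℝ w (B w) : ℝ)) ≤ KB * (ρ t x * ‖w‖ ^ 2) :=
    calc -(ρ t x * (inner ℝ w (B w) : ℝ)) = ρ t x * -(inner ℝ w (B w) : ℝ) := by ring
      _ ≤ ρ t x * (‖w‖ * (KB * ‖w‖)) := by
          gcongr
          exact (neg_le_abs _).trans ((abs_real_inner_le_norm _ _).trans (by
            gcongr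
            exact B.le_of_opNorm_le hB w))
      _ = KB * (ρ t x * ‖w‖ ^ 2) := by ring
  have hforce : -((ρ t x - r t x) * ((inner ℝ w (materialDeriv U t x) : ℝ) + g w)) ≤
      KF * (|ρ t x - r t x| * ‖w‖) :=
    calc -((ρ t x - r t x) * ((inner ℝ w (materialDeriv U t x) : ℝ) + g w))
        ≤ |ρ t x - r t x| * |(inner ℝ w (materialDeriv U t x) : ℝ) + g w| :=
          (neg_le_abs _).trans_eq (abs_mul _ _)
      _ ≤ |ρ t x - r t x| * (‖w‖ * ‖materialDeriv U t x‖ + ‖g‖ * ‖w‖) := by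
          gcongr
          exact (abs_add_le _ _).trans (add_le_add (abs_real_inner_le_norm _ _) (g.le_opNorm w))
      _ = (‖materialDeriv U t x‖ + ‖g‖) * (|ρ t x - r t x| * ‖w‖) := by ring
      _ ≤ KF * (|ρ t x - r t x| * ‖w‖) := by gcongr
  have hcompr : -(p * tr B) ≤ N * KB * p :=
    calc -(p * tr B) = p * -tr B := by ring
      _ ≤ p * (N * KB) := by
          gcongr
          exact (neg_le_abs _).trans ((abs_tr_le B).trans (by gcongr))
      _ = N * KB * p := mul_comm _ _
  have hpert := (le_abs_self ((q (ρ t x) - q (r t x)) * tr (Du t x - B))).trans_eq (abs_mul _ _)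
  rw [remainder]
  linarith

theorem exists_remainder_le (hΩ : IsOpen Ω) (hb : Bornology.IsBounded Ω) (ha : 0 < a) (hγ : 1 < γ)
    (hq : IsTestOnPos q) (hr : IsC1 Ω T r) (hU : IsC1 Ω T U)
    (hpos : ∀ t ∈ Icc (0 : ℝ) T, ∀ x ∈ closure Ω, 0 < r t x) {δ : ℝ} (hδ : 0 < δ) :
    ∃ C : ℝ, ∀ t ∈ Ioo 0 T, ∀ x ∈ Ω, 0 ≤ ρ t x →
      remainder a γ q ρ u Du r U t x ≤
        C * relEnergy a γ (ρ t x) (u t x) (r t x) (U t x)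
          + δ * (‖u t x - U t x‖ ^ 2 + tr (Du t x - fderiv ℝ (U t) x) ^ 2) := by
  obtain ⟨r₀, hr₀, hlow⟩ := (isCompact_Icc_prod_closure (T := T) hb).exists_forall_le'
    hr.continuousOn fun z hz => hpos z.1 hz.1 z.2 hz.2
  obtain ⟨R, hR⟩ := hr.exists_bound hb
  obtain ⟨KB, hKB⟩ := hU.exists_bound_fderiv_slice hΩ hb
  obtain ⟨KU, hKU⟩ := hU.exists_bound_materialDeriv hΩ hb
  obtain ⟨Kh, hKh⟩ := (hr.enthalpy (a := a) (γ := γ) hpos).exists_bound_fderiv_slice hΩ hb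
  obtain ⟨C, hC⟩ := exists_remainder_bound ha hγ hq hr₀ (le_max_left r₀ R)
    (abs_nonneg KB) (abs_nonneg (KU + Kh)) (mul_nonneg N.cast_nonneg (abs_nonneg KB)) hδ
  refine ⟨C, fun t ht x hx hs => ?_⟩
  have ht' := Ioo_subset_Icc_self ht
  have hx' := subset_closure hx
  have hrx : r t x ∈ Icc r₀ (max r₀ R) :=
    ⟨hlow (t, x) ⟨ht', hx'⟩, le_max_of_le_right ((le_abs_self _).trans (hR t ht' x hx'))⟩
  exact (remainder_le ha.le hγ hs (hpos t ht' x hx') ((hKB t ht x hx).trans (le_abs_self _))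
    ((add_le_add (hKU t ht x hx) (hKh t ht x hx)).trans (le_abs_self _))).trans
    (hC (r t x) hrx (ρ t x) hs _ _)

namespace IsWeakSolutionWithGradient

section Dissipation

variable (h : IsWeakSolutionWithGradient Ω T μ lam a γ q ρ u Du)
include h

theorem memLp_gradient_sub (hΩ : IsOpen Ω) (hb : Bornology.IsBounded Ω) (hU : IsC1 Ω T U) :
    MemLp (fun z : ℝ × Eucl N => Du z.1 z.2 - fderiv ℝ (U z.1) z.2) 2
      (volume.restrict (cylinder Ω T)) :=
  have := isFiniteMeasure_restrict_cylinder (T := T) hb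
  h.velocity.2.1.sub ((hU.memLp_top_fderiv_slice hΩ hb).mono_exponent le_top)

theorem integrable_relDissipation (hΩ : IsOpen Ω) (hb : Bornology.IsBounded Ω)
    (hU : IsC1 Ω T U) :
    Integrable (fun z : ℝ × Eucl N => relDissipation μ lam Du U z.1 z.2)
      (volume.restrict (cylinder Ω T)) :=
  integrable_bilin_of_memLp_two ((frobL N).comp (stressL N μ lam))
    (h.memLp_gradient_sub hΩ hb hU) (h.memLp_gradient_sub hΩ hb hU)

theorem integrable_sq_velocity_sub_add_sq_tr (hΩ : IsOpen Ω) (hb : Bornology.IsBounded Ω)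
    (hU : IsC1 Ω T U) :
    Integrable (fun z : ℝ × Eucl N => ‖u z.1 z.2 - U z.1 z.2‖ ^ 2
      + tr (Du z.1 z.2 - fderiv ℝ (U z.1) z.2) ^ 2) (volume.restrict (cylinder Ω T)) := by
  have := isFiniteMeasure_restrict_cylinder (T := T) hb
  exact ((h.velocity.1.sub ((hU.memLp_top hΩ hb).mono_exponent le_top)).integrable_norm_pow
    two_ne_zero).add ((trL N).comp_memLp' (h.memLp_gradient_sub hΩ hb hU)).integrable_sq

theorem exists_coercivity_relDissipation (hN : 0 < N) (hΩ : IsOpen Ω)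
    (hb : Bornology.IsBounded Ω) (hμ : 0 < μ) (hlam : 0 ≤ lam) (hvisc : N = 1 → 0 < lam)
    (hc : IsClassicalSolution Ω T μ lam a γ q r U) :
    ∃ δ > 0, ∀ τ ∈ Ioo 0 T,
      δ * (∫ z in cylinder Ω τ, (‖u z.1 z.2 - U z.1 z.2‖ ^ 2
        + tr (Du z.1 z.2 - fderiv ℝ (U z.1) z.2) ^ 2)) ≤
      ∫ z in cylinder Ω τ, relDissipation μ lam Du U z.1 z.2 := by
  obtain ⟨δ, hδ, hcoer⟩ := exists_coercivity_stress_of_memH10 hN hΩ hb hμ hlam hvisc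
  refine ⟨δ, hδ, fun τ hτ => ?_⟩
  have hdiss := h.integrable_relDissipation hΩ hb hc.velocity_C1
  have hsq := (h.integrable_sq_velocity_sub_add_sq_tr hΩ hb hc.velocity_C1).const_mul δ
  have hle := Measure.restrict_mono (μ := volume) (cylinder_mono (Ω := Ω) hτ.2.le) le_rfl
  rw [← integral_const_mul, ← sub_nonneg,
    ← integral_sub (hdiss.mono_measure hle) (hsq.mono_measure hle)]
  refine integral_cylinder_nonneg (f := fun t x => relDissipation μ lam Du U t x
    - δ * (‖u t x - U t x‖ ^ 2 + tr (Du t x - fderiv ℝ (U t) x) ^ 2)) hτ.1.le hτ.2.le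
    (hdiss.sub hsq) ?_
  filter_upwards [h.ae_memH10_sub hc hΩ hb] with t hw
  have hdisst : IntegrableOn (fun x => relDissipation μ lam Du U t x) Ω :=
    integrable_bilin_of_memLp_two ((frobL N).comp (stressL N μ lam)) hw.2.1 hw.2.1
  have hsqt : IntegrableOn (fun x => ‖u t x - U t x‖ ^ 2
      + tr (Du t x - fderiv ℝ (U t) x) ^ 2) Ω :=
    (hw.1.integrable_norm_pow two_ne_zero).add ((trL N).comp_memLp' hw.2.1).integrable_sq
  rw [integral_sub hdisst (hsqt.const_mul δ), integral_const_mul]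
  exact sub_nonneg.2 (hcoer _ _ hw)

end Dissipation

section Gronwall

variable (h : IsWeakSolutionWithGradient Ω T μ lam a γ q ρ u Du)
  (hc : IsClassicalSolution Ω T μ lam a γ q r U) (hΩ : IsOpen Ω) (hb : Bornology.IsBounded Ω)
  (hγ : 1 < γ) (hq : IsTestOnPos q) (hpos : ∀ t ∈ Icc (0 : ℝ) T, ∀ x ∈ closure Ω, 0 < r t x)
include h hc hΩ hb hγ hq hpos

theorem integrable_relEnergy (ha : 0 ≤ a) :
    Integrable (fun z : ℝ × Eucl N => relEnergy a γ (ρ z.1 z.2) (u z.1 z.2) (r z.1 z.2)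
      (U z.1 z.2)) (volume.restrict (cylinder Ω T)) := by
  have := isFiniteMeasure_restrict_cylinder (T := T) hb
  have hmom : Integrable (fun z : ℝ × Eucl N => (inner ℝ (ρ z.1 z.2 • u z.1 z.2) (U z.1 z.2) : ℝ))
      (volume.restrict (cylinder Ω T)) :=
    integrable_bilin_of_memLp_top (innerSL ℝ) (h.integrable_momentum hb ha hγ hq)
      (hc.velocity_C1.memLp_top hΩ hb)
  have hmass := integrable_bilin_of_memLp_top (ContinuousLinearMap.mul ℝ ℝ) h.integrable_density
    ((isC1_densityMultiplier (a := a) (γ := γ) hc.density_C1 hc.velocity_C1 hpos).memLp_top hΩ hb)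
  have hpressure := ((hc.density_C1.mul_rpow (a := a) hγ).memLp_top hΩ hb).integrable le_top
  refine ((((h.integrable_kinetic_add_potential hb ha hγ hq).sub hmom).add hmass).add
    hpressure).congr (ae_restrict_of_forall_mem (isOpen_cylinder hΩ).measurableSet fun z hz => ?_)
  simp only [Pi.add_apply, Pi.sub_apply, ContinuousLinearMap.mul_apply']
  rw [relEnergy_eq (q := q) hγ (hpos _ (Ioo_subset_Icc_self hz.1) _ (subset_closure hz.2)),
    energyDensity, pressurePotential_eq_add]
  ring

theorem exists_integral_remainder_sub_relDissipation_le (hN : 0 < N) (hμ : 0 < μ)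
    (hlam : 0 ≤ lam) (hvisc : N = 1 → 0 < lam) (ha : 0 < a) :
    ∃ C : ℝ, ∀ τ ∈ Ioo 0 T, ∫ z in cylinder Ω τ, (remainder a γ q ρ u Du r U z.1 z.2
        - relDissipation μ lam Du U z.1 z.2) ≤
      C * ∫ z in cylinder Ω τ, relEnergy a γ (ρ z.1 z.2) (u z.1 z.2) (r z.1 z.2) (U z.1 z.2) := by
  obtain ⟨δ, hδ, hcoer⟩ := h.exists_coercivity_relDissipation hN hΩ hb hμ hlam hvisc hc
  obtain ⟨C, hC⟩ := exists_remainder_le (ρ := ρ) (u := u) (Du := Du) hΩ hb ha hγ hq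
    hc.density_C1 hc.velocity_C1 hpos hδ
  refine ⟨C, fun τ hτ => ?_⟩
  have hle := Measure.restrict_mono (μ := volume) (cylinder_mono (Ω := Ω) hτ.2.le) le_rfl
  have henergy := ((h.integrable_relEnergy hc hΩ hb hγ hq hpos ha.le).mono_measure hle).const_mul C
  have hsq := ((h.integrable_sq_velocity_sub_add_sq_tr hΩ hb
    hc.velocity_C1).mono_measure hle).const_mul δ
  have hdiss := (h.integrable_relDissipation hΩ hb hc.velocity_C1).mono_measure hle
  have hbound := integral_mono_ae
    ((h.integral_remainder_sub_relDissipation hc hΩ hb ha.le hγ hq hpos).1.mono_measure hle)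
    ((henergy.add hsq).sub hdiss) (ae_mono hle (by
      filter_upwards [h.ae_nonneg_cylinder, ae_restrict_mem (isOpen_cylinder hΩ).measurableSet]
        with z hz hzc
      exact sub_le_sub_right (hC z.1 hzc.1 z.2 hzc.2 hz) _))
  have hsplit := (integral_sub (henergy.add hsq) hdiss).trans
    (congrArg (· - _) (integral_add henergy hsq))
  rw [integral_const_mul, integral_const_mul] at hsplit
  linarith [hbound.trans_eq hsplit, hcoer τ hτ]

theorem ae_relEnergy_eq_zero (hN : 0 < N) (hT : 0 ≤ T) (hμ : 0 < μ) (hlam : 0 ≤ lam)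
    (hvisc : N = 1 → 0 < lam) (ha : 0 < a)
    (h0 : ∀ᵐ x ∂(volume.restrict Ω), relEnergy a γ (ρ 0 x) (u 0 x) (r 0 x) (U 0 x) = 0) :
    ∀ᵐ z ∂(volume.restrict (cylinder Ω T)),
      relEnergy a γ (ρ z.1 z.2) (u z.1 z.2) (r z.1 z.2) (U z.1 z.2) = 0 := by
  have hint := h.integrable_relEnergy hc hΩ hb hγ hq hpos ha.le
  have hnonneg : ∀ᵐ z ∂(volume.restrict (cylinder Ω T)),
      0 ≤ relEnergy a γ (ρ z.1 z.2) (u z.1 z.2) (r z.1 z.2) (U z.1 z.2) := by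
    filter_upwards [h.ae_nonneg_cylinder, ae_restrict_mem (isOpen_cylinder hΩ).measurableSet]
      with z hz hzc
    exact relEnergy_nonneg ha.le hγ hz
      (hpos z.1 (Ioo_subset_Icc_self hzc.1) z.2 (subset_closure hzc.2)) _ _
  obtain ⟨C, hC⟩ := h.exists_integral_remainder_sub_relDissipation_le hc hΩ hb hγ hq hpos
    hN hμ hlam hvisc ha
  have hgronwall : ∀ᵐ τ ∂(volume.restrict (Ioo 0 T)),
      ∫ x in Ω, relEnergy a γ (ρ τ x) (u τ x) (r τ x) (U τ x) ≤
        C * ∫ t in (0 : ℝ)..τ, ∫ x in Ω, relEnergy a γ (ρ t x) (u t x) (r t x) (U t x) := by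
    filter_upwards [h.ae_integral_relEnergy_le hc hΩ hb ha.le hγ hq hpos,
      ae_restrict_mem measurableSet_Ioo] with τ hτ hτT
    rw [intervalIntegral_eq_integral_cylinder hτT.1.le hτT.2.le hint]
    have hle := hτ.2
    rw [integral_eq_zero_of_ae h0, zero_add] at hle
    exact hle.trans (hC τ hτT)
  have hzero : ∫ z in cylinder Ω T,
      relEnergy a γ (ρ z.1 z.2) (u z.1 z.2) (r z.1 z.2) (U z.1 z.2) = 0 := by
    rw [← intervalIntegral_eq_integral_cylinder
      (f := fun t x => relEnergy a γ (ρ t x) (u t x) (r t x) (U t x)) hT le_rfl hint]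
    rw [restrict_cylinder] at hint hnonneg
    exact integral_eq_zero_of_ae_le_mul_integral hT hint.integral_prod_left
      ((Measure.ae_ae_of_ae_prod hnonneg).mono fun t ht => integral_nonneg_of_ae ht) hgronwall
  exact (integral_eq_zero_iff_of_nonneg_ae hnonneg hint).1 hzero

end Gronwall

end IsWeakSolutionWithGradient

end Uniqueness

end CompressibleNS

end

theorem theorem1_general {N : ℕ} (hN : 0 < N) {Ω : Set (CompressibleNS.Eucl N)} (hΩ : IsOpen Ω)
    (hb : Bornology.IsBounded Ω) {T : ℝ} (hT : 0 < T)
    {μ lam : ℝ} (hμ : 0 < μ) (hlam : 0 ≤ lam) (hvisc : N = 1 → 0 < lam)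
    {a γ : ℝ} (ha : 0 < a) (hγ : 1 < γ) {q : ℝ → ℝ} (hq : CompressibleNS.IsTestOnPos q)
    {ρ : ℝ → CompressibleNS.Eucl N → ℝ} {u : ℝ → CompressibleNS.Eucl N → CompressibleNS.Eucl N}
    (hw : CompressibleNS.IsDissipativeWeakSolution Ω T μ lam a γ q ρ u)
    {r : ℝ → CompressibleNS.Eucl N → ℝ} {U : ℝ → CompressibleNS.Eucl N → CompressibleNS.Eucl N}
    (hc : CompressibleNS.IsClassicalSolution Ω T μ lam a γ q r U)
    (hpos : ∀ x ∈ closure Ω, 0 < r 0 x)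
    (hρ0 : ∀ᵐ x ∂(volume.restrict Ω), ρ 0 x = r 0 x)
    (hm0 : ∀ᵐ x ∂(volume.restrict Ω), ρ 0 x • u 0 x = r 0 x • U 0 x) :
    ∀ᵐ z ∂(volume.restrict (CompressibleNS.cylinder Ω T)),
      ρ z.1 z.2 = r z.1 z.2 ∧ u z.1 z.2 = U z.1 z.2 := by
  obtain rfl | hne := Ω.eq_empty_or_nonempty
  · simp [CompressibleNS.cylinder]
  obtain ⟨Du, h⟩ := hw.exists_gradient
  have hrpos (t : ℝ) (ht : t ∈ Icc 0 T) (x : CompressibleNS.Eucl N) (hx : x ∈ closure Ω) :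
      0 < r t x := hc.density_pos hΩ hb hne hT hpos ht hx
  have hinit : ∀ᵐ x ∂(volume.restrict Ω),
      CompressibleNS.relEnergy a γ (ρ 0 x) (u 0 x) (r 0 x) (U 0 x) = 0 := by
    filter_upwards [hρ0, hm0, ae_restrict_mem hΩ.measurableSet] with x hρx hmx hx
    rw [hρx] at hmx ⊢
    rw [smul_right_injective _ (hpos x (subset_closure hx)).ne' hmx,
      CompressibleNS.relEnergy_self]
  filter_upwards [h.ae_relEnergy_eq_zero hc hΩ hb hγ hq hrpos hN hT.le hμ hlam hvisc ha hinit,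
    h.ae_nonneg_cylinder, ae_restrict_mem (CompressibleNS.isOpen_cylinder hΩ).measurableSet]
    with z hzero hρz hz
  exact CompressibleNS.eq_of_relEnergy_eq_zero ha hγ hρz
    (hrpos z.1 (Ioo_subset_Icc_self hz.1) z.2 (subset_closure hz.2)) hzero

theorem theorem1 (N : ℕ) (hN : N = 1 ∨ N = 2 ∨ N = 3)
    (Ω : Set (CompressibleNS.Eucl N)) (hΩ : CompressibleNS.IsBoundedLipschitzDomain Ω)
    (T : ℝ) (hT : 0 < T)
    (μ lam : ℝ) (hμ : 0 < μ) (hlam : 0 ≤ lam) (hvisc : N = 1 → 0 < lam)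
    (a γ : ℝ) (ha : 0 < a) (hγ : 1 < γ)
    (q : ℝ → ℝ) (hq : CompressibleNS.IsTestOnPos q)
    (ρ : ℝ → CompressibleNS.Eucl N → ℝ)
    (u : ℝ → CompressibleNS.Eucl N → CompressibleNS.Eucl N)
    (hw : CompressibleNS.IsDissipativeWeakSolution Ω T μ lam a γ q ρ u)
    (r : ℝ → CompressibleNS.Eucl N → ℝ)
    (U : ℝ → CompressibleNS.Eucl N → CompressibleNS.Eucl N)
    (hc : CompressibleNS.IsClassicalSolution Ω T μ lam a γ q r U)
    (hpos : ∀ x ∈ closure Ω, 0 < r 0 x)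
    (hρ0 : ∀ᵐ x ∂(volume.restrict Ω), ρ 0 x = r 0 x)
    (hm0 : ∀ᵐ x ∂(volume.restrict Ω), ρ 0 x • u 0 x = r 0 x • U 0 x) :
    ∀ᵐ z ∂(volume.restrict (CompressibleNS.cylinder Ω T)),
      ρ z.1 z.2 = r z.1 z.2 ∧ u z.1 z.2 = U z.1 z.2 := by
  have hN' : 0 < N := by omega
  exact theorem1_general hN' hΩ.isOpen hΩ.isBounded hT hμ hlam hvisc ha hγ hq hw hc hpos hρ0 hm0
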